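/- Work with randomized register machines with logarithmic (bit) cost. A program is a fixed while-program over finitely many registers that hold natural numbers; its instructions are: do nothing; load a fixed constant; add, subtract (truncated at $0$), multiply, divide with quotient or remainder two register contents; set a register to a fair random bit; append a letter to the output; and sequencing, branching and looping controlled by whether a register is nonzero. An arithmetic operation on $m,n$ is charged $(\ell(m)+1)(\ell(n)+1)$ units of time, where $\ell$ is the number of binary digits; loading a constant $m$, or testing a register containing $m$, is charged $\ell(m)+1$; every other step is charged $1$. A word is a finite sequence of letters, each denoting one of $\begin{pmatrix}1&1\\0&1\end{pmatrix}$, $\begin{pmatrix}1&0\\1&1\end{pmatrix}$ or one of their inverses. **Theorem 1.** There exist a single such program $A$ and constants $c_1, c_2$ such that for every $c_3<1$ there exists a constant $c_4$ with the following property. For every prime $p$ and every $g\in{\rm SL}_2(\mathbb F_p)$, the program $A$, run on input $p$ and the four entries of $g$ (each given by its representative in $\{0,\dots,p-1\}$; all other registers start at $0$), halts in time at most $c_4(\log p)^{c_2}$ and outputs a word that represents $g$ and has length at most $c_1\log p\,\log\log \max(p,3)$, with probability at least $c_3$. (For $p\ge 3$ the length bound is $c_1\log p\log\log p$.) -/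

import Mathlib

/-- The four letters of a word: the two generators and their inverses. -/
inductive Letter where
  | u
  | v
  | uInv
  | vInv

namespace Letter

/-- The upper unitriangular generator `(1 1; 0 1)`. -/
def upper (R : Type*) [CommRing R] : Matrix.SpecialLinearGroup (Fin 2) R :=
  ⟨!![1, 1; 0, 1], by simp [Matrix.det_fin_two]⟩

/-- The lower unitriangular generator `(1 0; 1 1)`. -/
def lower (R : Type*) [CommRing R] : Matrix.SpecialLinearGroup (Fin 2) R :=
  ⟨!![1, 0; 1, 1], by simp [Matrix.det_fin_two]⟩

/-- The group element denoted by a letter. -/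
def eval (R : Type*) [CommRing R] : Letter → Matrix.SpecialLinearGroup (Fin 2) R
  | u => upper R
  | v => lower R
  | uInv => (upper R)⁻¹
  | vInv => (lower R)⁻¹

/-- The group element denoted by a word. -/
def evalWord (R : Type*) [CommRing R] (w : List Letter) : Matrix.SpecialLinearGroup (Fin 2) R :=
  (w.map (eval R)).prod

end Letter

/-! ### Randomized register machines with logarithmic (bit) cost

Registers are indexed by `ℕ` and hold natural numbers of arbitrary size.  The time charged for an
instruction is a bound for its bit complexity with schoolbook arithmetic, so that running times are
those of a probabilistic Turing machine up to a polynomial. Randomness is available only as single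
fair coin flips. -/

namespace RandRAM

/-- Arithmetic operations on natural numbers. -/
inductive Op where
  | add
  | sub
  | mul
  | div
  | mod

/-- Semantics of the operations: `sub` is truncated, `div` and `mod` are quotient and remainder
(with `m / 0 = 0` and `m % 0 = m`). -/
def Op.eval : Op → ℕ → ℕ → ℕ
  | add, m, n => m + n
  | sub, m, n => m - n
  | mul, m, n => m * n
  | div, m, n => m / n
  | mod, m, n => m % n

/-- Programs. Registers are named by numerals that are part of the program text, so that a
program uses only finitely many of them. -/
inductive Prog where
  /-- do nothing -/
  | skip
  /-- `x := c` for a fixed numeral `c` -/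
  | const (x c : ℕ)
  /-- `x := y ∘ z` for an arithmetic operation `∘` -/
  | arith (o : Op) (x y z : ℕ)
  /-- `x :=` a fair random bit, independent of everything before -/
  | flip (x : ℕ)
  /-- append a letter to the output -/
  | emit (l : Letter)
  /-- run `P`, then `Q` -/
  | seq (P Q : Prog)
  /-- if register `x` is nonzero run `P`, otherwise run `Q` -/
  | ite (x : ℕ) (P Q : Prog)
  /-- while register `x` is nonzero run `P` -/
  | loop (x : ℕ) (P : Prog)

/-- A configuration of the machine. -/
structure Config where
  /-- the programs that remain to be run, in this order; the machine has halted when none is left -/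
  todo : List Prog
  /-- contents of the registers -/
  reg : ℕ → ℕ
  /-- output written so far -/
  out : List Letter
  /-- time used so far -/
  time : ℕ

/-- One step of the machine: a probability distribution on successor configurations.  Here
`Nat.size n` is the number of binary digits of `n`. -/
noncomputable def step : Config → PMF Config
  | ⟨[], r, w, t⟩ => PMF.pure ⟨[], r, w, t⟩
  | ⟨.skip :: k, r, w, t⟩ => PMF.pure ⟨k, r, w, t + 1⟩
  | ⟨.const x c :: k, r, w, t⟩ =>
      PMF.pure ⟨k, Function.update r x c, w, t + (c.size + 1)⟩
  | ⟨.arith o x y z :: k, r, w, t⟩ =>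
      PMF.pure ⟨k, Function.update r x (o.eval (r y) (r z)), w,
        t + ((r y).size + 1) * ((r z).size + 1)⟩
  | ⟨.flip x :: k, r, w, t⟩ =>
      (PMF.uniformOfFintype Bool).map fun b =>
        ⟨k, Function.update r x (if b then 1 else 0), w, t + 1⟩
  | ⟨.emit l :: k, r, w, t⟩ => PMF.pure ⟨k, r, w ++ [l], t + 1⟩
  | ⟨.seq P Q :: k, r, w, t⟩ => PMF.pure ⟨P :: Q :: k, r, w, t + 1⟩
  | ⟨.ite x P Q :: k, r, w, t⟩ =>
      PMF.pure ⟨(if r x = 0 then Q else P) :: k, r, w, t + ((r x).size + 1)⟩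
  | ⟨.loop x P :: k, r, w, t⟩ =>
      PMF.pure ⟨if r x = 0 then k else P :: .loop x P :: k, r, w, t + ((r x).size + 1)⟩

/-- The distribution of the configuration after `n` steps. -/
noncomputable def run : ℕ → Config → PMF Config
  | 0, c => PMF.pure c
  | n + 1, c => (step c).bind (run n)

/-- The probability that the program `A`, started with registers `r`, no output and time zero,
halts in time at most `T` with an output in `S`.  Halted configurations do not change any more, so
that the supremum is the limit as the number of steps goes to infinity. -/
noncomputable def successProb (A : Prog) (r : ℕ → ℕ) (T : ℝ) (S : Set (List Letter)) : ENNReal :=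
  ⨆ n : ℕ, (run n ⟨[A], r, [], 0⟩).toOuterMeasure
    {c | c.todo = [] ∧ (c.time : ℝ) ≤ T ∧ c.out ∈ S}

/-- The input `(p, g)`: register `0` holds `p`, registers `1, 2, 3, 4` hold the entries of the
matrix `g` row by row, each as its representative in `{0, …, p - 1}`; all others hold `0`. -/
def input (p : ℕ) (g : Matrix.SpecialLinearGroup (Fin 2) (ZMod p)) : ℕ → ℕ
  | 0 => p
  | 1 => (g.1 0 0).val
  | 2 => (g.1 0 1).val
  | 3 => (g.1 1 0).val
  | 4 => (g.1 1 1).val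
  | _ => 0

end RandRAM

/-! The heart of the matter is to write unipotent elements as short words. Let `a` be a nonzero
residue and `x` a lift of `a` with `0 < x < p ^ 3`. Then `x` is coprime to `p ^ 3`, and running the
Euclidean algorithm on `(x, p ^ 3)` backwards gives a positive word in the two generators whose
integer matrix has first column `(x, p ^ 3)`. Its length is the sum of the partial quotients. Modulo
`p` the column is `(a, 0)`, so conjugating `(1 1; 0 1)` or its inverse by the word gives the upper
unitriangular matrix with entry `a ^ 2` or `-a ^ 2` (`Letter.evalWord_exponentWord_apply`,
`Letter.conj_unip`). Every residue is a difference of two squares, and an element whose lower left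
entry is nonzero is a product of three unipotents with Weyl elements in between
(`Letter.eq_unip_mul`); if that entry is zero, one further generator repairs this. Hence six
conjugates and a bounded number of letters suffice.

It remains to find a lift with small partial quotients. A partial quotient `q` belongs to a
continuant `s` with `s * x` congruent to `± t` modulo `p ^ 3` and `q * s * t ≤ p ^ 3`, so it yields
one element of `approxSet (p ^ 3) ε x j` for each `j ≤ q`. Different quotients of the same sign
belong to different `s` (`EuclidTrace.quotientSum_le_eventCount`). On average over the `p ^ 2` lifts
of `a`, the set for a given `j ≤ p` has `O(log p / j)` elements (`sum_card_approxFinset_le`). With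
`J` a large multiple of `log p`, for most lifts the set for `j = J` is empty, and summing `1 / j`
over `j < J` leaves an average of `O(log p * log log p)`. By Markov's inequality at most a quarter
of the lifts have a larger quotient sum than a constant times this (`four_mul_card_isBadLift_le`).

The machine draws lifts from random bits until one passes the test. Each trial succeeds with
probability at least one half, the slight non-uniformity included. The loop is unbounded, so one
program serves every `c₃`; only the number `m` of trials in the analysis, and with it `c₄`, depends
on `c₃`. The program is verified in a small program logic: `Exec` for deterministic parts, `Hoare`
for parts that succeed with a given probability. -/

namespace RandRAM

open scoped ENNReal

/-! ### Halting probabilities and a program logic -/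

/-- The probability of halting in a configuration that satisfies `G`. -/
noncomputable def haltProb (G : Config → Prop) (c : Config) : ℝ≥0∞ :=
  ⨆ n : ℕ, (run n c).toOuterMeasure {c' | c'.todo = [] ∧ G c'}

theorem run_succ_apply (n : ℕ) (c : Config) (s : Set Config) :
    (run (n + 1) c).toOuterMeasure s = ∑' c', step c c' * (run n c').toOuterMeasure s := by
  simp only [run, PMF.toOuterMeasure_bind_apply]

/-- Halted configurations are fixed by `step`, so success, once reached, persists. -/
theorem run_mono_succ (G : Config → Prop) (n : ℕ) (c : Config) :
    (run n c).toOuterMeasure {c' | c'.todo = [] ∧ G c'} ≤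
      (run (n + 1) c).toOuterMeasure {c' | c'.todo = [] ∧ G c'} := by
  induction n generalizing c with
  | zero =>
    by_cases h : c.todo = []
    · obtain ⟨k, r, w, t⟩ := c
      obtain rfl : k = [] := h
      simp [run, step]
    · have : (run 0 c).toOuterMeasure {c' | c'.todo = [] ∧ G c'} = 0 := by
        simp [run, h]
      rw [this]
      exact zero_le
  | succ n ih =>
    rw [run_succ_apply, run_succ_apply (n + 1)]
    exact ENNReal.tsum_le_tsum fun c' => mul_le_mul_right (ih c') _

theorem run_mono (G : Config → Prop) (c : Config) :
    Monotone fun n => (run n c).toOuterMeasure {c' | c'.todo = [] ∧ G c'} :=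
  monotone_nat_of_le_succ fun n => run_mono_succ G n c

theorem le_haltProb_of_step_eq_pure {G : Config → Prop} {c c' : Config}
    (h : step c = PMF.pure c') : haltProb G c' ≤ haltProb G c := by
  refine iSup_le fun n => le_trans (le_of_eq ?_) (le_iSup _ (n + 1))
  simp only [run, h, PMF.pure_bind]

/-- Monotonicity in the number of steps allows the two suprema to be taken along the same `n`, so
that their sum is the supremum of the sums. -/
theorem le_haltProb_flip (G : Config → Prop) (x : ℕ) (k : List Prog) (r : ℕ → ℕ)
    (w : List Letter) (t : ℕ) :
    2⁻¹ * haltProb G ⟨k, Function.update r x 0, w, t + 1⟩ +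
      2⁻¹ * haltProb G ⟨k, Function.update r x 1, w, t + 1⟩ ≤
        haltProb G ⟨.flip x :: k, r, w, t⟩ := by
  unfold haltProb
  rw [ENNReal.mul_iSup, ENNReal.mul_iSup, ENNReal.iSup_add_iSup_of_monotone]
  · refine iSup_le fun n => le_trans (le_of_eq ?_) (le_iSup _ (n + 1))
    simp only [run, step, PMF.bind_map, PMF.toOuterMeasure_bind_apply]
    rw [tsum_bool]
    simp [PMF.uniformOfFintype_apply]
  · exact fun a b hab => mul_le_mul_right (run_mono G _ hab) _
  · exact fun a b hab => mul_le_mul_right (run_mono G _ hab) _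

theorem one_le_haltProb_of_halted {G : Config → Prop} {r : ℕ → ℕ} {w : List Letter} {t : ℕ}
    (h : G ⟨[], r, w, t⟩) : 1 ≤ haltProb G ⟨[], r, w, t⟩ := by
  refine le_trans (le_of_eq ?_) (le_iSup _ 0)
  simp [run, h]

/-- Run on registers `r`, the program `P` halts with registers `r'`, having written `o`; it takes
time at most `n * (B + 1) ^ 2` and uses no randomness. -/
def Exec (B : ℕ) (P : Prog) (r r' : ℕ → ℕ) (o : List Letter) (n : ℕ) : Prop :=
  ∃ T ≤ n * (B + 1) ^ 2, ∀ (k : List Prog) (w : List Letter) (t : ℕ) (G : Config → Prop),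
    haltProb G ⟨k, r', w ++ o, t + T⟩ ≤ haltProb G ⟨P :: k, r, w, t⟩

namespace Exec

variable {B : ℕ} {P Q : Prog} {r r' r₁ r₂ : ℕ → ℕ} {o o₁ o₂ : List Letter} {n n' n₁ n₂ x : ℕ}

theorem mono (h : Exec B P r r' o n) (hn : n ≤ n') : Exec B P r r' o n' := by
  obtain ⟨T, hT, H⟩ := h
  exact ⟨T, hT.trans (Nat.mul_le_mul_right _ hn), H⟩

theorem skip (r : ℕ → ℕ) : Exec B .skip r r [] 1 :=
  ⟨1, by nlinarith [Nat.zero_le B], fun k w t G =>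
    le_haltProb_of_step_eq_pure (by simp [step])⟩

theorem const (r : ℕ → ℕ) {c : ℕ} (hc : c.size ≤ B) :
    Exec B (.const x c) r (Function.update r x c) [] 1 :=
  ⟨c.size + 1, by nlinarith, fun k w t G =>
    le_haltProb_of_step_eq_pure (by simp [step])⟩

theorem arith (op : Op) {y z : ℕ} (hy : (r y).size ≤ B) (hz : (r z).size ≤ B) :
    Exec B (.arith op x y z) r (Function.update r x (op.eval (r y) (r z))) [] 1 :=
  ⟨((r y).size + 1) * ((r z).size + 1), by nlinarith, fun k w t G =>
    le_haltProb_of_step_eq_pure (by simp [step])⟩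

theorem emit (l : Letter) (r : ℕ → ℕ) : Exec B (.emit l) r r [l] 1 :=
  ⟨1, by nlinarith [Nat.zero_le B], fun k w t G =>
    le_haltProb_of_step_eq_pure (by simp [step])⟩

theorem seq (hP : Exec B P r r₁ o₁ n₁) (hQ : Exec B Q r₁ r₂ o₂ n₂) :
    Exec B (.seq P Q) r r₂ (o₁ ++ o₂) (n₁ + n₂ + 1) := by
  obtain ⟨T₁, hT₁, H₁⟩ := hP
  obtain ⟨T₂, hT₂, H₂⟩ := hQ
  refine ⟨1 + T₁ + T₂, by nlinarith [Nat.zero_le B], fun k w t G => ?_⟩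
  refine le_trans (le_trans ?_ (H₂ k (w ++ o₁) (t + 1 + T₁) G)) (le_trans (H₁ (Q :: k) w (t + 1) G)
    (le_haltProb_of_step_eq_pure (by simp [step])))
  simp [add_assoc]

theorem ite_pos (hx : r x ≠ 0) (hB : (r x).size ≤ B) (hP : Exec B P r r' o n) :
    Exec B (.ite x P Q) r r' o (n + 1) := by
  obtain ⟨T, hT, H⟩ := hP
  refine ⟨((r x).size + 1) + T, by nlinarith [Nat.zero_le B], fun k w t G => ?_⟩
  rw [← add_assoc]
  exact le_trans (H k w _ G) (le_haltProb_of_step_eq_pure (by simp [step, hx]))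

theorem ite_neg (hx : r x = 0) (hQ : Exec B Q r r' o n) :
    Exec B (.ite x P Q) r r' o (n + 1) := by
  obtain ⟨T, hT, H⟩ := hQ
  refine ⟨1 + T, by nlinarith [Nat.zero_le B], fun k w t G => ?_⟩
  rw [← add_assoc]
  exact le_trans (H k w _ G) (le_haltProb_of_step_eq_pure (by simp [step, hx]))

theorem loop_zero (hx : r x = 0) : Exec B (.loop x P) r r [] 1 :=
  ⟨1, by nlinarith [Nat.zero_le B], fun k w t G =>
    le_haltProb_of_step_eq_pure (by simp [step, hx])⟩

theorem loop_step (hx : r x ≠ 0) (hB : (r x).size ≤ B) (hP : Exec B P r r₁ o₁ n₁)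
    (hL : Exec B (.loop x P) r₁ r₂ o₂ n₂) :
    Exec B (.loop x P) r r₂ (o₁ ++ o₂) (n₁ + n₂ + 1) := by
  obtain ⟨T₁, hT₁, H₁⟩ := hP
  obtain ⟨T₂, hT₂, H₂⟩ := hL
  refine ⟨((r x).size + 1) + T₁ + T₂, by nlinarith [Nat.zero_le B], fun k w t G => ?_⟩
  refine le_trans (le_trans ?_ (H₂ k (w ++ o₁) (t + ((r x).size + 1) + T₁) G))
    (le_trans (H₁ (.loop x P :: k) w (t + ((r x).size + 1)) G)
      (le_haltProb_of_step_eq_pure (by simp [step, hx])))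
  simp [add_assoc]

end Exec

/-- Run on registers `r`, the program `P` halts with probability at least `q` in time at most
`n * (B + 1) ^ 2` with registers and output that satisfy `Post`. -/
def Hoare (B : ℕ) (q : ℝ≥0∞) (P : Prog) (r : ℕ → ℕ) (n : ℕ)
    (Post : (ℕ → ℕ) → List Letter → Prop) : Prop :=
  ∀ (k : List Prog) (w : List Letter) (t : ℕ) (G : Config → Prop) (β : ℝ≥0∞),
    (∀ r' o T, T ≤ n * (B + 1) ^ 2 → Post r' o → β ≤ haltProb G ⟨k, r', w ++ o, t + T⟩) →
      q * β ≤ haltProb G ⟨P :: k, r, w, t⟩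

theorem Exec.hoare {B : ℕ} {P : Prog} {r r' : ℕ → ℕ} {o : List Letter} {n : ℕ}
    {Post : (ℕ → ℕ) → List Letter → Prop}
    (h : Exec B P r r' o n) (hpost : Post r' o) : Hoare B 1 P r n Post := by
  obtain ⟨T, hT, H⟩ := h
  intro k w t G β hβ
  rw [one_mul]
  exact (hβ r' o T hT hpost).trans (H k w t G)

namespace Hoare

variable {B : ℕ} {P Q : Prog} {r : ℕ → ℕ} {n n' n₁ n₂ x : ℕ} {q q' q₁ q₂ : ℝ≥0∞}
  {Post Post' Mid : (ℕ → ℕ) → List Letter → Prop}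

theorem mono (h : Hoare B q P r n Post) (hq : q' ≤ q) (hn : n ≤ n')
    (hp : ∀ r' o, Post r' o → Post' r' o) : Hoare B q' P r n' Post' := by
  intro k w t G β hβ
  refine le_trans (mul_le_mul_left hq β) (h k w t G β fun r' o T hT ho => ?_)
  exact hβ r' o T (hT.trans (Nat.mul_le_mul_right _ hn)) (hp _ _ ho)

/-- Because `Hoare` quantifies over all lower bounds `β` for the continuation, the statement for `P`
can be used with `q₂ * β` in place of `β`; this is how success probabilities multiply. -/
theorem seq (hP : Hoare B q₁ P r n₁ Mid)
    (hQ : ∀ r₁ o₁, Mid r₁ o₁ → Hoare B q₂ Q r₁ n₂ fun r₂ o₂ => Post r₂ (o₁ ++ o₂)) :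
    Hoare B (q₁ * q₂) (.seq P Q) r (n₁ + n₂ + 1) Post := by
  intro k w t G β hβ
  refine le_trans ?_ (le_haltProb_of_step_eq_pure (c' := ⟨P :: Q :: k, r, w, t + 1⟩)
    (by simp [step]))
  rw [mul_assoc]
  refine hP _ _ _ _ _ fun r₁ o₁ T₁ hT₁ h₁ => ?_
  refine hQ r₁ o₁ h₁ _ _ _ _ _ fun r₂ o₂ T₂ hT₂ h₂ => ?_
  have := hβ r₂ (o₁ ++ o₂) (1 + T₁ + T₂) (by nlinarith [Nat.zero_le B]) h₂
  simpa [add_assoc] using this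

theorem ite_pos (hx : r x ≠ 0) (hB : (r x).size ≤ B) (hP : Hoare B q P r n Post) :
    Hoare B q (.ite x P Q) r (n + 1) Post := by
  intro k w t G β hβ
  refine le_trans ?_ (le_haltProb_of_step_eq_pure
    (c' := ⟨P :: k, r, w, t + ((r x).size + 1)⟩) (by simp [step, hx]))
  refine hP _ _ _ _ _ fun r₁ o₁ T₁ hT₁ h₁ => ?_
  rw [add_assoc]
  exact hβ _ _ _ (by nlinarith [Nat.zero_le B]) h₁

theorem ite_neg (hx : r x = 0) (hQ : Hoare B q Q r n Post) :
    Hoare B q (.ite x P Q) r (n + 1) Post := by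
  intro k w t G β hβ
  refine le_trans ?_ (le_haltProb_of_step_eq_pure
    (c' := ⟨Q :: k, r, w, t + ((r x).size + 1)⟩) (by simp [step, hx]))
  refine hQ _ _ _ _ _ fun r₁ o₁ T₁ hT₁ h₁ => ?_
  rw [add_assoc]
  exact hβ _ _ _ (by simp [hx]; nlinarith [Nat.zero_le B]) h₁

/-- The case of an empty continuation and `β = 1`. -/
theorem le_successProb {T : ℝ} {S : Set (List Letter)} (h : Hoare B q P r n Post)
    (hT : ((n * (B + 1) ^ 2 : ℕ) : ℝ) ≤ T) (hS : ∀ r' o, Post r' o → o ∈ S) :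
    q ≤ successProb P r T S := by
  have := h [] [] 0 (fun c => (c.time : ℝ) ≤ T ∧ c.out ∈ S) 1 fun r' o T' hT' ho => by
    refine one_le_haltProb_of_halted ⟨?_, ?_⟩
    · exact le_trans (by simpa using (Nat.cast_le (α := ℝ)).2 hT') hT
    · simpa using hS _ _ ho
  simpa [haltProb, successProb] using this

end Hoare

end RandRAM

/-! ### Harmonic sums and the average number of good approximations -/

/-- The harmonic sum in dyadic blocks: each block `[2 ^ k, 2 ^ (k + 1))` contributes at most `M`. -/
theorem Nat.sum_div_le_mul_size (M n : ℕ) : ∑ i ∈ Finset.Icc 1 n, M / i ≤ M * n.size := by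
  have key : ∀ k : ℕ, ∑ i ∈ Finset.Ico 1 (2 ^ k), M / i ≤ M * k := by
    intro k
    induction k with
    | zero => simp
    | succ k ih =>
      rw [← Finset.sum_Ico_consecutive _ Nat.one_le_two_pow
        (Nat.pow_le_pow_right two_pos k.le_succ)]
      have : ∑ i ∈ Finset.Ico (2 ^ k) (2 ^ (k + 1)), M / i ≤ M := by
        calc _ ≤ ∑ i ∈ Finset.Ico (2 ^ k) (2 ^ (k + 1)), M / 2 ^ k :=
              Finset.sum_le_sum fun i hi =>
                Nat.div_le_div_left (Finset.mem_Ico.1 hi).1 (by positivity)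
          _ = 2 ^ k * (M / 2 ^ k) := by
              rw [Finset.sum_const, Nat.card_Ico, smul_eq_mul]
              congr 1
              rw [pow_succ]; omega
          _ ≤ M := Nat.mul_div_le _ _
      rw [mul_add, mul_one]
      exact add_le_add ih this
  refine le_trans (Finset.sum_le_sum_of_subset fun i hi => ?_) (key n.size)
  rw [Finset.mem_Icc] at hi
  exact Finset.mem_Ico.2 ⟨hi.1, hi.2.trans_lt n.lt_size_self⟩

theorem Nat.size_mul_le (m n : ℕ) : (m * n).size ≤ m.size + n.size := by
  rw [Nat.size_le, pow_add]
  exact Nat.mul_lt_mul'' m.lt_size_self n.lt_size_self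

/-- The positive `s` for which `s * x` is congruent to `ε * t` modulo `y`, for some positive `t` with
`j * s * t ≤ y`. -/
def approxSet (y : ℕ) (ε : ℤ) (x j : ℕ) : Set ℕ :=
  {s | 1 ≤ s ∧ ∃ t : ℕ, 1 ≤ t ∧ j * (s * t) ≤ y ∧ (y : ℤ) ∣ s * x - ε * t}

open Classical in
/-- The elements of `approxSet` as a finite set. -/
noncomputable def approxFinset (y : ℕ) (ε : ℤ) (x j : ℕ) : Finset ℕ :=
  (Finset.Icc 1 y).filter (· ∈ approxSet y ε x j)

section Counting

variable {p : ℕ}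

theorem eq_of_dvd_sub_of_lt {m x x' : ℕ} (hx : x < m) (hx' : x' < m)
    (h : (m : ℤ) ∣ (x : ℤ) - x') : x = x' := by
  have := Int.eq_zero_of_abs_lt_dvd h (by rw [abs_lt]; omega)
  omega

/-- On a residue class modulo `p` the quotient by `p` is injective. -/
theorem card_residue_class_le (M : ℕ) (c : ℤ) :
    ((Finset.Icc 1 M).filter fun t : ℕ => (p : ℤ) ∣ t - c).card ≤ M / p + 1 := by
  rw [← Finset.card_range (M / p + 1)]
  refine Finset.card_le_card_of_injOn (· / p) (fun t ht => ?_) fun t ht t' ht' h => ?_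
  · simp only [Finset.coe_filter, Finset.mem_Icc, Set.mem_ofPred_eq] at ht
    simpa [Nat.lt_succ_iff] using Nat.div_le_div_right ht.1.2
  · simp only [Finset.coe_filter, Finset.mem_Icc, Set.mem_ofPred_eq] at ht ht'
    have h₁ : (p : ℤ) ∣ (t : ℤ) - t' := by simpa using dvd_sub ht.2 ht'.2
    have h₂ : t ≡ t' [MOD p] := ((Nat.modEq_iff_dvd).2 (by simpa using (dvd_neg.2 h₁)))
    rw [← Nat.div_add_mod t p, ← Nat.div_add_mod t' p, h₂]
    simp only at h
    rw [h]

/-- Starting the interval at `p` excludes the quotient `0`, which saves the extra `1` of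
`card_residue_class_le`. -/
theorem card_residue_class_Icc_le (hp : 0 < p) (M : ℕ) (c a : ℤ)
    (ha : IsCoprime (p : ℤ) a) :
    ((Finset.Icc p M).filter fun s : ℕ => (p : ℤ) ∣ c - s * a).card ≤ M / p := by
  have : M / p = (Finset.Icc 1 (M / p)).card := by simp
  rw [this]
  refine Finset.card_le_card_of_injOn (· / p) (fun t ht => ?_) fun t ht t' ht' h => ?_
  · simp only [Finset.coe_filter, Finset.mem_Icc, Set.mem_ofPred_eq] at ht
    simpa using ⟨(Nat.one_le_div_iff hp).2 ht.1.1, Nat.div_le_div_right ht.1.2⟩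
  · simp only [Finset.coe_filter, Finset.mem_Icc, Set.mem_ofPred_eq] at ht ht'
    have h₁ : (p : ℤ) ∣ ((t : ℤ) - t') * a := by
      exact (dvd_sub ht'.2 ht.2).trans (Eq.dvd (by ring))
    have h₁ := ha.dvd_of_dvd_mul_right h₁
    have h₂ : t ≡ t' [MOD p] := ((Nat.modEq_iff_dvd).2 (by simpa using (dvd_neg.2 h₁)))
    rw [← Nat.div_add_mod t p, ← Nat.div_add_mod t' p, h₂]
    simp only at h
    rw [h]

/-- The natural numbers below `p ^ 3` that are congruent to `a` modulo `p`. -/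
def lifts (p a : ℕ) : Finset ℕ := (Finset.range (p ^ 3)).filter fun x => (p : ℤ) ∣ x - a

open Classical in
-- Reduction modulo `p` ties `t` to `ε * s * a`, and since `s` is invertible modulo `p ^ 3`, the
-- pair `(s, t)` determines `x`. So it is enough to count lattice points under the hyperbola `s * t
-- ≤ p ^ 3 / j` on a line modulo `p`. For `s < p` the count is over `t` with `s` fixed; for `s ≥ p`
-- it is over `s` with `t` fixed. In this way the rounding errors add up to at most about `p`.
theorem card_coprime_le (hp : p.Prime) {a : ℕ} (ε : ℤ) (hε : ε = 1 ∨ ε = -1) (j : ℕ) (hj : 1 ≤ j) :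
    ((lifts p a ×ˢ Finset.Icc 1 (p ^ 3)).filter fun z : ℕ × ℕ =>
      ¬ p ∣ z.2 ∧ z.2 ∈ approxSet (p ^ 3) ε z.1 j).card ≤
    (((Finset.Ico 1 p).sigma fun s => (Finset.Icc 1 (p ^ 3 / j / s)).filter
        fun t : ℕ => (p : ℤ) ∣ t - ε * s * a).card) +
      ((Finset.Icc 1 (p ^ 3 / j / p)).sigma fun t => (Finset.Icc p (p ^ 3 / j / t)).filter
        fun s : ℕ => (p : ℤ) ∣ t - s * (ε * a)).card := by
  rw [← Finset.card_disjSum]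
  refine Finset.card_le_card_of_forall_subsingleton
    (fun z w => ∃ s t : ℕ, (w = Sum.inl ⟨s, t⟩ ∨ w = Sum.inr ⟨t, s⟩) ∧ z.2 = s ∧
      ((p ^ 3 : ℕ) : ℤ) ∣ s * z.1 - ε * t) ?_ ?_
  · rintro ⟨x, s⟩ hz
    rw [Finset.mem_filter] at hz
    simp only [lifts, Finset.mem_filter, Finset.mem_product, Finset.mem_range, approxSet,
      Set.mem_ofPred_eq, Finset.mem_Icc] at hz
    obtain ⟨⟨⟨hx, hxa⟩, hs, -⟩, hps, -, t, ht, hle, hd⟩ := hz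
    have hst : s * t ≤ p ^ 3 / j := (Nat.le_div_iff_mul_le hj).2 (by rw [mul_comm]; exact hle)
    have hdp : (p : ℤ) ∣ s * x - ε * t :=
      dvd_trans (by push_cast; exact dvd_pow_self _ (by norm_num)) hd
    have hε2 : ε * ε = 1 := by rcases hε with rfl | rfl <;> norm_num
    have hc : (p : ℤ) ∣ t - ε * s * a := by
      have h1 := dvd_sub (hxa.mul_left (ε * s)) (hdp.mul_left ε)
      exact h1.trans (Eq.dvd (by linear_combination (t : ℤ) * hε2))
    by_cases hsp : s < p
    · refine ⟨Sum.inl ⟨s, t⟩, ?_, s, t, Or.inl rfl, rfl, hd⟩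
      simp only [Finset.inl_mem_disjSum, Finset.mem_sigma, Finset.mem_Ico, Finset.mem_filter,
        Finset.mem_Icc]
      exact ⟨⟨hs, hsp⟩, ⟨ht, (Nat.le_div_iff_mul_le hs).2 (by rwa [mul_comm])⟩, hc⟩
    · refine ⟨Sum.inr ⟨t, s⟩, ?_, s, t, Or.inr rfl, rfl, hd⟩
      simp only [Finset.inr_mem_disjSum, Finset.mem_sigma, Finset.mem_filter, Finset.mem_Icc]
      refine ⟨⟨ht, (Nat.le_div_iff_mul_le hp.pos).2 ?_⟩, ⟨by omega,
        (Nat.le_div_iff_mul_le ht).2 hst⟩, ?_⟩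
      · rw [mul_comm]; exact le_trans (Nat.mul_le_mul_right _ (by omega)) hst
      · exact hc.trans (Eq.dvd (by ring))
  · rintro w - ⟨x, s⟩ ⟨hz, s₁, t₁, hw, rfl, hd⟩ ⟨x', s'⟩ ⟨hz', s₂, t₂, hw', rfl, hd'⟩
    simp only at hw hw' hd hd'
    have hst : s = s' ∧ t₁ = t₂ := by
      rcases hw with rfl | rfl <;> rcases hw' with h | h <;> simp at h <;> tauto
    obtain ⟨rfl, rfl⟩ := hst
    simp only [lifts, Finset.mem_filter, Finset.mem_product, Finset.mem_range] at hz hz'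
    have h1 : ((p ^ 3 : ℕ) : ℤ) ∣ s * ((x : ℤ) - x') := by
      exact (dvd_sub hd hd').trans (Eq.dvd (by ring))
    have hcop : IsCoprime ((p ^ 3 : ℕ) : ℤ) (s : ℤ) :=
      Nat.isCoprime_iff_coprime.2 (((hp.coprime_iff_not_dvd).2 hz.2.1).pow_left 3)
    have := eq_of_dvd_sub_of_lt hz.1.1.1 hz'.1.1.1 (hcop.dvd_of_dvd_mul_left h1)
    rw [this]

open Classical in
-- If `p` divides `s`, it divides `t`, and dividing both by `p` leaves a congruence modulo `p ^ 2`.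
-- The new `s` is prime to `p`, so it and the new `t` determine `x` modulo `p ^ 2`; the factor
-- `Finset.range p` records `x / p ^ 2`.
theorem card_dvd_le (hp : p.Prime) {a : ℕ} (ε : ℤ) (hε : ε = 1 ∨ ε = -1) (j : ℕ) (hj : 1 ≤ j) :
    ((lifts p a ×ˢ Finset.Icc 1 (p ^ 3)).filter fun z : ℕ × ℕ =>
      p ∣ z.2 ∧ z.2 ∈ approxSet (p ^ 3) ε z.1 j).card ≤
    (((Finset.Icc 1 (p ^ 3 / j / p ^ 2)).sigma fun s =>
      Finset.Icc 1 (p ^ 3 / j / p ^ 2 / s)) ×ˢ Finset.range p).card := by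
  have hp0 := hp.pos
  refine Finset.card_le_card_of_forall_subsingleton
    (fun z w => z.2 = p * w.1.1 ∧ z.1 / p ^ 2 = w.2 ∧ ¬ p ∣ w.1.1 ∧
      ((p ^ 2 : ℕ) : ℤ) ∣ w.1.1 * z.1 - ε * w.1.2) ?_ ?_
  · rintro ⟨x, s⟩ hz
    rw [Finset.mem_filter] at hz
    simp only [lifts, Finset.mem_filter, Finset.mem_product, Finset.mem_range, approxSet,
      Set.mem_ofPred_eq, Finset.mem_Icc] at hz
    obtain ⟨⟨⟨hx, hxa⟩, hs, -⟩, ⟨s, rfl⟩, -, t, ht, hle, hd⟩ := hz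
    have hε2 : ε * ε = 1 := by rcases hε with rfl | rfl <;> norm_num
    have dvd_t : ∀ m : ℕ, ∀ z : ℤ, (m : ℤ) ∣ z → (m : ℤ) ∣ z - ε * t → m ∣ t := by
      intro m z h1 h2
      have : (m : ℤ) ∣ (t : ℤ) := by
        have := (dvd_sub h1 h2).mul_left ε
        exact this.trans (Eq.dvd (by linear_combination (t : ℤ) * hε2))
      exact_mod_cast this
    obtain ⟨t, rfl⟩ : p ∣ t := by
      refine dvd_t p _ (Dvd.dvd.mul_right ?_ _) (dvd_trans ?_ hd)
      · exact_mod_cast Nat.dvd_mul_right p s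
      · exact_mod_cast dvd_pow_self p (by norm_num)
    have hs0 : 0 < s := Nat.pos_of_ne_zero (by rintro rfl; simp at hs)
    have ht0 : 0 < t := Nat.pos_of_ne_zero (by rintro rfl; simp at ht)
    have hst : s * t ≤ p ^ 3 / j / p ^ 2 := by
      rw [Nat.le_div_iff_mul_le (by positivity), Nat.le_div_iff_mul_le hj]
      calc _ = j * (p * s * (p * t)) := by ring
        _ ≤ _ := hle
    have hstp : s * t ≤ p := by
      refine hst.trans ?_
      calc _ ≤ p ^ 3 / p ^ 2 := Nat.div_le_div_right (Nat.div_le_self _ _)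
        _ = p := by rw [pow_succ p 2, Nat.mul_div_cancel_left _ (by positivity)]
    have hd2 : ((p ^ 2 : ℕ) : ℤ) ∣ s * x - ε * t := by
      have : ((p : ℤ) * (p ^ 2 : ℕ)) ∣ p * (s * x - ε * t) := by
        convert hd using 1 <;> push_cast <;> ring
      exact Int.dvd_of_mul_dvd_mul_left (by exact_mod_cast hp0.ne') this
    refine ⟨(⟨s, t⟩, x / p ^ 2), ?_, rfl, rfl, ?_, hd2⟩
    · simp only [Finset.mem_product, Finset.mem_sigma, Finset.mem_Icc, Finset.mem_range]
      refine ⟨⟨⟨hs0, le_trans (Nat.le_mul_of_pos_right _ ht0) hst⟩, ht0,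
        (Nat.le_div_iff_mul_le hs0).2 (by rwa [mul_comm])⟩, ?_⟩
      rw [Nat.div_lt_iff_lt_mul (by positivity)]
      calc x < p ^ 3 := hx
        _ = _ := by ring
    -- A second factor `p` in `s` would again force one in `t`, so the product of the reduced
    -- numbers would be at least `p ^ 2`, against `hstp`.
    · rintro ⟨s, rfl⟩
      have hdp : ((p : ℕ) : ℤ) ∣ ((p * s : ℕ) : ℤ) * x - ε * t :=
        dvd_trans (by exact_mod_cast dvd_pow_self p (by norm_num)) hd2
      obtain ⟨t, rfl⟩ : p ∣ t := by
        have hz : ((p : ℕ) : ℤ) ∣ ((p * s : ℕ) : ℤ) * x :=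
          Dvd.dvd.mul_right (by exact_mod_cast Nat.dvd_mul_right p s) _
        have : (p : ℤ) ∣ (t : ℤ) := by
          have := (dvd_sub hz hdp).mul_left ε
          exact this.trans (Eq.dvd (by linear_combination (t : ℤ) * hε2))
        exact_mod_cast this
      have hs1 : 0 < s := Nat.pos_of_ne_zero (by rintro rfl; simp at hs0)
      have ht1 : 0 < t := Nat.pos_of_ne_zero (by rintro rfl; simp at ht0)
      have h2 := hp.two_le
      have : 1 ≤ s * t := Nat.mul_pos hs1 ht1
      have : p * s * (p * t) = p * p * (s * t) := by ring
      nlinarith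
  · rintro ⟨⟨s, t⟩, m⟩ - ⟨x, s₁⟩ ⟨hz, rfl, h2, h3, hd⟩ ⟨x', s₂⟩ ⟨hz', rfl, h2', -, hd'⟩
    simp only at h2 h2' h3 hd hd'
    have h1 : ((p ^ 2 : ℕ) : ℤ) ∣ s * ((x : ℤ) - x') := by
      exact (dvd_sub hd hd').trans (Eq.dvd (by ring))
    have hcop : IsCoprime ((p ^ 2 : ℕ) : ℤ) (s : ℤ) :=
      Nat.isCoprime_iff_coprime.2 (((hp.coprime_iff_not_dvd).2 h3).pow_left 2)
    have h4 := hcop.dvd_of_dvd_mul_left h1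
    have h5 : x ≡ x' [MOD p ^ 2] := Nat.modEq_iff_dvd.2 (by simpa using (dvd_neg.2 h4))
    have : x = x' := by
      rw [← Nat.div_add_mod x (p ^ 2), ← Nat.div_add_mod x' (p ^ 2), h5, h2, h2']
    rw [this]

open Classical in
theorem sum_card_approxFinset_eq (a : ℕ) (ε : ℤ) (j : ℕ) :
    ∑ x ∈ lifts p a, (approxFinset (p ^ 3) ε x j).card =
      ((lifts p a ×ˢ Finset.Icc 1 (p ^ 3)).filter fun z : ℕ × ℕ =>
        z.2 ∈ approxSet (p ^ 3) ε z.1 j).card := by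
  rw [Finset.card_filter, Finset.sum_product]
  refine Finset.sum_congr rfl fun x _ => ?_
  rw [approxFinset, Finset.card_filter]

/-- With `R = p ^ 3 / j`, each of the three counts is of order `R / p * p.size`, apart from a
rounding error `p`. The error is harmless because `p * j ≤ p ^ 2`; here the modulus `p ^ 3` and the
hypothesis `j ≤ p` are used. -/
theorem sum_card_approxFinset_le (hp : p.Prime) {a : ℕ} (ha : ¬ p ∣ a) (ε : ℤ)
    (hε : ε = 1 ∨ ε = -1) {j : ℕ} (hj : 1 ≤ j) (hjp : j ≤ p) :
    ∑ x ∈ lifts p a, (approxFinset (p ^ 3) ε x j).card ≤ 5 * p.size * p ^ 2 / j := by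
  classical
  rw [Nat.le_div_iff_mul_le hj, sum_card_approxFinset_eq,
    ← Finset.card_filter_add_card_filter_not (fun z : ℕ × ℕ => p ∣ z.2),
    Finset.filter_filter, Finset.filter_filter]
  simp only [and_comm (b := _ ∣ _), and_comm (b := ¬ _)]
  have hA := card_coprime_le hp (a := a) ε hε j hj
  have hC := card_dvd_le hp (a := a) ε hε j hj
  have hp0 := hp.pos
  set R := p ^ 3 / j with hR
  rw [Finset.card_sigma, Finset.card_sigma] at hA
  rw [Finset.card_product, Finset.card_sigma, Finset.card_range] at hC
  simp only [Nat.card_Icc, add_tsub_cancel_right] at hC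
  have h1 : ∑ s ∈ Finset.Ico 1 p, ((Finset.Icc 1 (R / s)).filter
        fun t : ℕ => (p : ℤ) ∣ t - ε * s * a).card ≤ R / p * p.size + p := by
    calc _ ≤ ∑ s ∈ Finset.Ico 1 p, (R / p / s + 1) := by
          refine Finset.sum_le_sum fun s _ => (card_residue_class_le _ _).trans ?_
          rw [Nat.div_right_comm]
      _ ≤ R / p * p.size + p := by
          rw [Finset.sum_add_distrib]
          refine add_le_add (le_trans (Finset.sum_le_sum_of_subset ?_)
            (Nat.sum_div_le_mul_size (R / p) p)) (by simp)
          exact Finset.Ico_subset_Icc_self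
  have hRp : R / p ≤ p ^ 2 := by
    calc _ ≤ p ^ 3 / p := Nat.div_le_div_right (Nat.div_le_self _ _)
      _ = p ^ 2 := by rw [pow_succ, Nat.mul_div_cancel _ hp0]
  have hRp2 : R / p ^ 2 ≤ p := by
    calc _ ≤ p ^ 3 / p ^ 2 := Nat.div_le_div_right (Nat.div_le_self _ _)
      _ = p := by rw [pow_succ p 2, Nat.mul_div_cancel_left _ (by positivity)]
  have h2 : ∑ t ∈ Finset.Icc 1 (R / p), ((Finset.Icc p (R / t)).filter
        fun s : ℕ => (p : ℤ) ∣ t - s * (ε * a)).card ≤ R / p * (2 * p.size) := by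
    have hcop : IsCoprime (p : ℤ) (ε * a) := by
      have := Nat.isCoprime_iff_coprime.2 ((hp.coprime_iff_not_dvd).2 ha)
      rcases hε with rfl | rfl
      · simpa using this
      · simpa using this.neg_right
    calc _ ≤ ∑ t ∈ Finset.Icc 1 (R / p), R / p / t := by
          refine Finset.sum_le_sum fun s _ => (card_residue_class_Icc_le hp0 _ _ _ hcop).trans ?_
          rw [Nat.div_right_comm]
      _ ≤ R / p * (R / p).size := Nat.sum_div_le_mul_size _ _
      _ ≤ _ := by
          refine Nat.mul_le_mul_left _ ((Nat.size_le_size hRp).trans ?_)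
          have := Nat.size_mul_le p p
          rw [← pow_two] at this
          omega
  have h3 : (∑ s ∈ Finset.Icc 1 (R / p ^ 2), R / p ^ 2 / s) * p ≤ R / p * p.size := by
    calc _ ≤ R / p ^ 2 * (R / p ^ 2).size * p :=
          Nat.mul_le_mul_right _ (Nat.sum_div_le_mul_size _ _)
      _ ≤ R / p ^ 2 * p.size * p := by
          gcongr
          exact Nat.size_le_size hRp2
      _ = R / p / p * p * p.size := by rw [pow_two, Nat.div_div_eq_div_mul R]; ring
      _ ≤ _ := Nat.mul_le_mul_right _ (Nat.div_mul_le_self _ _)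
  have h4 : R / p * j ≤ p ^ 2 := by
    have e1 : R / p * p ≤ R := Nat.div_mul_le_self _ _
    have e2 : R * j ≤ p ^ 3 := Nat.div_mul_le_self _ _
    refine Nat.le_of_mul_le_mul_right ?_ hp0
    calc R / p * j * p = R / p * p * j := by ring
      _ ≤ R * j := Nat.mul_le_mul_right _ e1
      _ ≤ p ^ 2 * p := by rw [← pow_succ]; exact e2
  have h5 : 1 ≤ p.size := Nat.size_pos.2 hp0
  calc _ ≤ (R / p * p.size + (R / p * p.size + p + R / p * (2 * p.size))) * j := by
        refine Nat.mul_le_mul_right _ (add_le_add (hC.trans h3) (hA.trans (add_le_add h1 h2)))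
    _ = (R / p * j) * (4 * p.size) + p * j := by ring
    _ ≤ p ^ 2 * (4 * p.size) + p * p :=
        add_le_add (Nat.mul_le_mul_right _ h4) (Nat.mul_le_mul_left _ hjp)
    _ ≤ 5 * p.size * p ^ 2 := by nlinarith [Nat.zero_le (p ^ 2)]

end Counting

/-! ### The Euclidean algorithm -/

/-- The partial quotients, in pairs, of the Euclidean algorithm on `(u, v)`, in the variant where the
remainder of `u` by `v` is taken in `{1, …, v}` and that of `v` by `u` in `{0, …, u - 1}`. -/
inductive EuclidTrace : ℕ → ℕ → List (ℕ × ℕ) → Prop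
  | nil (u : ℕ) : EuclidTrace u 0 []
  | cons {u v u' v' q q' : ℕ} {l : List (ℕ × ℕ)} (hv : v ≠ 0) (hu : u = q * v + u')
      (hpos : 1 ≤ u') (hle : u' ≤ v) (hv' : v = q' * u' + v') (hlt : v' < u')
      (h : EuclidTrace u' v' l) : EuclidTrace u v ((q, q') :: l)

/-- The sum of all partial quotients. -/
def quotientSum (l : List (ℕ × ℕ)) : ℕ := (l.map fun z => z.1 + z.2).sum

@[simp] theorem quotientSum_nil : quotientSum [] = 0 := rfl

@[simp] theorem quotientSum_cons (z : ℕ × ℕ) (l : List (ℕ × ℕ)) :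
    quotientSum (z :: l) = z.1 + z.2 + quotientSum l := rfl

namespace EuclidTrace

variable {u v : ℕ} {l : List (ℕ × ℕ)}

theorem exists_trace (u v : ℕ) (hu : 1 ≤ u) : ∃ l, EuclidTrace u v l := by
  induction v using Nat.strong_induction_on generalizing u with
  | _ v ih =>
    rcases Nat.eq_zero_or_pos v with rfl | hv
    · exact ⟨[], nil u⟩
    -- Shifting by one gives the remainder in `{1, …, v}`; it keeps the first entry positive, so the
    -- algorithm always ends at `(gcd, 0)`.
    · set r := (u - 1) % v with hr
      have h1 : u = (u - 1) / v * v + (r + 1) := by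
        have := Nat.div_add_mod' (u - 1) v
        omega
      have h2 : r < v := Nat.mod_lt _ hv
      have h3 : v % (r + 1) < r + 1 := Nat.mod_lt _ (Nat.succ_pos _)
      obtain ⟨l, hl⟩ := ih (v % (r + 1)) (by omega) (r + 1) (by omega)
      exact ⟨_, cons hv.ne' h1 (by omega) h2 (Nat.div_add_mod' v _).symm h3 hl⟩

/-- A round more than halves the second entry: `v ≥ u' + v' > 2 * v'`. -/
theorem length_le (h : EuclidTrace u v l) : l.length ≤ v.size := by
  induction h with
  | nil => simp
  | @cons u v u' v' q q' l hv hu hpos hle hv' hlt h ih =>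
    rw [List.length_cons]
    refine Nat.succ_le_of_lt (lt_of_le_of_lt ih ?_)
    have h2 : v' + v' < v := by
      have : 1 ≤ q' := Nat.pos_of_ne_zero (by rintro rfl; omega)
      nlinarith
    rw [Nat.lt_size]
    rcases Nat.eq_zero_or_pos v' with rfl | hv0
    · simp; omega
    · have h3 : 2 ^ (v'.size - 1) ≤ v' := Nat.lt_size.1 (by have := Nat.size_pos.2 hv0; omega)
      have h4 : 2 ^ v'.size = 2 ^ (v'.size - 1) * 2 := by
        rw [← pow_succ]
        congr 1
        have := Nat.size_pos.2 hv0; omega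
      omega

/-- A crude bound, used for small primes and to limit the size of registers. -/
theorem quotientSum_le (h : EuclidTrace u v l) : quotientSum l ≤ u + v := by
  induction h with
  | nil => simp
  | cons hv hu hpos hle hv' hlt h ih =>
    rename_i u v u' v' q q' l
    rw [quotientSum_cons]
    have h1 : q ≤ q * v := Nat.le_mul_of_pos_right _ (by omega)
    have h2 : q' ≤ q' * u' := Nat.le_mul_of_pos_right _ (by omega)
    simp only
    omega

/-- The quotients can serve as digits in base `N`, and the second one of each pair is a nonzero
digit. -/
theorem mem_lt (h : EuclidTrace u v l) {N : ℕ} (hN : u + v < N) :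
    ∀ z ∈ l, z.1 < N ∧ 1 ≤ z.2 ∧ z.2 < N := by
  induction h with
  | nil => simp
  | cons hv hu hpos hle hv' hlt h ih =>
    rename_i u v u' v' q q' l
    have h1 : q ≤ q * v := Nat.le_mul_of_pos_right _ (by omega)
    have h2 : q' ≤ q' * u' := Nat.le_mul_of_pos_right _ (by omega)
    have h3 : 1 ≤ q' := Nat.pos_of_ne_zero (by rintro rfl; omega)
    intro z hz
    rcases List.mem_cons.1 hz with rfl | hz
    · simp only
      omega
    · exact ih (by omega) z hz

end EuclidTrace

/-! ### Words from continued fractions, and conjugation of unipotents -/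

namespace Letter

variable {R : Type*} [CommRing R]

theorem evalWord_append (w w' : List Letter) :
    evalWord R (w ++ w') = evalWord R w * evalWord R w' := by
  simp [evalWord]

theorem evalWord_replicate (n : ℕ) (l : Letter) :
    evalWord R (List.replicate n l) = eval R l ^ n := by
  simp [evalWord]

theorem val_mul (A B : Matrix.SpecialLinearGroup (Fin 2) R) : (A * B).1 = A.1 * B.1 := rfl

theorem upper_pow (n : ℕ) : ((upper R ^ n).1 : Matrix (Fin 2) (Fin 2) R) = !![1, (n : R); 0, 1] := by
  induction n with
  | zero => simp [Matrix.one_fin_two]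
  | succ n ih =>
    rw [pow_succ, val_mul, ih]
    simp [upper, add_comm]

theorem lower_pow (n : ℕ) : ((lower R ^ n).1 : Matrix (Fin 2) (Fin 2) R) = !![1, 0; (n : R), 1] := by
  induction n with
  | zero => simp [Matrix.one_fin_two]
  | succ n ih =>
    rw [pow_succ, val_mul, ih]
    simp [lower]

/-- The word with the given exponents of `u` and `v`. -/
def exponentWord (l : List (ℕ × ℕ)) : List Letter :=
  l.flatMap fun z => List.replicate z.1 u ++ List.replicate z.2 v

/-- The word inverse to `exponentWord l`. -/
def exponentWordInv (l : List (ℕ × ℕ)) : List Letter :=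
  l.reverse.flatMap fun z => List.replicate z.2 vInv ++ List.replicate z.1 uInv

theorem exponentWord_cons (z : ℕ × ℕ) (l : List (ℕ × ℕ)) :
    exponentWord (z :: l) =
      List.replicate z.1 u ++ List.replicate z.2 v ++ exponentWord l := by
  simp [exponentWord]

theorem exponentWordInv_cons (z : ℕ × ℕ) (l : List (ℕ × ℕ)) :
    exponentWordInv (z :: l) =
      exponentWordInv l ++ (List.replicate z.2 vInv ++ List.replicate z.1 uInv) := by
  simp [exponentWordInv]

theorem length_exponentWord (l : List (ℕ × ℕ)) : (exponentWord l).length = quotientSum l := by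
  induction l with
  | nil => rfl
  | cons z l ih => rw [exponentWord_cons]; simp [ih]; omega

theorem length_exponentWordInv (l : List (ℕ × ℕ)) :
    (exponentWordInv l).length = quotientSum l := by
  induction l with
  | nil => rfl
  | cons z l ih => rw [exponentWordInv_cons]; simp [ih]; omega

theorem evalWord_exponentWordInv (l : List (ℕ × ℕ)) :
    evalWord R (exponentWordInv l) = (evalWord R (exponentWord l))⁻¹ := by
  induction l with
  | nil => simp [exponentWord, exponentWordInv, evalWord]
  | cons z l ih =>
    rw [exponentWord_cons, exponentWordInv_cons]
    simp only [evalWord_append, ih, evalWord_replicate, eval, inv_pow, mul_inv_rev]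

/-- The product of the two generator powers of one round takes the column `(x', y')` back to `(x,
y)`. By coprimality the algorithm ends at `(1, 0)`, the first column of the identity. -/
theorem evalWord_exponentWord_apply {x y : ℕ} {l : List (ℕ × ℕ)} (h : EuclidTrace x y l)
    (hx : 1 ≤ x) (hc : x.Coprime y) :
    (evalWord R (exponentWord l)).1 0 0 = x ∧ (evalWord R (exponentWord l)).1 1 0 = y := by
  induction h with
  | nil u =>
    obtain rfl : u = 1 := by simpa using hc
    simp [exponentWord, evalWord]
  | cons hv hu hpos hle hv' hlt h ih =>
    rename_i x y x' y' q q' l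
    have hc1 : Nat.Coprime x' y := by
      rw [hu] at hc
      simpa [add_comm] using hc
    have hc' : Nat.Coprime x' y' := by
      rw [hv'] at hc1
      simpa [add_comm] using hc1
    obtain ⟨h1, h2⟩ := ih hpos hc'
    rw [exponentWord_cons, evalWord_append, evalWord_append, evalWord_replicate,
      evalWord_replicate]
    simp only [eval, val_mul, upper_pow, lower_pow, Matrix.mul_apply, Fin.sum_univ_two, h1, h2]
    have e1 : (y : R) = q' * x' + y' := by exact_mod_cast congrArg (Nat.cast (R := R)) hv'
    have e2 : (x : R) = q * y + x' := by exact_mod_cast congrArg (Nat.cast (R := R)) hu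
    constructor
    · simp; rw [e2, e1]; ring
    · simp; rw [e1]

/-- The upper unitriangular matrix with the given entry. -/
def unip (x : R) : Matrix.SpecialLinearGroup (Fin 2) R :=
  ⟨!![1, x; 0, 1], by simp [Matrix.det_fin_two]⟩

theorem unip_mul (x y : R) : unip x * unip y = unip (x + y) := by
  apply Subtype.ext
  rw [val_mul]
  simp [unip, add_comm]

theorem unip_zero : unip (0 : R) = 1 := by
  apply Subtype.ext
  simp [unip, Matrix.one_fin_two]

theorem unip_neg (x : R) : unip (-x) = (unip x)⁻¹ := by
  rw [eq_inv_iff_mul_eq_one, unip_mul, neg_add_cancel, unip_zero]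

/-- An upper triangular matrix of determinant one has diagonal `(a, a⁻¹)`, so it scales the
unipotent entry by `a ^ 2`. -/
theorem conj_unip (M : Matrix.SpecialLinearGroup (Fin 2) R) (h : M.1 1 0 = 0) (x : R) :
    M * unip x * M⁻¹ = unip (x * M.1 0 0 ^ 2) := by
  rw [mul_inv_eq_iff_eq_mul]
  have hdet := M.2
  rw [Matrix.det_fin_two, h, mul_zero, sub_zero] at hdet
  apply Subtype.ext
  rw [val_mul, val_mul]
  ext i j
  fin_cases i <;> fin_cases j <;>
    simp [unip, Matrix.mul_apply, Fin.sum_univ_two, h]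
  linear_combination (-x * M.1 0 0) * hdet

theorem eval_u : eval R u = unip 1 := rfl

theorem eval_uInv : eval R uInv = unip (-1) := by
  rw [unip_neg]; rfl

end Letter

/-! ### From partial quotients to good approximations -/

section Events

variable {y x J : ℕ} {ε : ℤ}

/-- The number of pairs `(j, s)` with `1 ≤ j < J` and `s ≥ c` in `approxSet y ε x j`. -/
noncomputable def eventCount (y : ℕ) (ε : ℤ) (x J c : ℕ) : ℕ :=
  ∑ j ∈ Finset.Ico 1 J, ((approxFinset y ε x j).filter (c ≤ ·)).card

theorem eventCount_anti {c c' : ℕ} (h : c ≤ c') :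
    eventCount y ε x J c' ≤ eventCount y ε x J c :=
  Finset.sum_le_sum fun _ _ => Finset.card_le_card fun s hs => by
    rw [Finset.mem_filter] at hs ⊢
    exact ⟨hs.1, h.trans hs.2⟩

/-- The pairs `(j, s)` with `1 ≤ j ≤ q` are all counted from threshold `c` on and none from `c'` on.
Since the set for `J` is empty and the sets shrink as `j` grows, `q < J`, so no pair is cut off. -/
theorem add_eventCount_le {c c' s q t : ℕ} (hcs : c ≤ s) (hsc : s < c') (hs : 1 ≤ s) (ht : 1 ≤ t)
    (hq : q * (s * t) ≤ y) (hst : s ≤ y) (hd : (y : ℤ) ∣ s * x - ε * t)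
    (hJ : approxFinset y ε x J = ∅) :
    q + eventCount y ε x J c' ≤ eventCount y ε x J c := by
  classical
  have hmem : ∀ j ≤ q, s ∈ approxFinset y ε x j := fun j hj =>
    Finset.mem_filter.2 ⟨Finset.mem_Icc.2 ⟨hs, hst⟩, hs, t, ht,
      le_trans (Nat.mul_le_mul_right _ hj) hq, hd⟩
  have hqJ : q < J := by
    by_contra! h
    have := hmem J h
    simp [hJ] at this
  have hcard : q = ∑ j ∈ Finset.Ico 1 J, if j ≤ q then 1 else 0 := by
    rw [← Finset.card_filter]
    have : (Finset.Ico 1 J).filter (· ≤ q) = Finset.Icc 1 q := by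
      ext j; simp only [Finset.mem_filter, Finset.mem_Ico, Finset.mem_Icc]; omega
    rw [this]; simp
  rw [eventCount, eventCount]
  nth_rw 1 [hcard]
  rw [← Finset.sum_add_distrib]
  refine Finset.sum_le_sum fun j _ => ?_
  split_ifs with hj
  · rw [add_comm, ← Finset.card_insert_of_notMem (a := s) (by simp; omega)]
    refine Finset.card_le_card (Finset.insert_subset ?_ fun s' hs' => ?_)
    · exact Finset.mem_filter.2 ⟨hmem j hj, hcs⟩
    · rw [Finset.mem_filter] at hs' ⊢
      exact ⟨hs'.1, by omega⟩
  · rw [zero_add]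
    refine Finset.card_le_card fun s' hs' => ?_
    rw [Finset.mem_filter] at hs' ⊢
    exact ⟨hs'.1, by omega⟩

/-- The invariant carries the continuants: `d * x` is congruent to `u` and `c * x` to `-v` modulo
`y`, while `c * u + d * v = y` bounds both products. The quotient `q` is charged to `s = c` with
sign `-1`, and `q'` to the new `s = d'` with sign `1`. The continuants increase, so raising the
thresholds prevents double counting. In `hcd` the first alternative is the start, where the first
quotient is zero and needs no charge; later every quotient is positive. -/
theorem EuclidTrace.quotientSum_le_eventCount {u v : ℕ} {l : List (ℕ × ℕ)}
    (h : EuclidTrace u v l) (hJ : approxFinset y 1 x J = ∅) (hJ' : approxFinset y (-1) x J = ∅)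
    (c d : ℕ) (hy : c * u + d * v = y) (hu : (y : ℤ) ∣ d * x - u)
    (hv : (y : ℤ) ∣ c * x + v) (hd : 1 ≤ d) (hcd : (c = 0 ∧ u ≤ v) ∨ (1 ≤ c ∧ v < u)) :
    quotientSum l ≤ eventCount y (-1) x J c + eventCount y 1 x J (c + d) := by
  induction h generalizing c d with
  | nil => simp
  | cons hv0 hu0 hpos hle hv' hlt h ih =>
    rename_i u v u' v' q q' l
    set d' := d + q * c with hd'
    set c' := c + q' * d' with hc'
    have hq' : 1 ≤ q' := Nat.pos_of_ne_zero (by rintro rfl; omega)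
    have hdd' : 1 ≤ d' := by omega
    have hdc' : d' ≤ q' * d' := Nat.le_mul_of_pos_left _ hq'
    have e0 : c * u' + d' * v = y := by rw [← hy, hu0, hd']; ring
    have hy' : c' * u' + d' * v' = y := by
      rw [← e0, hc', congrArg (d' * ·) hv']; ring
    have hu' : (y : ℤ) ∣ d' * x - u' := by
      have := dvd_add hu (hv.mul_left (q : ℤ))
      refine this.trans (Eq.dvd ?_)
      rw [hd', hu0]; push_cast; ring
    have hvv' : (y : ℤ) ∣ c' * x + v' := by
      have := dvd_add hv (hu'.mul_left (q' : ℤ))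
      refine this.trans (Eq.dvd ?_)
      rw [hc']; nth_rw 1 [hv']; push_cast; ring
    have hrec := ih c' d' hy' hu' hvv' hdd' (Or.inr ⟨by omega, hlt⟩)
    have h2 : q' + eventCount y 1 x J (c' + d') ≤ eventCount y 1 x J (c + d) := by
      have hdv : d' * v ≤ y := by rw [← e0]; exact Nat.le_add_left _ _
      refine add_eventCount_le (s := d') (t := u') ?_ (by omega) hdd' hpos ?_ ?_ ?_ hJ
      -- At the start `c = 0`, so `d' = d` meets the threshold `c + d`; afterwards `q ≥ 1` gives `d'
      -- ≥ c + d`.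
      · rcases hcd with ⟨rfl, -⟩ | ⟨hc, hvu⟩
        · omega
        · have : 1 ≤ q := Nat.pos_of_ne_zero (by rintro rfl; omega)
          have : c ≤ q * c := Nat.le_mul_of_pos_left _ this
          omega
      · refine le_trans ?_ hdv
        calc q' * (d' * u') = d' * (q' * u') := by ring
          _ ≤ d' * v := Nat.mul_le_mul_left _ (by omega)
      · exact le_trans (Nat.le_mul_of_pos_right _ (Nat.pos_of_ne_zero hv0)) hdv
      · simpa using hu'
    have h1 : q + eventCount y (-1) x J c' ≤ eventCount y (-1) x J c := by
      rcases hcd with ⟨rfl, huv⟩ | ⟨hc, hvu⟩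
      · have : q = 0 := by
          by_contra h0
          have : v ≤ q * v := Nat.le_mul_of_pos_left _ (Nat.pos_of_ne_zero h0)
          omega
        rw [this, zero_add]
        exact eventCount_anti (Nat.zero_le _)
      · have hcu : c * u ≤ y := by rw [← hy]; exact Nat.le_add_right _ _
        refine add_eventCount_le (s := c) (t := v) le_rfl (by omega) hc (by omega) ?_ ?_ ?_ hJ'
        · refine le_trans ?_ hcu
          calc q * (c * v) = c * (q * v) := by ring
            _ ≤ c * u := Nat.mul_le_mul_left _ (by omega)
        · exact le_trans (Nat.le_mul_of_pos_right _ (by omega)) hcu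
        · simpa using hv
    rw [quotientSum_cons]
    simp only
    omega

end Events

/-! ### Most lifts have small partial quotients -/

section Lifts

variable {p a : ℕ}

/-- The lifts `x` of `a` for which the Euclidean algorithm on `(x, p ^ 3)` has large partial
quotients. -/
def IsBadLift (p T x : ℕ) : Prop := ∀ l, EuclidTrace x (p ^ 3) l → T < quotientSum l

theorem IsBadLift.eventCount_lt {T x J : ℕ} (h : IsBadLift p T x) (hx : 1 ≤ x) (hxp : x < p ^ 3)
    (hJ : approxFinset (p ^ 3) 1 x J = ∅) (hJ' : approxFinset (p ^ 3) (-1) x J = ∅) :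
    T < eventCount (p ^ 3) (-1) x J 0 + eventCount (p ^ 3) 1 x J 0 := by
  obtain ⟨l, hl⟩ := EuclidTrace.exists_trace x (p ^ 3) hx
  refine (h l hl).trans_le ?_
  refine (hl.quotientSum_le_eventCount hJ hJ' 0 1 (by simp) (by simp) (by simp) le_rfl
    (Or.inl ⟨rfl, hxp.le⟩)).trans ?_
  exact add_le_add_right (eventCount_anti (Nat.zero_le _)) _

theorem eventCount_zero (y : ℕ) (ε : ℤ) (x J : ℕ) :
    eventCount y ε x J 0 = ∑ j ∈ Finset.Ico 1 J, (approxFinset y ε x j).card := by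
  simp [eventCount]

/-- Summing the average `1 / j` over `j < J` costs only a factor `J.size`; for `J` of order `log p`
this is the source of `log log p`. -/
theorem sum_eventCount_le (hp : p.Prime) (ha : ¬ p ∣ a) (ε : ℤ) (hε : ε = 1 ∨ ε = -1) {J : ℕ}
    (hJ : J ≤ p) :
    ∑ x ∈ lifts p a, eventCount (p ^ 3) ε x J 0 ≤ 5 * p.size * p ^ 2 * J.size := by
  simp only [eventCount_zero]
  rw [Finset.sum_comm]
  calc _ ≤ ∑ j ∈ Finset.Ico 1 J, 5 * p.size * p ^ 2 / j := Finset.sum_le_sum fun j hj => by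
        rw [Finset.mem_Ico] at hj
        exact sum_card_approxFinset_le hp ha ε hε hj.1 (by omega)
    _ ≤ ∑ j ∈ Finset.Icc 1 J, 5 * p.size * p ^ 2 / j :=
        Finset.sum_le_sum_of_subset Finset.Ico_subset_Icc_self
    _ ≤ _ := Nat.sum_div_le_mul_size _ _

-- For a bad lift, either an approximation of level `J` exists, or the number of events below level
-- `J` exceeds `T`. Markov's inequality bounds both cases, with the two signs together doubling the
-- constant `5`.
open Classical in
theorem card_isBadLift_le (hp : p.Prime) (ha : ¬ p ∣ a) {J T : ℕ} (hJ0 : 1 ≤ J) (hJ : J ≤ p)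
    (hT : 0 < T) :
    ((lifts p a).filter (IsBadLift p T)).card ≤
      10 * p.size * p ^ 2 / J + 10 * p.size * p ^ 2 * J.size / T := by
  set D := 5 * p.size * p ^ 2 with hD
  have hsub : (lifts p a).filter (IsBadLift p T) ⊆
      (lifts p a).filter (fun x => 1 ≤
        (approxFinset (p ^ 3) 1 x J).card + (approxFinset (p ^ 3) (-1) x J).card) ∪
      (lifts p a).filter (fun x => T ≤
        eventCount (p ^ 3) (-1) x J 0 + eventCount (p ^ 3) 1 x J 0) := by
    intro x hx
    rw [Finset.mem_filter] at hx
    rw [Finset.mem_union, Finset.mem_filter, Finset.mem_filter]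
    by_cases h : 1 ≤ (approxFinset (p ^ 3) 1 x J).card + (approxFinset (p ^ 3) (-1) x J).card
    · exact Or.inl ⟨hx.1, h⟩
    · refine Or.inr ⟨hx.1, le_of_lt (hx.2.eventCount_lt ?_ ?_ ?_ ?_)⟩
      · refine Nat.pos_of_ne_zero ?_
        rintro rfl
        have := (Finset.mem_filter.1 hx.1).2
        simp only [Nat.cast_zero, zero_sub, dvd_neg] at this
        exact ha (by exact_mod_cast this)
      · exact Finset.mem_range.1 (Finset.mem_filter.1 hx.1).1
      · exact Finset.card_eq_zero.1 (by omega)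
      · exact Finset.card_eq_zero.1 (by omega)
  have markov : ∀ (f : ℕ → ℕ) (c : ℕ), ((lifts p a).filter fun x => c ≤ f x).card * c ≤
      ∑ x ∈ lifts p a, f x := fun f c => by
    calc _ = ∑ x ∈ (lifts p a).filter fun x => c ≤ f x, c := by simp
      _ ≤ ∑ x ∈ (lifts p a).filter fun x => c ≤ f x, f x :=
          Finset.sum_le_sum fun x hx => (Finset.mem_filter.1 hx).2
      _ ≤ _ := Finset.sum_le_sum_of_subset (Finset.filter_subset _ _)
  refine (Finset.card_le_card hsub).trans ((Finset.card_union_le _ _).trans (add_le_add ?_ ?_))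
  · have h := markov (fun x => (approxFinset (p ^ 3) 1 x J).card +
      (approxFinset (p ^ 3) (-1) x J).card) 1
    rw [mul_one, Finset.sum_add_distrib] at h
    refine h.trans ?_
    have h1 := sum_card_approxFinset_le hp ha 1 (Or.inl rfl) hJ0 hJ
    have h2 := sum_card_approxFinset_le hp ha (-1) (Or.inr rfl) hJ0 hJ
    rw [← hD] at h1 h2
    have h3 := Nat.div_mul_le_self D J
    rw [Nat.le_div_iff_mul_le hJ0]
    nlinarith
  · have h := markov (fun x => eventCount (p ^ 3) (-1) x J 0 + eventCount (p ^ 3) 1 x J 0) T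
    rw [Finset.sum_add_distrib] at h
    have h1 := sum_eventCount_le hp ha 1 (Or.inl rfl) hJ
    have h2 := sum_eventCount_le hp ha (-1) (Or.inr rfl) hJ
    rw [← hD] at h1 h2
    rw [Nat.le_div_iff_mul_le hT]
    refine h.trans ((add_le_add h2 h1).trans (le_of_eq ?_))
    rw [hD]; ring

/-- The bound for the sum of the partial quotients up to which a lift is accepted. -/
def quotientBound (p : ℕ) : ℕ := 2 ^ 50 * (p.size * p.size.size)

theorem size_mul_le_of_large (hp : 2 ^ 16 ≤ p) : 160 * p.size ≤ p := by
  have key : ∀ s, 17 ≤ s → 160 * s ≤ 2 ^ (s - 1) := by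
    intro s hs
    induction s, hs using Nat.le_induction with
    | base => norm_num
    | succ s hs ih =>
      have : 2 ^ (s + 1 - 1) = 2 ^ (s - 1) * 2 := by
        rw [← pow_succ]; congr 1; omega
      omega
  have h17 : 17 ≤ p.size := Nat.lt_size.2 hp
  exact (key _ h17).trans (Nat.lt_size.1 (by omega))

open Classical in
theorem four_mul_card_isBadLift_le (hp : p.Prime) (ha : ¬ p ∣ a) :
    4 * ((lifts p a).filter (IsBadLift p (quotientBound p))).card ≤ p ^ 2 := by
  have hs : 1 ≤ p.size := Nat.size_pos.2 hp.pos
  have hss : 1 ≤ p.size.size := Nat.size_pos.2 hs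
  have h1 : 1 ≤ p.size * p.size.size := Nat.mul_pos hs hss
  by_cases hlarge : 2 ^ 16 ≤ p
  -- The choice `J = 160 * p.size` makes the first term of `card_isBadLift_le` about `p ^ 2 / 16`;
  -- the slack up to `p ^ 2 / 8` absorbs rounding. It needs `J ≤ p`, hence a large prime.
  · have hJ := size_mul_le_of_large hlarge
    refine (Nat.mul_le_mul_left 4 (card_isBadLift_le hp ha (J := 160 * p.size) (by omega) hJ
      (T := quotientBound p) (by unfold quotientBound; omega))).trans ?_
    have e1 : 10 * p.size * p ^ 2 / (160 * p.size) ≤ p ^ 2 / 8 := by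
      refine Nat.div_le_of_le_mul ?_
      have : p ^ 2 < 8 * (p ^ 2 / 8 + 1) := by omega
      have : p ^ 2 ≤ 16 * (p ^ 2 / 8) := by
        have : 8 ≤ p ^ 2 := by nlinarith
        omega
      nlinarith
    have e2 : 10 * p.size * p ^ 2 * (160 * p.size).size / quotientBound p ≤ p ^ 2 / 8 := by
      refine Nat.div_le_of_le_mul ?_
      have h8 : (160 * p.size).size ≤ 9 * p.size.size := by
        refine (Nat.size_mul_le _ _).trans ?_
        have : Nat.size 160 ≤ 8 := Nat.size_le.2 (by norm_num)
        omega
      have : p ^ 2 ≤ 16 * (p ^ 2 / 8) := by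
        have : 8 ≤ p ^ 2 := by nlinarith
        omega
      unfold quotientBound
      calc 10 * p.size * p ^ 2 * (160 * p.size).size
          ≤ 10 * p.size * (16 * (p ^ 2 / 8)) * (9 * p.size.size) := by gcongr
        _ = 1440 * (p.size * p.size.size * (p ^ 2 / 8)) := by ring
        _ ≤ 2 ^ 50 * (p.size * p.size.size * (p ^ 2 / 8)) :=
            Nat.mul_le_mul_right _ (by norm_num)
        _ = _ := by ring
    omega
  -- For `p < 2 ^ 16` any quotient sum is at most `x + p ^ 3 < 2 ^ 49`. The constant `2 ^ 50` in
  -- `quotientBound` is so large that there are no bad lifts here.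
  · have : (lifts p a).filter (IsBadLift p (quotientBound p)) = ∅ := by
      refine Finset.filter_eq_empty_iff.2 fun x hx hbad => ?_
      have hx1 : 1 ≤ x := by
        refine Nat.pos_of_ne_zero ?_
        rintro rfl
        have := (Finset.mem_filter.1 hx).2
        simp only [Nat.cast_zero, zero_sub, dvd_neg] at this
        exact ha (by exact_mod_cast this)
      have hx2 : x < p ^ 3 := Finset.mem_range.1 (Finset.mem_filter.1 hx).1
      obtain ⟨l, hl⟩ := EuclidTrace.exists_trace x (p ^ 3) hx1
      have h2 := hbad l hl
      have h3 := hl.quotientSum_le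
      have h4 : p ^ 3 ≤ (2 ^ 16) ^ 3 := Nat.pow_le_pow_left (by omega) 3
      unfold quotientBound at h2
      have h5 : 2 ^ 50 ≤ 2 ^ 50 * (p.size * p.size.size) := Nat.le_mul_of_pos_right _ h1
      omega
    rw [this]; simp

open Classical in
/-- At most half of the random choices of `k` lead to a bad lift `a + k * p`. -/
theorem two_mul_card_bad_le (hp : p.Prime) (ha : ¬ p ∣ a) :
    2 * ((Finset.range (2 ^ (p * p).size)).filter fun k =>
      IsBadLift p (quotientBound p) ((a + k * p) % p ^ 3)).card ≤ 2 ^ (p * p).size := by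
  have hp0 := hp.pos
  have hpow1 : p ^ 2 ≤ 2 ^ (p * p).size := by rw [pow_two]; exact (p * p).lt_size_self.le
  have hpow2 : 2 ^ (p * p).size ≤ 2 * p ^ 2 := by
    have h0 : 0 < (p * p).size := Nat.size_pos.2 (by positivity)
    have : 2 ^ ((p * p).size - 1) ≤ p * p := Nat.lt_size.1 (by omega)
    calc 2 ^ (p * p).size = 2 * 2 ^ ((p * p).size - 1) := by
          rw [← pow_succ']; congr 1; omega
      _ ≤ 2 * (p * p) := Nat.mul_le_mul_left _ this
      _ = _ := by ring
  have hcard : ((Finset.range (2 ^ (p * p).size)).filter fun k =>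
      IsBadLift p (quotientBound p) ((a + k * p) % p ^ 3)).card ≤
      ((lifts p a).filter (IsBadLift p (quotientBound p)) ×ˢ Finset.range 2).card := by
    -- The lift determines `k` modulo `p ^ 2`, and `2 ^ (p * p).size ≤ 2 * p ^ 2`, so each lift is
    -- hit at most twice. A quarter of bad lifts thus becomes at most half of the choices.
    refine Finset.card_le_card_of_injOn (fun k => ((a + k * p) % p ^ 3, k / p ^ 2)) ?_ ?_
    · intro k hk
      rw [Finset.mem_coe, Finset.mem_filter, Finset.mem_range] at hk
      simp only [Finset.coe_product, Set.mem_prod, Finset.mem_coe, Finset.mem_filter,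
        Finset.mem_range, lifts]
      refine ⟨⟨⟨Nat.mod_lt _ (by positivity), ?_⟩, hk.2⟩, ?_⟩
      · push_cast
        have h1 : (p : ℤ) ∣ (a + k * p : ℤ) - (a + k * p : ℤ) % p ^ 3 :=
          dvd_trans (dvd_pow_self _ (by norm_num)) (Int.dvd_self_sub_emod)
        exact (dvd_sub (dvd_mul_left (p : ℤ) k) h1).trans (Eq.dvd (by ring))
      · rw [Nat.div_lt_iff_lt_mul (by positivity)]
        omega
    · intro k _ k' _ h
      simp only [Prod.mk.injEq] at h
      have h1 : a + k * p ≡ a + k' * p [MOD p ^ 3] := h.1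
      have h2 : k * p ≡ k' * p [MOD p ^ 2 * p] := by
        rw [← pow_succ]; exact Nat.ModEq.add_left_cancel' a h1
      have h3 : k ≡ k' [MOD p ^ 2] := Nat.ModEq.mul_right_cancel' hp0.ne' h2
      rw [← Nat.div_add_mod k (p ^ 2), ← Nat.div_add_mod k' (p ^ 2), h3, h.2]
  rw [Finset.card_product, Finset.card_range] at hcard
  have := four_mul_card_isBadLift_le hp ha
  omega

end Lifts

/-! ### Straight-line code and the Euclidean algorithm on the machine -/

namespace RandRAM

open scoped ENNReal

/-- A straight-line program of arithmetic operations. -/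
def block : List (Op × ℕ × ℕ × ℕ) → Prog
  | [] => .skip
  | (o, x, y, z) :: l => .seq (.arith o x y z) (block l)

/-- The registers after `block`. -/
def blockEval : List (Op × ℕ × ℕ × ℕ) → (ℕ → ℕ) → ℕ → ℕ
  | [], r => r
  | (o, x, y, z) :: l, r => blockEval l (Function.update r x (o.eval (r y) (r z)))

/-- All operands read by `block` have at most `B` digits. -/
def BlockOk (B : ℕ) : List (Op × ℕ × ℕ × ℕ) → (ℕ → ℕ) → Prop
  | [], _ => True
  | (o, x, y, z) :: l, r => (r y).size ≤ B ∧ (r z).size ≤ B ∧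
      BlockOk B l (Function.update r x (o.eval (r y) (r z)))

theorem exec_block {B : ℕ} (l : List (Op × ℕ × ℕ × ℕ)) {r : ℕ → ℕ} (h : BlockOk B l r) :
    Exec B (block l) r (blockEval l r) [] (2 * l.length + 1) := by
  induction l generalizing r with
  | nil => exact Exec.skip r
  | cons z l ih =>
    obtain ⟨o, x, y, z⟩ := z
    obtain ⟨h1, h2, h3⟩ := h
    have := (Exec.arith (x := x) o h1 h2).seq (ih h3)
    exact this.mono (by simp; omega)

theorem blockEval_of_notMem {l : List (Op × ℕ × ℕ × ℕ)} {i : ℕ} (h : ∀ z ∈ l, i ≠ z.2.1)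
    (r : ℕ → ℕ) : blockEval l r i = r i := by
  induction l generalizing r with
  | nil => rfl
  | cons z l ih =>
    obtain ⟨o, x, y, z⟩ := z
    simp only [List.mem_cons, forall_eq_or_imp] at h
    rw [blockEval, ih h.2, Function.update_of_ne h.1]

/-- Emit the letter `l` as often as register `y` says. -/
def emitLoop (l : Letter) (y : ℕ) : Prog :=
  .seq (.arith .mul 34 y 6) (.loop 34 (.seq (.emit l) (.arith .sub 34 34 6)))

/-- The number of steps is linear in the exponent itself, which is affordable since the exponents
add up to the quotient sum. Register `6` holds `1`, so multiplying by it copies a register. -/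
theorem exec_emitLoop {B : ℕ} (hB : 1 ≤ B) (l : Letter) {y : ℕ} {r : ℕ → ℕ} (h6 : r 6 = 1)
    (hy : (r y).size ≤ B) :
    Exec B (emitLoop l y) r (Function.update r 34 0) (List.replicate (r y) l)
      (4 * r y + 3) := by
  have loop : ∀ (n : ℕ) (r : ℕ → ℕ), r 6 = 1 → r 34 = n → n.size ≤ B →
      Exec B (.loop 34 (.seq (.emit l) (.arith .sub 34 34 6))) r (Function.update r 34 0)
        (List.replicate n l) (4 * n + 1) := by
    intro n
    induction n with
    | zero =>
      intro r _ h34 _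
      have : Function.update r 34 0 = r := by rw [← h34, Function.update_eq_self]
      rw [this]
      exact Exec.loop_zero h34
    | succ n ih =>
      intro r h6 h34 hs
      have hB' : (r 6).size ≤ B := by rw [h6]; simpa using hB
      have h1 := (Exec.emit (B := B) l r).seq
        (Exec.arith (x := 34) (y := 34) .sub (by rwa [h34]) hB')
      have h2 := ih (Function.update r 34 (r 34 - r 6)) (by simpa using h6)
        (by simp [h34, h6]) ((Nat.size_le_size n.le_succ).trans hs)
      have h3 := Exec.loop_step (by omega) (by rwa [h34]) h1 h2
      rw [Function.update_idem] at h3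
      rw [List.replicate_succ]
      exact h3.mono (by omega)
  have h1 := Exec.arith (B := B) (x := 34) .mul hy (z := 6) (by rw [h6]; simpa using hB)
  have h2 := loop (r y) (Function.update r 34 (Op.mul.eval (r y) (r 6))) (by simpa using h6)
    (by simp [Op.eval, h6]) hy
  rw [Function.update_idem] at h2
  exact (h1.seq h2).mono (by omega)

/-- One round of the Euclidean algorithm on registers `27`, `28`, with quotients in `29`, `31`. -/
def euclidBlock : List (Op × ℕ × ℕ × ℕ) :=
  [(.sub, 30, 27, 6), (.div, 29, 30, 28), (.mul, 30, 29, 28), (.sub, 27, 27, 30),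
    (.div, 31, 28, 27), (.mod, 28, 28, 27)]

theorem euclid_round {u v u' v' q q' : ℕ} (hu : u = q * v + u')
    (hpos : 1 ≤ u') (hle : u' ≤ v) (hv' : v = q' * u' + v') (hlt : v' < u') :
    (u - 1) / v = q ∧ u - q * v = u' ∧ v / u' = q' ∧ v % u' = v' := by
  refine ⟨?_, by omega, ?_, ?_⟩
  · have : u - 1 = (u' - 1) + v * q := by rw [mul_comm v]; omega
    rw [this, Nat.add_mul_div_left _ _ (by omega), Nat.div_eq_of_lt (by omega), zero_add]
  · rw [hv', add_comm, Nat.add_mul_div_right _ _ (by omega), Nat.div_eq_of_lt hlt, zero_add]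
  · rw [hv', add_comm, Nat.add_mul_mod_self_right, Nat.mod_eq_of_lt hlt]

theorem euclidBlock_spec {B u v u' v' q q' : ℕ} (hv : v ≠ 0) (hu : u = q * v + u')
    (hpos : 1 ≤ u') (hle : u' ≤ v) (hv' : v = q' * u' + v') (hlt : v' < u') {r : ℕ → ℕ}
    (h6 : r 6 = 1) (h27 : r 27 = u) (h28 : r 28 = v) (hB1 : 1 ≤ B) (hu2 : u.size ≤ B)
    (hv2 : v.size ≤ B) :
    ∃ r', Exec B (block euclidBlock) r r' [] 13 ∧ r' 27 = u' ∧ r' 28 = v' ∧ r' 29 = q ∧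
      r' 31 = q' ∧ ∀ i, (i < 27 ∨ 31 < i) → r' i = r i := by
  obtain ⟨h1, h2, h3, h4⟩ := euclid_round hu hpos hle hv' hlt
  have hu1 : (u - 1).size ≤ B := (Nat.size_le_size (Nat.sub_le _ _)).trans hu2
  have hqv : (q * v).size ≤ B := (Nat.size_le_size (by omega)).trans hu2
  have hq : q.size ≤ B :=
    (Nat.size_le_size (Nat.le_mul_of_pos_right q (Nat.pos_of_ne_zero hv))).trans hqv
  have hu' : u'.size ≤ B := (Nat.size_le_size hle).trans hv2
  refine ⟨_, exec_block euclidBlock ?_, ?_, ?_, ?_, ?_, fun i hi => ?_⟩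
  · simp [euclidBlock, BlockOk, Op.eval, h6, h27, h28, h1, h2, hB1, hu1, hqv,
      hq, hu', hu2, hv2]
  · simp [euclidBlock, blockEval, Op.eval, h6, h27, h28, h1, h2]
  · simp [euclidBlock, blockEval, Op.eval, h6, h27, h28, h1, h2, h4]
  · simp [euclidBlock, blockEval, Op.eval, h6, h27, h28, h1]
  · simp [euclidBlock, blockEval, Op.eval, h6, h27, h28, h1, h2, h3]
  · refine blockEval_of_notMem ?_ r
    simp only [euclidBlock, List.mem_cons, forall_eq_or_imp, List.not_mem_nil, false_imp_iff,
      implies_true, and_true]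
    omega

/-- The Euclidean algorithm, adding the partial quotients to register `32`. -/
def euclidSum : Prog :=
  .loop 28 (.seq (block euclidBlock) (block [(.add, 32, 32, 29), (.add, 32, 32, 31)]))

theorem exec_euclidSum {B u v : ℕ} {l : List (ℕ × ℕ)} (h : EuclidTrace u v l) (hB1 : 1 ≤ B)
    {r : ℕ → ℕ} (h6 : r 6 = 1) (h27 : r 27 = u) (h28 : r 28 = v) (hu : u.size ≤ B)
    (hv : v.size ≤ B) (h32 : (r 32 + quotientSum l).size ≤ B) :
    ∃ r', Exec B euclidSum r r' [] (20 * l.length + 1) ∧ r' 32 = r 32 + quotientSum l ∧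
      ∀ i, (i < 27 ∨ 32 < i) → r' i = r i := by
  induction h generalizing r with
  | nil u => exact ⟨r, Exec.loop_zero h28, by simp, fun _ _ => rfl⟩
  | cons hv0 hu0 hpos hle hv' hlt h ih =>
    rename_i u v u' v' q q' l
    obtain ⟨r₁, e1, a27, a28, a29, a31, a⟩ :=
      euclidBlock_spec hv0 hu0 hpos hle hv' hlt h6 h27 h28 hB1 hu hv
    have a32 := a 32 (by omega)
    rw [quotientSum_cons] at h32
    simp only at h32
    have s1 : (r 32).size ≤ B := (Nat.size_le_size (by omega)).trans h32
    have s2 : (r 32 + q).size ≤ B := (Nat.size_le_size (by omega)).trans h32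
    have s3 : q.size ≤ B := (Nat.size_le_size (by omega)).trans h32
    have s4 : q'.size ≤ B := (Nat.size_le_size (by omega)).trans h32
    have e2 := exec_block (B := B) (r := r₁) [(.add, 32, 32, 29), (.add, 32, 32, 31)]
      (by simp [BlockOk, Op.eval, a32, a29, a31, s1, s2, s3, s4])
    set r₂ := blockEval [(.add, 32, 32, 29), (.add, 32, 32, 31)] r₁ with hr₂
    have b : ∀ i, i ≠ 32 → r₂ i = r₁ i := fun i hi => blockEval_of_notMem (by simp [hi]) r₁
    have b32 : r₂ 32 = r 32 + q + q' := by
      simp [hr₂, blockEval, Op.eval, a32, a29, a31]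
    obtain ⟨r₃, e3, c32, c⟩ := ih (r := r₂)
      (by rw [b 6 (by omega), a 6 (by omega), h6]) (by rw [b 27 (by omega), a27])
      (by rw [b 28 (by omega), a28]) ((Nat.size_le_size hle).trans hv)
      ((Nat.size_le_size (by omega)).trans hv)
      (by rw [b32]; exact (Nat.size_le_size (by omega)).trans h32)
    refine ⟨r₃, (Exec.loop_step (by omega) (by rwa [h28]) (e1.seq e2) e3).mono ?_, ?_, ?_⟩
    · simp; omega
    · rw [c32, b32, quotientSum_cons]; simp only; omega
    · intro i hi
      rw [c i hi, b i (by omega), a i (by omega)]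

/-- A stack of pairs, coded as a natural number in base `N`. -/
def stackCode (N : ℕ) : List (ℕ × ℕ) → ℕ
  | [] => 0
  | z :: l => (stackCode N l * N + z.1) * N + z.2

theorem stackCode_lt {N : ℕ} {l : List (ℕ × ℕ)} (h : ∀ z ∈ l, z.1 < N ∧ 1 ≤ z.2 ∧ z.2 < N) :
    stackCode N l < N ^ (2 * l.length) := by
  induction l with
  | nil => simp [stackCode]
  | cons z l ih =>
    simp only [List.mem_cons, forall_eq_or_imp] at h
    have h1 := ih h.2
    rw [stackCode, List.length_cons, mul_add, pow_add]
    have h2 : (stackCode N l + 1) * N ≤ N ^ (2 * l.length) * N := Nat.mul_le_mul_right _ h1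
    have h3 : (stackCode N l * N + z.1 + 1) * N ≤ N ^ (2 * l.length) * N * N :=
      Nat.mul_le_mul_right _ (by nlinarith)
    calc _ < (stackCode N l * N + z.1 + 1) * N := by nlinarith
      _ ≤ _ := by rw [mul_one, pow_two, ← mul_assoc]; exact h3

/-- The Euclidean algorithm, emitting the corresponding word and pushing the partial quotients on the
stack in register `33`. -/
def euclidEmit : Prog :=
  .loop 28 (.seq (block euclidBlock) (.seq (block [(.mul, 33, 33, 9), (.add, 33, 33, 29),
    (.mul, 33, 33, 9), (.add, 33, 33, 31)]) (.seq (emitLoop .u 29) (emitLoop .v 31))))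

/-- The stack stores the quotients with the last pair on top, the order in which the inverse word
needs them. -/
theorem exec_euclidEmit {B u v N : ℕ} {l st : List (ℕ × ℕ)} (h : EuclidTrace u v l) (hB1 : 1 ≤ B)
    {r : ℕ → ℕ} (h6 : r 6 = 1) (h9 : r 9 = N) (h27 : r 27 = u) (h28 : r 28 = v)
    (h33 : r 33 = stackCode N st) (hN : u + v < N) (hNB : N.size ≤ B)
    (hst : ∀ z ∈ st, z.1 < N ∧ 1 ≤ z.2 ∧ z.2 < N)
    (hB : (N ^ (2 * (st.length + l.length))).size ≤ B) :
    ∃ r', Exec B euclidEmit r r' (Letter.exponentWord l) (40 * l.length + 4 * quotientSum l + 1) ∧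
      r' 33 = stackCode N (l.reverse ++ st) ∧ ∀ i, i < 27 → r' i = r i := by
  induction h generalizing r st with
  | nil u => exact ⟨r, Exec.loop_zero h28, by simp [h33], fun _ _ => rfl⟩
  | cons hv0 hu0 hpos hle hv' hlt h ih =>
    have hmem := (EuclidTrace.cons hv0 hu0 hpos hle hv' hlt h).mem_lt hN
    rename_i u v u' v' q q' l
    have hz := hmem (q, q') (by simp)
    simp only at hz
    obtain ⟨hq, hq1, hq'⟩ := hz
    have hN0 : 0 < N := by omega
    have small : ∀ {m}, m ≤ N → m.size ≤ B := fun hm => (Nat.size_le_size hm).trans hNB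
    obtain ⟨r₁, e1, a27, a28, a29, a31, a⟩ :=
      euclidBlock_spec hv0 hu0 hpos hle hv' hlt h6 h27 h28 hB1 (small (by omega))
        (small (by omega))
    have a33 := a 33 (by omega)
    have a9 := a 9 (by omega)
    have hst' : ∀ z ∈ (q, q') :: st, z.1 < N ∧ 1 ≤ z.2 ∧ z.2 < N := by
      simp only [List.mem_cons, forall_eq_or_imp]
      exact ⟨⟨hq, hq1, hq'⟩, hst⟩
    have hlen : 2 * ((q, q') :: st).length ≤ 2 * (st.length + ((q, q') :: l).length) := by
      simp
    have hcode := (stackCode_lt hst').le.trans (Nat.pow_le_pow_right hN0 hlen)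
    -- All intermediate values of a push are at most the final code, so a single digit bound covers
    -- them.
    have big : ∀ {m}, m ≤ stackCode N ((q, q') :: st) → m.size ≤ B := fun hm =>
      (Nat.size_le_size (hm.trans hcode)).trans hB
    have t1 : stackCode N st * N ≤ stackCode N st * N + q := Nat.le_add_right _ _
    have t2 : stackCode N st * N + q ≤ (stackCode N st * N + q) * N :=
      Nat.le_mul_of_pos_right _ hN0
    have t3 : stackCode N st ≤ stackCode N st * N := Nat.le_mul_of_pos_right _ hN0
    have t4 : (stackCode N st * N + q) * N ≤ stackCode N ((q, q') :: st) := Nat.le_add_right _ _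
    have e2 := exec_block (B := B) (r := r₁) [(.mul, 33, 33, 9), (.add, 33, 33, 29),
      (.mul, 33, 33, 9), (.add, 33, 33, 31)]
      (by
        simp [BlockOk, Op.eval, a33, a9, a29, a31, h33, h9, hNB,
          small hq.le, small hq'.le, big (t3.trans (t1.trans (t2.trans t4))),
          big (t1.trans (t2.trans t4)), big (t2.trans t4), big t4])
    set r₂ := blockEval [(.mul, 33, 33, 9), (.add, 33, 33, 29),
      (.mul, 33, 33, 9), (.add, 33, 33, 31)] r₁ with hr₂
    have b : ∀ i, i ≠ 33 → r₂ i = r₁ i := fun i hi => blockEval_of_notMem (by simp [hi]) r₁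
    have b33 : r₂ 33 = stackCode N ((q, q') :: st) := by
      simp [hr₂, blockEval, Op.eval, a33, a9, a29, a31, h33, h9, stackCode]
    have b29 : r₂ 29 = q := by rw [b 29 (by omega), a29]
    have b31 : r₂ 31 = q' := by rw [b 31 (by omega), a31]
    have b6 : r₂ 6 = 1 := by rw [b 6 (by omega), a 6 (by omega), h6]
    have e3 := exec_emitLoop (B := B) hB1 .u (y := 29) (r := r₂) b6 (by rw [b29]; exact small hq.le)
    have e4 := exec_emitLoop (B := B) hB1 .v (y := 31) (r := Function.update r₂ 34 0)
      (by simpa using b6) (by simpa [b31] using small hq'.le)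
    rw [Function.update_idem] at e4
    obtain ⟨r₃, e5, c33, c⟩ := ih (r := Function.update r₂ 34 0) (st := (q, q') :: st)
      (by simpa using b6) (by simp [b 9, a9, h9]) (by simp [b 27, a27]) (by simp [b 28, a28])
      (by simp [b33]) (by omega) hst' (by
        rw [List.length_cons] at hB ⊢
        rwa [add_assoc, add_comm 1])
    refine ⟨r₃, ?_, ?_, fun i hi => ?_⟩
    · have := Exec.loop_step (by omega) (by rw [h28]; exact small (by omega))
        (e1.seq (e2.seq (e3.seq e4))) e5
      rw [Letter.exponentWord_cons]
      simp only [b29, Function.update_apply, b31, if_neg (show (31 : ℕ) ≠ 34 by norm_num),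
        List.nil_append] at this
      refine this.mono ?_
      simp
      omega
    · rw [c33]; simp
    · rw [c i hi, Function.update_of_ne (by omega), b i (by omega), a i (by omega)]

/-- Emit the word inverse to the one described by the stack in register `33`. -/
def stackEmit : Prog :=
  .loop 33 (.seq (block [(.mod, 31, 33, 9), (.div, 33, 33, 9), (.mod, 29, 33, 9),
    (.div, 33, 33, 9)]) (.seq (emitLoop .vInv 31) (emitLoop .uInv 29)))

theorem exec_stackEmit {B N : ℕ} {st : List (ℕ × ℕ)} (hB1 : 1 ≤ B) (hNB : N.size ≤ B)
    (hst : ∀ z ∈ st, z.1 < N ∧ 1 ≤ z.2 ∧ z.2 < N) {r : ℕ → ℕ} (h6 : r 6 = 1) (h9 : r 9 = N)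
    (h33 : r 33 = stackCode N st) (hB : (stackCode N st).size ≤ B) :
    ∃ r', Exec B stackEmit r r'
      (st.flatMap fun z => List.replicate z.2 .vInv ++ List.replicate z.1 .uInv)
      (40 * st.length + 4 * quotientSum st + 1) ∧ ∀ i, i < 27 → r' i = r i := by
  induction st generalizing r with
  | nil => exact ⟨r, Exec.loop_zero h33, fun _ _ => rfl⟩
  | cons z st ih =>
    obtain ⟨q, q'⟩ := z
    simp only [List.mem_cons, forall_eq_or_imp] at hst
    obtain ⟨⟨hq, hq1, hq'⟩, hst⟩ := hst
    have hN0 : 0 < N := by omega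
    have small : ∀ {m}, m ≤ N → m.size ≤ B := fun hm => (Nat.size_le_size hm).trans hNB
    have d1 : stackCode N ((q, q') :: st) % N = q' := by
      rw [stackCode, Nat.mul_add_mod_self_right, Nat.mod_eq_of_lt hq']
    have d2 : stackCode N ((q, q') :: st) / N = stackCode N st * N + q := by
      rw [stackCode, add_comm, Nat.add_mul_div_right _ _ hN0, Nat.div_eq_of_lt hq', zero_add]
    have d3 : (stackCode N st * N + q) % N = q := by
      rw [Nat.mul_add_mod_self_right, Nat.mod_eq_of_lt hq]
    have d4 : (stackCode N st * N + q) / N = stackCode N st := by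
      rw [add_comm, Nat.add_mul_div_right _ _ hN0, Nat.div_eq_of_lt hq, zero_add]
    -- Since `q' ≥ 1`, a nonempty stack has nonzero code, so the loop does not stop early.
    have hne : stackCode N ((q, q') :: st) ≠ 0 := by rw [stackCode]; simp only; omega
    have s1 : (stackCode N st * N + q).size ≤ B := by
      rw [← d2]; exact (Nat.size_le_size (Nat.div_le_self _ _)).trans hB
    have s2 : (stackCode N st).size ≤ B := by
      rw [← d4]; exact (Nat.size_le_size (Nat.div_le_self _ _)).trans s1
    have e2 := exec_block (B := B) (r := r) [(.mod, 31, 33, 9), (.div, 33, 33, 9), (.mod, 29, 33, 9),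
      (.div, 33, 33, 9)] (by
        simp [BlockOk, Op.eval, h33, h9, d1, d2, d3, hNB, hB, s1])
    set r₂ := blockEval [(.mod, 31, 33, 9), (.div, 33, 33, 9), (.mod, 29, 33, 9),
      (.div, 33, 33, 9)] r with hr₂
    have b : ∀ i, i < 27 → r₂ i = r i := fun i hi =>
      blockEval_of_notMem (by simp; omega) r
    have b33 : r₂ 33 = stackCode N st := by
      simp [hr₂, blockEval, Op.eval, h33, h9, d1, d2, d3, d4]
    have b29 : r₂ 29 = q := by
      simp [hr₂, blockEval, Op.eval, h33, h9, d1, d2, d3, d4]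
    have b31 : r₂ 31 = q' := by
      simp [hr₂, blockEval, Op.eval, h33, h9, d1, d2, d3, d4]
    have b6 : r₂ 6 = 1 := by rw [b 6 (by omega), h6]
    have e3 := exec_emitLoop (B := B) hB1 .vInv (y := 31) (r := r₂) b6
      (by rw [b31]; exact small hq'.le)
    have e4 := exec_emitLoop (B := B) hB1 .uInv (y := 29) (r := Function.update r₂ 34 0)
      (by simpa using b6) (by simpa [b29] using small hq.le)
    rw [Function.update_idem] at e4
    obtain ⟨r₃, e5, c⟩ := ih (r := Function.update r₂ 34 0) hst
      (by simpa using b6) (by simp [b 9, h9]) (by simp [b33]) s2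
    refine ⟨r₃, ?_, fun i hi => ?_⟩
    · have := Exec.loop_step (by omega) (by rwa [h33]) (e2.seq (e3.seq e4)) e5
      rw [List.flatMap_cons]
      simp only [b29, Function.update_apply, b31, if_neg (show (29 : ℕ) ≠ 34 by norm_num),
        List.nil_append] at this
      refine this.mono ?_
      simp
      omega
    · rw [c i hi, Function.update_of_ne (by omega), b i (by omega)]


/-! ### The fixed registers and digit bounds -/

/-- A bound for the number of digits of the registers. -/
def digitBound (p : ℕ) : ℕ := 24 * p.size ^ 2 + 6 * p.size + 100

/-- The contents of the registers that are initialized once. -/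
structure Env (p : ℕ) (r : ℕ → ℕ) : Prop where
  r0 : r 0 = p
  r6 : r 6 = 1
  r7 : r 7 = 2
  r8 : r 8 = p ^ 3
  r9 : r 9 = p ^ 4
  r10 : r 10 = quotientBound p
  r11 : r 11 = p % 2
  r12 : r 12 = (p + 1) / 2
  r17 : r 17 = (p * p).size

/-- Registers `1` to `5` may change, as the environment does not mention them. -/
theorem Env.congr {p : ℕ} {r r' : ℕ → ℕ} (h : Env p r)
    (hr : ∀ i, i ≤ 12 ∨ i = 17 → i ≠ 1 → i ≠ 2 → i ≠ 3 → i ≠ 4 → i ≠ 5 → r' i = r i) :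
    Env p r' := by
  constructor <;> rw [hr _ (by omega) (by omega) (by omega) (by omega) (by omega) (by omega)]
  exacts [h.r0, h.r6, h.r7, h.r8, h.r9, h.r10, h.r11, h.r12, h.r17]

section Bounds

variable {p : ℕ}

theorem size_pow_le (n k : ℕ) : (n ^ k).size ≤ k * n.size + 1 := by
  rw [Nat.size_le, pow_succ, mul_comm k, pow_mul]
  have := Nat.pow_le_pow_left n.lt_size_self.le k
  have : 0 < (2 ^ n.size) ^ k := by positivity
  omega

theorem size_le_digitBound {n : ℕ} (h : n ≤ 8 * p ^ 6) : n.size ≤ digitBound p := by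
  refine (Nat.size_le_size h).trans ((Nat.size_mul_le _ _).trans ?_)
  have h8 : Nat.size 8 ≤ 4 := Nat.size_le.2 (by norm_num)
  have := size_pow_le p 6
  unfold digitBound
  omega

theorem size_cube_le : (p ^ 3).size ≤ 3 * p.size := by
  have h1 := Nat.size_mul_le p p
  have h2 := Nat.size_mul_le (p * p) p
  have : p ^ 3 = p * p * p := by ring
  rw [this]
  omega

/-- The stack is what makes `digitBound` quadratic: at most `3 * p.size` pairs of digits in base `p
^ 4`. -/
theorem size_stack_le {k : ℕ} (hk : k ≤ 3 * p.size) :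
    ((p ^ 4) ^ (2 * k)).size ≤ digitBound p := by
  rw [← pow_mul]
  refine (size_pow_le _ _).trans ?_
  unfold digitBound
  nlinarith [Nat.zero_le p.size]

theorem size_quotientBound_le : (quotientBound p).size ≤ digitBound p := by
  unfold quotientBound
  refine (Nat.size_mul_le _ _).trans ?_
  have h1 : (2 ^ 50).size ≤ 51 := Nat.size_le.2 (by norm_num)
  have h2 := Nat.size_mul_le p.size p.size.size
  have h3 : p.size.size ≤ p.size := Nat.size_le.2 Nat.lt_two_pow_self
  have h4 : p.size.size.size ≤ p.size.size := Nat.size_le.2 Nat.lt_two_pow_self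
  unfold digitBound
  nlinarith

theorem size_sq_le : (p * p).size ≤ 2 * p.size := by
  have := Nat.size_mul_le p p
  omega

theorem two_pow_size_sq_le (hp : 0 < p) : 2 ^ (p * p).size ≤ 2 * p ^ 2 := by
  have h0 : 0 < (p * p).size := Nat.size_pos.2 (by positivity)
  have : 2 ^ ((p * p).size - 1) ≤ p * p := Nat.lt_size.1 (by omega)
  calc 2 ^ (p * p).size = 2 * 2 ^ ((p * p).size - 1) := by
        rw [← pow_succ']; congr 1; omega
    _ ≤ 2 * (p * p) := Nat.mul_le_mul_left _ this
    _ = _ := by ring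

theorem pow_le_eight_mul (hp : 0 < p) {k : ℕ} (hk : k ≤ 6) : p ^ k ≤ p ^ 6 :=
  Nat.pow_le_pow_right hp hk

end Bounds

/-! ### Random numbers and rejection sampling -/

/-- The loop that appends as many random bits to register `23` as register `24` says. -/
def bitLoop : Prog :=
  .loop 24 (.seq (.flip 25) (block [(.add, 23, 23, 23), (.add, 23, 23, 25), (.sub, 24, 24, 6)]))

/-- Here `F i` bounds the continuation when the drawn number is `i`, and the conclusion averages
over all `i`. A single `β` as in `Hoare` would not do, since good and bad draws continue
differently. -/
theorem le_haltProb_bitLoop {B : ℕ} (hB : 1 ≤ B) (G : Config → Prop) (k : List Prog)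
    (w : List Letter) (n : ℕ) (r : ℕ → ℕ) (t : ℕ) (h6 : r 6 = 1) (h24 : r 24 = n) (hn : n ≤ B)
    (h23 : (r 23 + 1) * 2 ^ n ≤ 2 ^ B) (F : ℕ → ℝ≥0∞)
    (hF : ∀ i < 2 ^ n, ∀ r' T, T ≤ (10 * n + 1) * (B + 1) ^ 2 → r' 23 = r 23 * 2 ^ n + i →
      (∀ j < 23, r' j = r j) → F i ≤ haltProb G ⟨k, r', w, t + T⟩) :
    (2⁻¹) ^ n * ∑ i ∈ Finset.range (2 ^ n), F i ≤ haltProb G ⟨bitLoop :: k, r, w, t⟩ := by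
  induction n generalizing r t F with
  | zero =>
    simp only [pow_zero, one_mul, Finset.range_one, Finset.sum_singleton]
    refine (hF 0 (by simp) r 1 (by nlinarith [Nat.zero_le B]) (by simp) fun _ _ => rfl).trans ?_
    exact le_haltProb_of_step_eq_pure (by simp [bitLoop, step, h24])
  | succ n ih =>
    have hsn : (n + 1).size ≤ B := (Nat.size_le.2 Nat.lt_two_pow_self).trans hn
    have hpow : 0 < 2 ^ n := by positivity
    have h23' : (2 * r 23 + 2) * 2 ^ n ≤ 2 ^ B := by
      calc _ = (r 23 + 1) * 2 ^ (n + 1) := by ring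
        _ ≤ _ := h23
    have hlt : 2 * r 23 + 1 < 2 ^ B := by nlinarith
    have hhalf : ∀ b ≤ 1, (2⁻¹) ^ n * ∑ i ∈ Finset.range (2 ^ n), F (b * 2 ^ n + i) ≤
        haltProb G ⟨block [(.add, 23, 23, 23), (.add, 23, 23, 25), (.sub, 24, 24, 6)] ::
          bitLoop :: k, Function.update r 25 b, w, t + ((n + 1).size + 1) + 1 + 1⟩ := by
      intro b hb
      have sB : ∀ m, m ≤ 2 * r 23 + 1 → m.size ≤ B := fun m hm =>
        Nat.size_le.2 (lt_of_le_of_lt hm hlt)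
      obtain ⟨T₁, hT₁, H⟩ := exec_block (B := B) (r := Function.update r 25 b)
        [(.add, 23, 23, 23), (.add, 23, 23, 25), (.sub, 24, 24, 6)] (by
          simp only [BlockOk, Op.eval, ne_eq, Nat.reduceEqDiff,
            not_false_eq_true, Function.update_of_ne, Function.update_self, h24, h6]
          exact ⟨sB _ (by omega), sB _ (by omega), sB _ (by omega), sB _ (by omega), hsn,
            sB _ (by omega), trivial⟩)
      refine le_trans ?_ (H _ _ _ _)
      set r₁ := blockEval [(.add, 23, 23, 23), (.add, 23, 23, 25), (.sub, 24, 24, 6)]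
        (Function.update r 25 b) with hr₁
      have a : ∀ i < 23, r₁ i = r i := fun i hi => by
        rw [hr₁, blockEval_of_notMem (by simp; omega), Function.update_of_ne (by omega)]
      have a23 : r₁ 23 = 2 * r 23 + b := by simp [hr₁, blockEval, Op.eval]; ring
      have a24 : r₁ 24 = n := by simp [hr₁, blockEval, Op.eval, h24, h6]
      rw [List.append_nil]
      refine ih r₁ _ (by rw [a 6 (by omega), h6]) a24 (by omega) ?_ _ ?_
      · rw [a23]
        exact le_trans (Nat.mul_le_mul_right _ (by omega)) h23'
      · intro i hi r' T hT h1 h2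
        have := hF (b * 2 ^ n + i) ?_ r' (((n + 1).size + 1) + 1 + 1 + T₁ + T) ?_ ?_
          fun j hj => by rw [h2 j hj, a j hj]
        · simpa [add_assoc] using this
        · rw [pow_succ]
          nlinarith
        · simp only [List.length_cons, List.length_nil] at hT₁
          nlinarith [Nat.zero_le B]
        · rw [h1, a23]; ring
    have h0 := hhalf 0 (by norm_num)
    have h1 := hhalf 1 le_rfl
    have hstep := le_haltProb_flip G 25
      (block [(.add, 23, 23, 23), (.add, 23, 23, 25), (.sub, 24, 24, 6)] :: bitLoop :: k) r w
      (t + ((n + 1).size + 1) + 1)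
    have e1 : haltProb G ⟨.flip 25 :: block [(.add, 23, 23, 23), (.add, 23, 23, 25),
        (.sub, 24, 24, 6)] :: bitLoop :: k, r, w, t + ((n + 1).size + 1) + 1⟩ ≤
        haltProb G ⟨bitLoop :: k, r, w, t⟩ :=
      le_trans (le_haltProb_of_step_eq_pure (c := ⟨.seq (.flip 25) (block [(.add, 23, 23, 23),
        (.add, 23, 23, 25), (.sub, 24, 24, 6)]) :: bitLoop :: k, r, w, t + ((n + 1).size + 1)⟩)
        (by simp [step])) (le_haltProb_of_step_eq_pure (by simp [bitLoop, step, h24]))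
    refine le_trans ?_ (hstep.trans e1)
    refine le_trans (le_of_eq ?_) (add_le_add (mul_le_mul_right h0 _) (mul_le_mul_right h1 _))
    -- The first flip is the leading bit, so its two outcomes are the two halves of the range.
    rw [pow_succ 2 n, mul_two, Finset.sum_range_add]
    simp only [zero_mul, zero_add, one_mul]
    rw [pow_succ']
    ring

/-- Write as many random bits to register `23` as register `17` says. -/
def drawBits : Prog := .seq (block [(.sub, 23, 6, 6), (.mul, 24, 17, 6)]) bitLoop

theorem le_haltProb_drawBits {B n : ℕ} (hB : 1 ≤ B) (G : Config → Prop) (k : List Prog)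
    (w : List Letter) (r : ℕ → ℕ) (t : ℕ) (h6 : r 6 = 1) (h17 : r 17 = n) (hn : n ≤ B)
    (F : ℕ → ℝ≥0∞)
    (hF : ∀ i < 2 ^ n, ∀ r' T, T ≤ (10 * n + 10) * (B + 1) ^ 2 → r' 23 = i →
      (∀ j < 23, r' j = r j) → F i ≤ haltProb G ⟨k, r', w, t + T⟩) :
    (2⁻¹) ^ n * ∑ i ∈ Finset.range (2 ^ n), F i ≤ haltProb G ⟨drawBits :: k, r, w, t⟩ := by
  have hs : n.size ≤ B := (Nat.size_le.2 Nat.lt_two_pow_self).trans hn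
  obtain ⟨T₁, hT₁, H⟩ := exec_block (B := B) (r := r) [(.sub, 23, 6, 6), (.mul, 24, 17, 6)] (by
    simp [BlockOk, h6, h17, hB, hs])
  refine le_trans ?_ (le_haltProb_of_step_eq_pure
    (c' := ⟨block [(.sub, 23, 6, 6), (.mul, 24, 17, 6)] :: bitLoop :: k, r, w, t + 1⟩)
    (by simp [drawBits, step]))
  refine le_trans ?_ (H _ _ _ _)
  set r₁ := blockEval [(.sub, 23, 6, 6), (.mul, 24, 17, 6)] r with hr₁
  have a : ∀ i < 23, r₁ i = r i := fun i hi => blockEval_of_notMem (by simp; omega) r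
  have a23 : r₁ 23 = 0 := by simp [hr₁, blockEval, Op.eval, h6]
  have a24 : r₁ 24 = n := by simp [hr₁, blockEval, Op.eval, h6, h17]
  rw [List.append_nil]
  refine le_haltProb_bitLoop hB G k w n r₁ _ (by rw [a 6 (by omega), h6]) a24 hn ?_ F ?_
  · rw [a23, zero_add, one_mul]
    exact Nat.pow_le_pow_right two_pos hn
  · intro i hi r' T hT h1 h2
    have := hF i hi r' (1 + T₁ + T) ?_ (by rw [h1, a23]; simp) fun j hj => by rw [h2 j hj, a j hj]
    · simpa [add_assoc] using this
    · simp only [List.length_cons, List.length_nil] at hT₁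
      nlinarith [Nat.zero_le B]

/-- Lift the residue in register `y` using the random number in register `23`, and set register `22`
to zero if the partial quotients of the lift have a small sum. -/
def testLift (y : ℕ) : Prog :=
  .seq (block [(.mul, 26, 23, 0), (.add, 26, 26, y), (.mod, 26, 26, 8), (.mul, 27, 26, 6),
    (.mul, 28, 8, 6), (.sub, 32, 6, 6)]) (.seq euclidSum (.arith .sub 22 32 10))

/-- The subtraction is truncated, so register `22`, which controls the search loop, vanishes exactly
when the lift is accepted. -/
theorem exec_testLift {p k a y : ℕ} {r : ℕ → ℕ} {l : List (ℕ × ℕ)} (hp : 0 < p) (hr : Env p r)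
    (hk : r 23 = k) (hk2 : k < 2 ^ (p * p).size) (hy : r y = a) (hy22 : y < 22) (hap : a < p)
    (hl : EuclidTrace ((a + k * p) % p ^ 3) (p ^ 3) l) :
    ∃ r', Exec (digitBound p) (testLift y) r r' [] (60 * p.size + 20) ∧
      r' 26 = (a + k * p) % p ^ 3 ∧ r' 22 = quotientSum l - quotientBound p ∧
      ∀ i < 22, r' i = r i := by
  have hB1 : 1 ≤ digitBound p := by unfold digitBound; omega
  have hX : (a + k * p) % p ^ 3 < p ^ 3 := Nat.mod_lt _ (by positivity)
  have hk3 : k ≤ 2 * p ^ 2 := hk2.le.trans (two_pow_size_sq_le hp)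
  have hkp : k * p ≤ 2 * p ^ 3 := by
    calc k * p ≤ 2 * p ^ 2 * p := Nat.mul_le_mul_right _ hk3
      _ = _ := by ring
  have p1 : p ≤ p ^ 6 := by simpa using pow_le_eight_mul hp (k := 1) (by norm_num)
  have p2 := pow_le_eight_mul hp (k := 2) (by norm_num)
  have p3 := pow_le_eight_mul hp (k := 3) (by norm_num)
  have hlen : l.length ≤ 3 * p.size := hl.length_le.trans size_cube_le
  have hsum := hl.quotientSum_le
  have e1 := exec_block (B := digitBound p) (r := r) [(.mul, 26, 23, 0), (.add, 26, 26, y),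
    (.mod, 26, 26, 8), (.mul, 27, 26, 6), (.mul, 28, 8, 6), (.sub, 32, 6, 6)] (by
      have hy26 : y ≠ 26 := by omega
      simp only [BlockOk, Op.eval, ne_eq, Nat.reduceEqDiff, hy26,
        not_false_eq_true, Function.update_of_ne, Function.update_self, hr.r0, hr.r6, hr.r8, hk, hy,
        add_comm (k * p)]
      refine ⟨?_, ?_, ?_, ?_, ?_, ?_, ?_, ?_, ?_, ?_, ?_, ?_, trivial⟩ <;>
        exact size_le_digitBound (by omega))
  set r₁ := blockEval [(.mul, 26, 23, 0), (.add, 26, 26, y), (.mod, 26, 26, 8), (.mul, 27, 26, 6),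
    (.mul, 28, 8, 6), (.sub, 32, 6, 6)] r with hr₁
  have a1 : ∀ i < 23, r₁ i = r i := fun i hi => blockEval_of_notMem (by simp; omega) r
  have hy26 : y ≠ 26 := by omega
  have a26 : r₁ 26 = (a + k * p) % p ^ 3 := by
    simp [hr₁, blockEval, Op.eval, hr.r0, hr.r6, hr.r8, hk, hy, hy26, add_comm]
  have a27 : r₁ 27 = (a + k * p) % p ^ 3 := by
    simp [hr₁, blockEval, Op.eval, hr.r0, hr.r6, hr.r8, hk, hy, hy26, add_comm]
  have a28 : r₁ 28 = p ^ 3 := by simp [hr₁, blockEval, Op.eval, hr.r6, hr.r8]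
  have a32 : r₁ 32 = 0 := by simp [hr₁, blockEval, Op.eval, hr.r6]
  obtain ⟨r₂, e2, b32, b⟩ := exec_euclidSum (B := digitBound p) hl hB1
    (by rw [a1 6 (by omega), hr.r6]) a27 a28 (size_le_digitBound (by omega))
    (size_le_digitBound (by omega)) (size_le_digitBound (by omega))
  have b10 : r₂ 10 = quotientBound p := by rw [b 10 (by omega), a1 10 (by omega), hr.r10]
  rw [a32, zero_add] at b32
  have e3 := Exec.arith (B := digitBound p) (r := r₂) (x := 22) .sub (y := 32) (z := 10)
    (by rw [b32]; exact size_le_digitBound (by omega)) (by rw [b10]; exact size_quotientBound_le)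
  refine ⟨_, (e1.seq (e2.seq e3)).mono ?_, ?_, ?_, fun i hi => ?_⟩
  · simp; omega
  · rw [Function.update_of_ne (by norm_num), b 26 (by omega), a26]
  · rw [Function.update_self, b32, b10]; rfl
  · rw [Function.update_of_ne (by omega), b i (by omega), a1 i (by omega)]

/-- The probability of at least one success in `m` fair trials. -/
noncomputable def trialProb : ℕ → ℝ≥0∞
  | 0 => 0
  | m + 1 => 2⁻¹ + 2⁻¹ * trialProb m

theorem trialProb_le_one (m : ℕ) : trialProb m ≤ 1 := by
  induction m with
  | zero => simp [trialProb]
  | succ m ih =>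
    calc _ ≤ 2⁻¹ + 2⁻¹ * 1 := add_le_add_right (mul_le_mul_right ih _) _
      _ = 1 := by rw [mul_one, ENNReal.inv_two_add_inv_two]

/-- Register `26` holds a good lift of the residue in register `y`. -/
def GoodLift (p y : ℕ) (r r' : ℕ → ℕ) (o : List Letter) : Prop :=
  o = [] ∧ (∀ i < 22, r' i = r i) ∧ (p : ℤ) ∣ r' 26 - r y ∧ r' 26 < p ^ 3 ∧
    ∃ l, EuclidTrace (r' 26) (p ^ 3) l ∧ quotientSum l ≤ quotientBound p

/-- Search for a good lift of the residue in register `y`. -/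
def searchLift (y : ℕ) : Prog := .seq (.const 22 1) (.loop 22 (.seq drawBits (testLift y)))

/-- One trial: a draw in the bad set `S` leaves `q * β`, any other draw gives `β`. As `q ≤ 1`, the
worst case is that `S` is exactly half of the draws. -/
theorem half_mul_add_le {n : ℕ} (hn : 1 ≤ n) {S : Finset ℕ} (hS : S ⊆ Finset.range (2 ^ n))
    (hcard : 2 * S.card ≤ 2 ^ n) {β q : ℝ≥0∞} (hq : q ≤ 1) [DecidablePred (· ∈ S)] :
    (2⁻¹ + 2⁻¹ * q) * β ≤
      (2⁻¹) ^ n * ∑ i ∈ Finset.range (2 ^ n), if i ∈ S then q * β else β := by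
  obtain ⟨n, rfl⟩ : ∃ m, n = m + 1 := ⟨n - 1, by omega⟩
  rw [pow_succ] at hcard
  have hS' : S.card ≤ 2 ^ n := by omega
  obtain ⟨c, hc⟩ := Nat.exists_eq_add_of_le hS'
  rw [Finset.sum_ite, Finset.sum_const, Finset.sum_const, Finset.filter_mem_eq_inter,
    Finset.inter_eq_right.2 hS]
  have h2 : (Finset.filter (fun x => x ∉ S) (Finset.range (2 ^ (n + 1)))).card = 2 ^ n + c := by
    have := Finset.card_filter_add_card_filter_not (s := Finset.range (2 ^ (n + 1))) (· ∈ S)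
    rw [Finset.filter_mem_eq_inter, Finset.inter_eq_right.2 hS, Finset.card_range] at this
    have hpow : 2 ^ (n + 1) = 2 ^ n * 2 := pow_succ 2 n
    omega
  rw [h2]
  have h3 : (2 ^ n : ℕ) • (q * β) + (2 ^ n : ℕ) • β ≤ S.card • (q * β) + (2 ^ n + c) • β := by
    have h4 : c • (q * β) ≤ c • β := nsmul_le_nsmul_right (by simpa using mul_le_mul_left hq β) c
    generalize 2 ^ n = N at hc
    rw [hc]
    simp only [add_smul]
    calc _ = S.card • (q * β) + S.card • β + c • β + c • (q * β) := by abel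
      _ ≤ S.card • (q * β) + S.card • β + c • β + c • β := add_le_add_right h4 _
      _ = _ := by abel
  refine le_trans (le_of_eq ?_) (mul_le_mul_right h3 _)
  have h5 : (2⁻¹ : ℝ≥0∞) ^ n * 2 ^ n = 1 := by
    rw [← mul_pow, ENNReal.inv_mul_cancel (by norm_num) (by norm_num), one_pow]
  rw [nsmul_eq_mul, nsmul_eq_mul, ← mul_add]
  push_cast
  calc _ = 1 * (2⁻¹ * (q * β + β)) := by ring
    _ = _ := by rw [← h5]; ring

/-- The program contains no `m`; the induction only counts the runs that stop within `m` trials and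
gives up on the others, which is why `trialProb 0 = 0`. -/
theorem hoare_trialLoop {p y : ℕ} (hp : p.Prime) (hy : y < 22) (m : ℕ) {r : ℕ → ℕ} (hr : Env p r)
    (ha : 1 ≤ r y) (hap : r y < p) (h22 : r 22 ≠ 0) (h22s : (r 22).size ≤ digitBound p) :
    Hoare (digitBound p) (trialProb m) (.loop 22 (.seq drawBits (testLift y))) r
      (m * (100 * p.size + 50) + 1) (GoodLift p y r) := by
  classical
  have hB1 : 1 ≤ digitBound p := by unfold digitBound; omega
  have hn1 : 1 ≤ (p * p).size := Nat.size_pos.2 (Nat.mul_pos hp.pos hp.pos)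
  have hnB : (p * p).size ≤ digitBound p := size_sq_le.trans (by unfold digitBound; omega)
  have hpa : ¬ p ∣ r y := fun h => absurd (Nat.le_of_dvd ha h) (by omega)
  induction m generalizing r with
  | zero => intro k w t G β _; simp [trialProb]
  | succ m ih =>
    intro k w t G β hβ
    set B := digitBound p with hBdef
    set L : Prog := .loop 22 (.seq drawBits (testLift y)) with hL
    refine le_trans ?_ (le_trans (le_haltProb_of_step_eq_pure
      (c := ⟨.seq drawBits (testLift y) :: L :: k, r, w, t + ((r 22).size + 1)⟩)
      (c' := ⟨drawBits :: testLift y :: L :: k, r, w, t + ((r 22).size + 1) + 1⟩)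
      (by simp [step])) (le_haltProb_of_step_eq_pure (by simp [hL, step, h22])))
    set S := (Finset.range (2 ^ (p * p).size)).filter fun k =>
      IsBadLift p (quotientBound p) ((r y + k * p) % p ^ 3) with hSdef
    rw [trialProb]
    -- A rejected draw reenters the loop with one trial fewer and the same residue in register `y`.
    refine (half_mul_add_le hn1 (S := S) (Finset.filter_subset _ _)
      (by convert two_mul_card_bad_le hp hpa) (trialProb_le_one m)).trans ?_
    refine le_haltProb_drawBits (B := B) hB1 G _ w r _ hr.r6 hr.r17 hnB _ ?_
    intro i hi r₁ T₁ hT₁ h23 hfr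
    have hr₁ : Env p r₁ := hr.congr fun j hj _ _ _ _ _ => hfr j (by omega)
    have hy₁ : r₁ y = r y := hfr y (by omega)
    have hXd : (p : ℤ) ∣ (((r y + i * p) % p ^ 3 : ℕ) : ℤ) - r y := by
      push_cast
      have h1 : (p : ℤ) ∣ (r y + i * p : ℤ) - (r y + i * p : ℤ) % p ^ 3 :=
        dvd_trans (dvd_pow_self _ (by norm_num)) (Int.dvd_self_sub_emod)
      exact (dvd_sub (dvd_mul_left (p : ℤ) i) h1).trans (Eq.dvd (by ring))
    have hX1 : 1 ≤ (r y + i * p) % p ^ 3 := by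
      refine Nat.pos_of_ne_zero fun h0 => ?_
      rw [h0] at hXd
      simp only [Nat.cast_zero, zero_sub, dvd_neg] at hXd
      exact hpa (by exact_mod_cast hXd)
    have hX3 : (r y + i * p) % p ^ 3 < p ^ 3 := Nat.mod_lt _ (pow_pos hp.pos 3)
    have hT0 := size_sq_le (p := p)
    have time : ∀ T₂ c, T₂ ≤ (60 * p.size + 20) * (B + 1) ^ 2 → c ≤ B →
        c + 1 + 1 + T₁ + T₂ ≤ (100 * p.size + 50) * (B + 1) ^ 2 := by
      intro T₂ c h1 h2
      have h3 : T₁ ≤ (20 * p.size + 10) * (B + 1) ^ 2 :=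
        hT₁.trans (Nat.mul_le_mul_right _ (by omega))
      nlinarith [Nat.zero_le (p.size * (B + 1) ^ 2)]
    by_cases hS : i ∈ S
    · rw [if_pos hS]
      have hbad := (Finset.mem_filter.1 hS).2
      obtain ⟨l, hl⟩ := EuclidTrace.exists_trace _ (p ^ 3) hX1
      obtain ⟨r₂, ⟨T₂, hT₂, H⟩, c26, c22, c⟩ := exec_testLift hp.pos hr₁ h23 hi hy₁ hy hap hl
      refine le_trans ?_ (H _ _ _ _)
      rw [List.append_nil]
      have hlt := hbad l hl
      have hsum := hl.quotientSum_le
      have p3 := pow_le_eight_mul hp.pos (k := 3) (by norm_num)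
      have hr₂ : Env p r₂ := hr₁.congr fun j hj _ _ _ _ _ => c j (by omega)
      have hfr₂ : ∀ j < 22, r₂ j = r j := fun j hj => by rw [c j hj, hfr j (by omega)]
      refine ih hr₂ (by rwa [hfr₂ y hy]) (by rwa [hfr₂ y hy]) (by rw [c22]; omega)
        (by rw [c22]; exact size_le_digitBound (by omega)) (by rwa [hfr₂ y hy]) k w _ G β ?_
      intro r' o T hT hpost
      have := hβ r' o ((r 22).size + 1 + 1 + T₁ + T₂ + T) ?_ ?_
      · simpa [add_assoc] using this
      · have := time T₂ _ hT₂ h22s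
        nlinarith
      · obtain ⟨g1, g2, g3, g4⟩ := hpost
        refine ⟨g1, fun j hj => by rw [g2 j hj, hfr₂ j hj], ?_, g4⟩
        rwa [hfr₂ y hy] at g3
    · rw [if_neg hS]
      have hgood : ¬ IsBadLift p (quotientBound p) ((r y + i * p) % p ^ 3) := fun h =>
        hS (Finset.mem_filter.2 ⟨Finset.mem_range.2 hi, h⟩)
      unfold IsBadLift at hgood
      push Not at hgood
      obtain ⟨l, hl, hle⟩ := hgood
      obtain ⟨r₂, ⟨T₂, hT₂, H⟩, c26, c22, c⟩ := exec_testLift hp.pos hr₁ h23 hi hy₁ hy hap hl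
      refine le_trans ?_ (H _ _ _ _)
      rw [List.append_nil]
      have h0 : r₂ 22 = 0 := by rw [c22]; omega
      refine le_trans ?_ (le_haltProb_of_step_eq_pure (c' := ⟨k, r₂, w,
        t + ((r 22).size + 1) + 1 + T₁ + T₂ + 1⟩) (by simp [hL, step, h0]))
      have := hβ r₂ [] ((r 22).size + 1 + 1 + T₁ + T₂ + 1) ?_ ?_
      · simpa [add_assoc] using this
      · have := time T₂ _ hT₂ h22s
        nlinarith [Nat.zero_le (m * (100 * p.size + 50) * (B + 1) ^ 2), Nat.zero_le B]
      · refine ⟨rfl, fun j hj => by rw [c j hj, hfr j (by omega)], ?_, ?_, l, ?_, hle⟩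
        · rw [c26]; exact hXd
        · rw [c26]; exact hX3
        · rw [c26]; exact hl

theorem hoare_searchLift {p y : ℕ} (hp : p.Prime) (hy : y < 22) (m : ℕ) {r : ℕ → ℕ} (hr : Env p r)
    (ha : 1 ≤ r y) (hap : r y < p) :
    Hoare (digitBound p) (trialProb m) (searchLift y) r (m * (100 * p.size + 50) + 3)
      (GoodLift p y r) := by
  have hB1 : 1 ≤ digitBound p := by unfold digitBound; omega
  have h1 := (Exec.const (B := digitBound p) (x := 22) r (c := 1) (by simpa using hB1)).hoare
    (Post := fun r' o => r' = Function.update r 22 1 ∧ o = []) ⟨rfl, rfl⟩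
  have h2 := h1.seq (Q := .loop 22 (.seq drawBits (testLift y))) (q₂ := trialProb m)
    (n₂ := m * (100 * p.size + 50) + 1) (Post := GoodLift p y r) ?_
  · exact h2.mono (by rw [one_mul]) (by omega) fun _ _ h => h
  · rintro r₁ o₁ ⟨rfl, rfl⟩
    have hyne : y ≠ 22 := by omega
    refine (hoare_trialLoop hp hy m (r := Function.update r 22 1)
      (hr.congr fun j _ _ _ _ _ _ => Function.update_of_ne (by omega) _ _) ?_ ?_ ?_ ?_).mono le_rfl
      le_rfl fun r₂ o₂ h => ?_
    · rwa [Function.update_of_ne hyne]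
    · rwa [Function.update_of_ne hyne]
    · simp
    · simpa using hB1
    · obtain ⟨g1, g2, g3, g4⟩ := h
      rw [Function.update_of_ne hyne] at g3
      exact ⟨by simpa using g1, fun j hj => by rw [g2 j hj, Function.update_of_ne (by omega)],
        g3, g4⟩


/-! ### Words for unipotent elements -/

/-- Emit a word for the conjugate of the letter `l` by a matrix with first column `(a, 0)`, where `a`
is the residue in register `y`, or nothing if `a = 0`. -/
def conjLetter (l : Letter) (y : ℕ) : Prog :=
  .ite y (.seq (searchLift y) (.seq (block [(.mul, 27, 26, 6), (.mul, 28, 8, 6), (.sub, 33, 6, 6)])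
    (.seq euclidEmit (.seq (.emit l) stackEmit)))) .skip

theorem coprime_of_dvd_sub {p a x : ℕ} (hp : p.Prime) (ha : 1 ≤ a) (hap : a < p)
    (h : (p : ℤ) ∣ x - a) : x.Coprime (p ^ 3) := by
  refine ((hp.coprime_iff_not_dvd).2 fun hx => ?_).symm.pow_right 3
  have h1 : (p : ℤ) ∣ (a : ℤ) := by
    simpa using dvd_sub (Int.natCast_dvd_natCast.2 hx) h
  exact absurd (Nat.le_of_dvd ha (Int.natCast_dvd_natCast.1 h1)) (by omega)

/-- The number of steps of `conjLetter` with `m` trials. -/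
def conjSteps (p m : ℕ) : ℕ := m * (100 * p.size + 50) + 240 * p.size + 8 * quotientBound p + 40

/-- The accepted lift is coprime to `p ^ 3`, so the emitted prefix has first column `(x, p ^ 3)`,
which is `(a, 0)` modulo `p`. The letter and the inverse word then complete the conjugate. Zero has
no coprime lift, but there the empty word is right. -/
theorem hoare_conjLetter {p y : ℕ} (hp : p.Prime) (hy : y < 22) (m : ℕ) {r : ℕ → ℕ} (hr : Env p r)
    (hap : r y < p) {l : Letter} {σ : ZMod p} (hl : Letter.eval (ZMod p) l = Letter.unip σ) :
    Hoare (digitBound p) (trialProb m) (conjLetter l y) r (conjSteps p m) fun r' o =>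
      (∀ i < 22, r' i = r i) ∧
      Letter.evalWord (ZMod p) o = Letter.unip (σ * (r y : ZMod p) ^ 2) ∧
      o.length ≤ 2 * quotientBound p + 1 := by
  have hp0 := hp.pos
  have hB1 : 1 ≤ digitBound p := by unfold digitBound; omega
  have p1 : p ≤ p ^ 6 := by simpa using pow_le_eight_mul hp0 (k := 1) (by norm_num)
  have p3 := pow_le_eight_mul hp0 (k := 3) (by norm_num)
  have p4 := pow_le_eight_mul hp0 (k := 4) (by norm_num)
  rcases Nat.eq_zero_or_pos (r y) with h0 | ha
  · refine (Hoare.ite_neg h0 ((Exec.skip r).hoare ⟨fun _ _ => rfl, ?_, by simp⟩)).mono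
      (trialProb_le_one m) (by unfold conjSteps; omega) fun _ _ h => h
    rw [h0]
    simp [Letter.evalWord, Letter.unip_zero]
  · have tail : ∀ r₁ o₁, GoodLift p y r r₁ o₁ → Hoare (digitBound p) 1
        (.seq (block [(.mul, 27, 26, 6), (.mul, 28, 8, 6), (.sub, 33, 6, 6)])
          (.seq euclidEmit (.seq (.emit l) stackEmit))) r₁ (240 * p.size + 8 * quotientBound p + 30)
        fun r' o => (∀ i < 22, r' i = r i) ∧
          Letter.evalWord (ZMod p) (o₁ ++ o) = Letter.unip (σ * (r y : ZMod p) ^ 2) ∧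
          (o₁ ++ o).length ≤ 2 * quotientBound p + 1 := by
      rintro r₁ o₁ ⟨rfl, hfr, hd, hX, L, hL, hsum⟩
      have hr₁ : Env p r₁ := hr.congr fun j hj _ _ _ _ _ => hfr j (by omega)
      have hcop := coprime_of_dvd_sub hp ha hap hd
      have hX1 : 1 ≤ r₁ 26 := Nat.pos_of_ne_zero fun h => by
        rw [h, Nat.coprime_zero_left] at hcop
        exact absurd hcop (Nat.one_lt_pow (by norm_num) hp.one_lt).ne'
      have e1 := exec_block (B := digitBound p) (r := r₁) [(.mul, 27, 26, 6), (.mul, 28, 8, 6),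
        (.sub, 33, 6, 6)] (by
          simp only [BlockOk, Op.eval, ne_eq, Nat.reduceEqDiff, not_false_eq_true,
            Function.update_of_ne, hr₁.r6, hr₁.r8]
          refine ⟨?_, ?_, ?_, ?_, ?_, ?_, trivial⟩ <;> exact size_le_digitBound (by omega))
      set r₂ := blockEval [(.mul, 27, 26, 6), (.mul, 28, 8, 6), (.sub, 33, 6, 6)] r₁ with hr₂
      have a : ∀ i < 27, r₂ i = r₁ i := fun i hi => blockEval_of_notMem (by simp; omega) r₁
      have a27 : r₂ 27 = r₁ 26 := by simp [hr₂, blockEval, Op.eval, hr₁.r6]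
      have a28 : r₂ 28 = p ^ 3 := by simp [hr₂, blockEval, Op.eval, hr₁.r6, hr₁.r8]
      have a33 : r₂ 33 = 0 := by simp [hr₂, blockEval, Op.eval, hr₁.r6]
      have h34 : 2 * p ^ 3 ≤ p ^ 4 := by
        rw [pow_succ p 3, mul_comm]; exact Nat.mul_le_mul_left _ hp.two_le
      have hlen : L.length ≤ 3 * p.size := hL.length_le.trans size_cube_le
      have hNB : (p ^ 4).size ≤ digitBound p := size_le_digitBound (by omega)
      -- This is why `p ^ 4` serves as the base of the stack.
      have hN : r₁ 26 + p ^ 3 < p ^ 4 := by omega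
      obtain ⟨r₃, e2, b33, b⟩ := exec_euclidEmit (B := digitBound p) (N := p ^ 4) (st := []) hL hB1
        (by rw [a 6 (by omega), hr₁.r6]) (by rw [a 9 (by omega), hr₁.r9]) a27 a28 a33 hN hNB
        (by simp) (by simpa using size_stack_le hlen)
      rw [List.append_nil] at b33
      have hmem : ∀ z ∈ L.reverse, z.1 < p ^ 4 ∧ 1 ≤ z.2 ∧ z.2 < p ^ 4 := fun z hz =>
        hL.mem_lt hN z (List.mem_reverse.1 hz)
      obtain ⟨r₄, e4, c⟩ := exec_stackEmit (B := digitBound p) hB1 hNB hmem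
        (by rw [b 6 (by omega), a 6 (by omega), hr₁.r6])
        (by rw [b 9 (by omega), a 9 (by omega), hr₁.r9]) b33
        ((Nat.size_le_size ((stackCode_lt hmem).le.trans (by rw [List.length_reverse]))).trans
          (size_stack_le hlen))
      have hqs : quotientSum L.reverse = quotientSum L := by
        simp [quotientSum, List.map_reverse, List.sum_reverse]
      refine ((e1.seq (e2.seq ((Exec.emit l r₃).seq e4))).hoare ⟨fun i hi => ?_, ?_, ?_⟩).mono le_rfl
        ?_ fun _ _ h => h
      · rw [hqs, List.length_reverse]
        simp only [List.length_cons, List.length_nil]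
        omega
      · rw [c i (by omega), b i (by omega), a i (by omega), hfr i hi]
      · change Letter.evalWord _ (Letter.exponentWord L ++ ([l] ++ Letter.exponentWordInv L)) = _
        rw [Letter.evalWord_append, Letter.evalWord_append, Letter.evalWord_exponentWordInv]
        have h1 : Letter.evalWord (ZMod p) [l] = Letter.unip σ := by simp [Letter.evalWord, hl]
        obtain ⟨h2, h3⟩ := Letter.evalWord_exponentWord_apply (R := ZMod p) hL hX1 hcop
        rw [h1, ← mul_assoc, Letter.conj_unip _ (by rw [h3]; simp), h2]
        congr 3
        have := (ZMod.intCast_zmod_eq_zero_iff_dvd _ p).2 hd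
        push_cast at this
        exact sub_eq_zero.1 this
      · change (Letter.exponentWord L ++ ([l] ++ Letter.exponentWordInv L)).length ≤ _
        simp only [List.length_append, Letter.length_exponentWord, Letter.length_exponentWordInv,
          List.length_singleton]
        omega
    refine (Hoare.ite_pos (by omega) (size_le_digitBound (by omega))
      ((hoare_searchLift hp hy m hr ha hap).seq tail)).mono (by rw [mul_one]) ?_ fun _ _ h => h
    unfold conjSteps
    omega

/-- Emit a word for the upper unitriangular matrix with the entry in register `5`. -/
def emitUnip : Prog :=
  .seq (block [(.add, 20, 5, 11), (.mul, 20, 20, 12), (.mod, 20, 20, 0), (.add, 21, 20, 0),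
    (.sub, 21, 21, 11), (.mul, 21, 21, 11), (.mod, 21, 21, 0)])
    (.seq (conjLetter .u 20) (conjLetter .uInv 21))

/-- For odd `p` this is `x = ((x + 1) / 2) ^ 2 - ((x - 1) / 2) ^ 2`. For `p = 2` the factors `p % 2`
turn the same formula into `x = x ^ 2 - 0`. -/
theorem sq_sub_sq_eq {p x : ℕ} (hp : p.Prime) :
    ((((x + p % 2) * ((p + 1) / 2) % p : ℕ) : ZMod p) ^ 2 -
      (((((x + p % 2) * ((p + 1) / 2) % p + p - p % 2) * (p % 2)) % p : ℕ) : ZMod p) ^ 2) = x := by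
  have := Fact.mk hp
  rcases hp.eq_two_or_odd with rfl | hodd
  · simp only [Nat.mod_self, add_zero, mul_zero, Nat.zero_mod, show (2 + 1) / 2 = 1 from rfl,
      mul_one, ZMod.natCast_mod, Nat.cast_zero]
    rw [ZMod.pow_card]
    simp
  · have h1 : (2 : ZMod p) * ((p + 1) / 2 : ℕ) = 1 := by
      have : 2 * ((p + 1) / 2) = p + 1 := by omega
      have := congrArg (Nat.cast (R := ZMod p)) this
      push_cast at this
      simpa using this
    have key : ∀ s : ℕ, (((s + p - 1) % p : ℕ) : ZMod p) = s - 1 := fun s => by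
      rw [ZMod.natCast_mod, Nat.cast_sub (by have := hp.one_lt; omega)]
      simp
    simp only [hodd, mul_one]
    rw [key]
    simp only [ZMod.natCast_mod, Nat.cast_mul, Nat.cast_add, Nat.cast_one]
    generalize (((p + 1) / 2 : ℕ) : ZMod p) = h at h1
    linear_combination (x + 1 : ZMod p) * h1

theorem hoare_emitUnip {p : ℕ} (hp : p.Prime) (m : ℕ) {r : ℕ → ℕ} (hr : Env p r)
    (hx : r 5 ≤ p) :
    Hoare (digitBound p) (trialProb m * trialProb m) emitUnip r (2 * conjSteps p m + 20) fun r' o =>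
      (∀ i < 20, r' i = r i) ∧
      Letter.evalWord (ZMod p) o = Letter.unip (r 5 : ZMod p) ∧
      o.length ≤ 4 * quotientBound p + 2 := by
  have hp0 := hp.pos
  have p1 : p ≤ p ^ 6 := by simpa using pow_le_eight_mul hp0 (k := 1) (by norm_num)
  have p2 := pow_le_eight_mul hp0 (k := 2) (by norm_num)
  set s := (r 5 + p % 2) * ((p + 1) / 2) % p with hs
  have hsp : s < p := Nat.mod_lt _ hp0
  have he : p % 2 ≤ 1 := by omega
  have h12 : (p + 1) / 2 ≤ p := by omega
  have hmul : (r 5 + p % 2) * ((p + 1) / 2) ≤ 2 * p ^ 2 := by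
    calc _ ≤ (p + p) * p := Nat.mul_le_mul (by omega) h12
      _ = _ := by ring
  have hmul2 : (s + p - p % 2) * (p % 2) ≤ 2 * p := by
    calc _ ≤ (2 * p) * 1 := Nat.mul_le_mul (by omega) he
      _ = _ := by ring
  have e1 := exec_block (B := digitBound p) (r := r) [(.add, 20, 5, 11), (.mul, 20, 20, 12),
    (.mod, 20, 20, 0), (.add, 21, 20, 0), (.sub, 21, 21, 11), (.mul, 21, 21, 11),
    (.mod, 21, 21, 0)] (by
      simp only [BlockOk, Op.eval, ne_eq, Nat.reduceEqDiff, not_false_eq_true, OfNat.zero_ne_ofNat,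
        Function.update_of_ne, Function.update_self, hr.r0, hr.r11, hr.r12, ← hs]
      refine ⟨?_, ?_, ?_, ?_, ?_, ?_, ?_, ?_, ?_, ?_, ?_, ?_, ?_, ?_, trivial⟩ <;>
        exact size_le_digitBound (by omega))
  set r₁ := blockEval [(.add, 20, 5, 11), (.mul, 20, 20, 12),
    (.mod, 20, 20, 0), (.add, 21, 20, 0), (.sub, 21, 21, 11), (.mul, 21, 21, 11),
    (.mod, 21, 21, 0)] r with hr₁
  have a : ∀ i < 20, r₁ i = r i := fun i hi => blockEval_of_notMem (by simp; omega) r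
  have a20 : r₁ 20 = s := by
    simp [hr₁, blockEval, Op.eval, hr.r0, hr.r11, hr.r12, ← hs]
  have a21 : r₁ 21 = (s + p - p % 2) * (p % 2) % p := by
    simp [hr₁, blockEval, Op.eval, hr.r0, hr.r11, hr.r12, ← hs]
  have hr1 : Env p r₁ := hr.congr fun j hj _ _ _ _ _ => a j (by omega)
  have h1 := hoare_conjLetter hp (y := 20) (by norm_num) m hr1 (by rw [a20]; exact hsp)
    (l := .u) Letter.eval_u
  have h0 := e1.hoare (Post := fun r' o => r' = r₁ ∧ o = []) ⟨rfl, rfl⟩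
  refine (h0.seq (q₂ := trialProb m * trialProb m) (n₂ := conjSteps p m + conjSteps p m + 1) ?_).mono
    (by rw [one_mul]) (by simp; omega) fun _ _ h => h
  rintro _ _ ⟨rfl, rfl⟩
  refine h1.seq ?_
  rintro r₂ o₂ ⟨b, c, d⟩
  have hr2 : Env p r₂ := hr1.congr fun j hj _ _ _ _ _ => b j (by omega)
  have b21 := b 21 (by norm_num)
  refine (hoare_conjLetter hp (y := 21) (by norm_num) m hr2
    (by rw [b21, a21]; exact Nat.mod_lt _ hp0) (l := .uInv) Letter.eval_uInv).mono le_rfl le_rfl ?_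
  rintro r₃ o₃ ⟨b', c', d'⟩
  refine ⟨fun i hi => by rw [b' i (by omega), b i (by omega), a i hi], ?_, ?_⟩
  · rw [List.nil_append, Letter.evalWord_append, c, c', Letter.unip_mul, b21, a20, a21]
    congr 1
    rw [one_mul, neg_one_mul, ← sub_eq_add_neg]
    exact sq_sub_sq_eq hp
  · simp only [List.nil_append, List.length_append]
    omega


/-! ### Digit counts, initialization and modular inverses -/

theorem size_eq_size_half_add_one {n : ℕ} (hn : n ≠ 0) : n.size = (n / 2).size + 1 := by
  refine le_antisymm ?_ (Nat.succ_le_of_lt (Nat.lt_size.2 ?_))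
  · rw [Nat.size_le, pow_succ]
    have := (n / 2).lt_size_self
    omega
  · rcases Nat.eq_zero_or_pos (n / 2) with h | h
    · rw [h]; simp; omega
    · have h1 := Nat.size_pos.2 h
      have h2 : 2 ^ ((n / 2).size - 1) ≤ n / 2 := Nat.lt_size.1 (by omega)
      have h3 : 2 ^ (n / 2).size = 2 ^ ((n / 2).size - 1) * 2 := by
        rw [← pow_succ]; congr 1; omega
      omega

/-- Set register `x` to the number of digits of register `y`. -/
def sizeProg (x y : ℕ) : Prog :=
  .seq (block [(.sub, x, 6, 6), (.mul, 19, y, 6)])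
    (.loop 19 (block [(.add, x, x, 6), (.div, 19, 19, 7)]))

theorem exec_sizeProg {B x y : ℕ} (hB : 2 ≤ B) (hx : x ≠ 6) (hx' : x ≠ 7) (hxs : x ≠ 19)
    (hxy : y ≠ x) {r : ℕ → ℕ} (h6 : r 6 = 1) (h7 : r 7 = 2) (hy : (r y).size ≤ B) :
    ∃ r', Exec B (sizeProg x y) r r' [] (6 * (r y).size + 10) ∧ r' x = (r y).size ∧
      ∀ i, i ≠ x → i ≠ 19 → r' i = r i := by
  have s1 : Nat.size 1 ≤ B := by simp; omega
  have s2 : Nat.size 2 ≤ B := (Nat.size_le.2 (by norm_num : 2 < 2 ^ 2)).trans hB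
  have loop : ∀ n v c (r : ℕ → ℕ), v.size = n → r 6 = 1 → r 7 = 2 → r 19 = v → r x = c →
      c + n ≤ B → ∃ r', Exec B (.loop 19 (block [(.add, x, x, 6), (.div, 19, 19, 7)])) r r' []
        (6 * n + 1) ∧ r' x = c + n ∧ ∀ i, i ≠ x → i ≠ 19 → r' i = r i := by
    intro n
    induction n with
    | zero =>
      intro v c r hv h6 h7 h19 hc hle
      rw [Nat.size_eq_zero] at hv
      exact ⟨r, Exec.loop_zero (by rw [h19, hv]), by simpa using hc, fun _ _ _ => rfl⟩
    | succ n ih =>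
      intro v c r hv h6 h7 h19 hc hle
      have hv0 : v ≠ 0 := by rintro rfl; simp at hv
      have hcs : c.size ≤ B := (Nat.size_le.2 Nat.lt_two_pow_self).trans (by omega)
      have e1 := exec_block (B := B) (r := r) [(.add, x, x, 6), (.div, 19, 19, 7)] (by
        simp only [BlockOk, Op.eval, Function.update_of_ne hxs.symm, Function.update_of_ne hx'.symm,
          h6, h7, h19, hc]
        exact ⟨hcs, s1, by omega, s2, trivial⟩)
      obtain ⟨r', e2, a, b⟩ := ih (v / 2) (c + 1)
        (blockEval [(.add, x, x, 6), (.div, 19, 19, 7)] r)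
        (by have := size_eq_size_half_add_one hv0; omega)
        (by rw [blockEval_of_notMem (by simp [hx.symm]), h6])
        (by rw [blockEval_of_notMem (by simp [hx'.symm]), h7])
        (by simp [blockEval, Op.eval, Function.update_of_ne hxs.symm,
          Function.update_of_ne hx'.symm, h7, h19])
        (by simp [blockEval, Op.eval, hxs, hc, h6]) (by omega)
      refine ⟨r', (Exec.loop_step (by rwa [h19]) (by rw [h19]; omega) e1 e2).mono ?_, ?_, ?_⟩
      · simp; omega
      · rw [a]; omega
      · intro i hi hi'
        rw [b i hi hi', blockEval_of_notMem (by simp [hi, hi'])]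
  have e1 := exec_block (B := B) (r := r) [(.sub, x, 6, 6), (.mul, 19, y, 6)] (by
    simp [BlockOk, Op.eval, Function.update_of_ne hxy, Function.update_of_ne hx.symm, h6, hy]
    omega)
  obtain ⟨r', e2, a, b⟩ := loop (r y).size (r y) 0
    (blockEval [(.sub, x, 6, 6), (.mul, 19, y, 6)] r) rfl
    (by rw [blockEval_of_notMem (by simp [hx.symm]), h6])
    (by rw [blockEval_of_notMem (by simp [hx'.symm]), h7])
    (by simp [blockEval, Op.eval, Function.update_of_ne hxy, Function.update_of_ne hx.symm, h6])
    (by simp [blockEval, Op.eval, hxs]) (by omega)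
  refine ⟨r', (e1.seq e2).mono ?_, by rw [a, zero_add], fun i hi hi' => ?_⟩
  · simp; omega
  · rw [b i hi hi', blockEval_of_notMem (by simp [hi, hi'])]

/-- Initialize the registers in `Env`. -/
def initProg : Prog :=
  .seq (.const 6 1) (.seq (.const 7 2) (.seq (block [(.mul, 8, 0, 0), (.mul, 8, 8, 0),
    (.mul, 9, 8, 0), (.mod, 11, 0, 7), (.add, 12, 0, 6), (.div, 12, 12, 7), (.mul, 18, 0, 0)])
    (.seq (sizeProg 10 0) (.seq (sizeProg 13 10) (.seq (.const 14 (2 ^ 50))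
      (.seq (block [(.mul, 10, 10, 13), (.mul, 10, 14, 10)]) (sizeProg 17 18)))))))

theorem exec_initProg {p : ℕ} (hp : 0 < p) {r : ℕ → ℕ} (h0 : r 0 = p) :
    ∃ r', Exec (digitBound p) initProg r r' [] (30 * p.size + 100) ∧ Env p r' ∧
      ∀ i < 6, r' i = r i := by
  have hB : 2 ≤ digitBound p := by unfold digitBound; omega
  have p1 : p ≤ p ^ 6 := by simpa using pow_le_eight_mul hp (k := 1) (by norm_num)
  have p2 := pow_le_eight_mul hp (k := 2) (by norm_num)
  have p3 := pow_le_eight_mul hp (k := 3) (by norm_num)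
  have p4 := pow_le_eight_mul hp (k := 4) (by norm_num)
  have q2 : p * p = p ^ 2 := by ring
  have q3 : p * p * p = p ^ 3 := by ring
  have q4 : p * p * p * p = p ^ 4 := by ring
  have l1 : p.size ≤ p := Nat.size_le.2 Nat.lt_two_pow_self
  have l2 : p.size.size ≤ p.size := Nat.size_le.2 Nat.lt_two_pow_self
  have e1 := Exec.const (B := digitBound p) (x := 6) r (c := 1) (size_le_digitBound (by omega))
  set r₁ := Function.update r 6 1 with hr₁
  have e2 := Exec.const (B := digitBound p) (x := 7) r₁ (c := 2) (size_le_digitBound (by omega))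
  set r₂ := Function.update r₁ 7 2 with hr₂
  have a0 : r₂ 0 = p := by simp [hr₂, hr₁, h0]
  have a6 : r₂ 6 = 1 := by simp [hr₂, hr₁]
  have a7 : r₂ 7 = 2 := by simp [hr₂]
  have e3 := exec_block (B := digitBound p) (r := r₂) [(.mul, 8, 0, 0), (.mul, 8, 8, 0),
    (.mul, 9, 8, 0), (.mod, 11, 0, 7), (.add, 12, 0, 6), (.div, 12, 12, 7), (.mul, 18, 0, 0)] (by
      simp only [BlockOk, Op.eval, ne_eq, Nat.reduceEqDiff, not_false_eq_true, OfNat.zero_ne_ofNat,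
        Function.update_of_ne, Function.update_self, a0, a6, a7]
      refine ⟨?_, ?_, ?_, ?_, ?_, ?_, ?_, ?_, ?_, ?_, ?_, ?_, ?_, ?_, trivial⟩ <;>
        exact size_le_digitBound (by omega))
  set r₃ := blockEval [(.mul, 8, 0, 0), (.mul, 8, 8, 0),
    (.mul, 9, 8, 0), (.mod, 11, 0, 7), (.add, 12, 0, 6), (.div, 12, 12, 7), (.mul, 18, 0, 0)] r₂
    with hr₃
  have b : ∀ i < 8, r₃ i = r₂ i := fun i hi => blockEval_of_notMem (by simp; omega) r₂
  have b8 : r₃ 8 = p ^ 3 := by simp [hr₃, blockEval, Op.eval, a0, q3]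
  have b9 : r₃ 9 = p ^ 4 := by simp [hr₃, blockEval, Op.eval, a0, q4]
  have b11 : r₃ 11 = p % 2 := by simp [hr₃, blockEval, Op.eval, a0, a7]
  have b12 : r₃ 12 = (p + 1) / 2 := by simp [hr₃, blockEval, Op.eval, a0, a6, a7]
  have b18 : r₃ 18 = p * p := by simp [hr₃, blockEval, Op.eval, a0]
  have b0 : r₃ 0 = p := by rw [b 0 (by omega), a0]
  have b6 : r₃ 6 = 1 := by rw [b 6 (by omega), a6]
  have b7 : r₃ 7 = 2 := by rw [b 7 (by omega), a7]
  obtain ⟨r₄, e4, c10, c⟩ := exec_sizeProg (B := digitBound p) (x := 10) (y := 0) hB (by norm_num)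
    (by norm_num) (by norm_num) (by norm_num) b6 b7 (by rw [b0]; exact size_le_digitBound (by omega))
  rw [b0] at c10 e4
  obtain ⟨r₅, e5, d13, d⟩ := exec_sizeProg (B := digitBound p) (r := r₄) (x := 13) (y := 10) hB
    (by norm_num) (by norm_num) (by norm_num) (by norm_num) (by rw [c 6 (by omega) (by omega), b6])
    (by rw [c 7 (by omega) (by omega), b7]) (by rw [c10]; exact size_le_digitBound (by omega))
  rw [c10] at d13 e5
  have e6 := Exec.const (B := digitBound p) (x := 14) r₅ (c := 2 ^ 50)
    ((Nat.size_le.2 (by norm_num : 2 ^ 50 < 2 ^ 51)).trans (by unfold digitBound; omega))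
  set r₆ := Function.update r₅ 14 (2 ^ 50) with hr₆
  have f : ∀ i, i ≠ 14 → r₆ i = r₅ i := fun i hi => Function.update_of_ne hi _ _
  have f10 : r₆ 10 = p.size := by rw [f 10 (by omega), d 10 (by omega) (by omega), c10]
  have f13 : r₆ 13 = p.size.size := by rw [f 13 (by omega), d13]
  have f14 : r₆ 14 = 2 ^ 50 := Function.update_self _ _ _
  have hmul : p.size * p.size.size ≤ p ^ 6 := by
    calc _ ≤ p * p := Nat.mul_le_mul l1 (l2.trans l1)
      _ ≤ p ^ 6 := by omega
  have e7 := exec_block (B := digitBound p) (r := r₆) [(.mul, 10, 10, 13), (.mul, 10, 14, 10)] (by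
      simp only [BlockOk, Op.eval, ne_eq, Nat.reduceEqDiff, not_false_eq_true,
        Function.update_of_ne, Function.update_self, f10, f13, f14]
      exact ⟨size_le_digitBound (by omega), size_le_digitBound (by omega),
        (Nat.size_le.2 (by norm_num : 2 ^ 50 < 2 ^ 51)).trans (by unfold digitBound; omega),
        size_le_digitBound (by omega), trivial⟩)
  set r₇ := blockEval [(.mul, 10, 10, 13), (.mul, 10, 14, 10)] r₆ with hr₇
  have g : ∀ i, i ≠ 10 → r₇ i = r₆ i := fun i hi => blockEval_of_notMem (by simp [hi]) r₆
  have g10 : r₇ 10 = quotientBound p := by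
    simp [hr₇, blockEval, Op.eval, f10, f13, f14, quotientBound]
  have g' : ∀ i, i < 13 ∨ i = 18 → i ≠ 10 → r₇ i = r₃ i := fun i hi hi' => by
    rw [g i hi', f i (by omega), d i (by omega) (by omega), c i hi' (by omega)]
  obtain ⟨r₈, e8, k17, k⟩ := exec_sizeProg (B := digitBound p) (r := r₇) (x := 17) (y := 18) hB
    (by norm_num) (by norm_num) (by norm_num) (by norm_num)
    (by rw [g' 6 (by omega) (by omega), b6]) (by rw [g' 7 (by omega) (by omega), b7])
    (by rw [g' 18 (by omega) (by omega), b18]; exact size_le_digitBound (by omega))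
  rw [g' 18 (by omega) (by omega), b18] at k17 e8
  have k' : ∀ i, i < 13 → i ≠ 10 → r₈ i = r₃ i := fun i hi hi' => by
    rw [k i (by omega) (by omega), g' i (Or.inl hi) hi']
  refine ⟨r₈, (e1.seq (e2.seq (e3.seq (e4.seq (e5.seq (e6.seq (e7.seq e8))))))).mono ?_, ?_, ?_⟩
  · have := size_sq_le (p := p)
    simp
    omega
  · constructor
    · rw [k' 0 (by omega) (by omega), b0]
    · rw [k' 6 (by omega) (by omega), b6]
    · rw [k' 7 (by omega) (by omega), b7]
    · rw [k' 8 (by omega) (by omega), b8]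
    · rw [k' 9 (by omega) (by omega), b9]
    · rw [k 10 (by omega) (by omega), g10]
    · rw [k' 11 (by omega) (by omega), b11]
    · rw [k' 12 (by omega) (by omega), b12]
    · exact k17
  · intro i hi
    rw [k' i (by omega) (by omega), b i (by omega), hr₂, Function.update_of_ne (by omega), hr₁,
      Function.update_of_ne (by omega)]

/-- The body of the loop for modular exponentiation. -/
def powBody : Prog :=
  .seq (block [(.mod, 16, 19, 7)]) (.seq (.ite 16 (block [(.mul, 13, 13, 18), (.mod, 13, 13, 0)])
    .skip) (block [(.mul, 18, 18, 18), (.mod, 18, 18, 0), (.div, 19, 19, 7)]))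

/-- Binary exponentiation: modulo `p`, the product of register `13` with the power of register `18`
to the exponent in register `19` is invariant. -/
theorem exec_powLoop {p : ℕ} (hp : 0 < p) (n : ℕ) {r : ℕ → ℕ} (hr : Env p r)
    (h19 : (r 19).size = n) (h19p : r 19 ≤ p) (h13 : r 13 ≤ p) (h18 : r 18 ≤ p) :
    ∃ r', Exec (digitBound p) (.loop 19 powBody) r r' [] (30 * n + 1) ∧ r' 13 ≤ p ∧
      (r' 13 : ZMod p) = (r 13 : ZMod p) * (r 18 : ZMod p) ^ (r 19) ∧
      ∀ i, i < 13 ∨ i = 17 → r' i = r i := by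
  have p1 : p ≤ p ^ 6 := by simpa using pow_le_eight_mul hp (k := 1) (by norm_num)
  have p2 := pow_le_eight_mul hp (k := 2) (by norm_num)
  induction n generalizing r with
  | zero =>
    rw [Nat.size_eq_zero] at h19
    exact ⟨r, Exec.loop_zero h19, h13, by simp [h19], fun _ _ => rfl⟩
  | succ n ih =>
    have h0 : r 19 ≠ 0 := fun h => by simp [h] at h19
    have e1 := exec_block (B := digitBound p) (r := r) [(.mod, 16, 19, 7)] (by
      simp only [BlockOk, hr.r7]
      exact ⟨size_le_digitBound (by omega), size_le_digitBound (by omega), trivial⟩)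
    set r₁ := blockEval [(.mod, 16, 19, 7)] r with hr₁
    have a : ∀ i, i ≠ 16 → r₁ i = r i := fun i hi => blockEval_of_notMem (by simp [hi]) r
    have a16 : r₁ 16 = r 19 % 2 := by simp [hr₁, blockEval, Op.eval, hr.r7]
    have hmul : ∀ {x y : ℕ}, x ≤ p → y ≤ p → x * y ≤ p ^ 2 := fun hx hy => by
      rw [pow_two]; exact Nat.mul_le_mul hx hy
    obtain ⟨r₂, e2, b13, b13', b⟩ : ∃ r₂, Exec (digitBound p)
        (.ite 16 (block [(.mul, 13, 13, 18), (.mod, 13, 13, 0)]) .skip) r₁ r₂ [] 6 ∧ r₂ 13 ≤ p ∧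
        (r₂ 13 : ZMod p) = (r 13 : ZMod p) * (r 18 : ZMod p) ^ (r 19 % 2) ∧
        ∀ i, i ≠ 13 → r₂ i = r₁ i := by
      rcases Nat.mod_two_eq_zero_or_one (r 19) with h | h
      · refine ⟨r₁, (Exec.ite_neg (by rw [a16, h]) (Exec.skip r₁)).mono (by norm_num), ?_, ?_,
          fun _ _ => rfl⟩
        · rw [a 13 (by omega)]; exact h13
        · rw [a 13 (by omega), h]; simp
      · have e := exec_block (B := digitBound p) (r := r₁) [(.mul, 13, 13, 18), (.mod, 13, 13, 0)]
          (by
            simp only [BlockOk, Op.eval, ne_eq, not_false_eq_true, OfNat.zero_ne_ofNat,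
              Function.update_of_ne, Function.update_self, a 13 (by omega), a 18 (by omega),
              a 0 (by omega), hr.r0]
            have := hmul h13 h18
            exact ⟨size_le_digitBound (by omega), size_le_digitBound (by omega),
              size_le_digitBound (by omega), size_le_digitBound (by omega), trivial⟩)
        have hv : blockEval [(.mul, 13, 13, 18), (.mod, 13, 13, 0)] r₁ 13 =
            r 13 * r 18 % p := by
          simp [blockEval, Op.eval, a 13 (by omega), a 18 (by omega), a 0 (by omega), hr.r0]
        refine ⟨_, (Exec.ite_pos (by rw [a16, h]; norm_num)
          (by rw [a16, h]; exact size_le_digitBound (by omega)) e).mono (by simp), ?_, ?_,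
          fun i hi => blockEval_of_notMem (by simp [hi]) r₁⟩
        · rw [hv]; exact (Nat.mod_lt _ hp).le
        · rw [hv, h, ZMod.natCast_mod]; simp
    have b18 : r₂ 18 = r 18 := by rw [b 18 (by omega), a 18 (by omega)]
    have b19 : r₂ 19 = r 19 := by rw [b 19 (by omega), a 19 (by omega)]
    have b0 : r₂ 0 = p := by rw [b 0 (by omega), a 0 (by omega), hr.r0]
    have b7 : r₂ 7 = 2 := by rw [b 7 (by omega), a 7 (by omega), hr.r7]
    have e3 := exec_block (B := digitBound p) (r := r₂) [(.mul, 18, 18, 18), (.mod, 18, 18, 0),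
      (.div, 19, 19, 7)] (by
        simp only [BlockOk, Op.eval, ne_eq, Nat.reduceEqDiff, not_false_eq_true, OfNat.zero_ne_ofNat,
          Function.update_of_ne, Function.update_self, b18, b19, b0, b7]
        have := hmul h18 h18
        exact ⟨size_le_digitBound (by omega), size_le_digitBound (by omega),
          size_le_digitBound (by omega), size_le_digitBound (by omega),
          size_le_digitBound (by omega), size_le_digitBound (by omega), trivial⟩)
    set r₃ := blockEval [(.mul, 18, 18, 18), (.mod, 18, 18, 0), (.div, 19, 19, 7)] r₂ with hr₃
    have c : ∀ i, i ≠ 18 → i ≠ 19 → r₃ i = r₂ i := fun i hi hi' =>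
      blockEval_of_notMem (by simp [hi, hi']) r₂
    have c18 : r₃ 18 = r 18 * r 18 % p := by simp [hr₃, blockEval, Op.eval, b18, b0]
    have c19 : r₃ 19 = r 19 / 2 := by simp [hr₃, blockEval, Op.eval, b19, b7]
    have c13 : r₃ 13 = r₂ 13 := c 13 (by omega) (by omega)
    have hr3 : Env p r₃ := hr.congr fun j hj _ _ _ _ _ => by
      rw [c j (by omega) (by omega), b j (by omega), a j (by omega)]
    obtain ⟨r₄, e4, d13, d, d'⟩ := ih hr3
      (by rw [c19]; have := size_eq_size_half_add_one h0; omega) (by rw [c19]; omega)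
      (by rwa [c13]) (by rw [c18]; exact (Nat.mod_lt _ hp).le)
    refine ⟨r₄, (Exec.loop_step h0 (size_le_digitBound (by omega)) (e1.seq (e2.seq e3)) e4).mono ?_,
      d13, ?_, ?_⟩
    · simp; omega
    · rw [d, c13, b13', c18, c19, ZMod.natCast_mod, Nat.cast_mul, ← pow_two, ← pow_mul, mul_assoc,
        ← pow_add, Nat.mod_add_div]
    · intro i hi
      rw [d' i hi, c i (by omega) (by omega), b i (by omega), a i (by omega)]

/-- Set register `13` to the inverse of register `3` modulo `p`. -/
def invProg : Prog :=
  .seq (block [(.mul, 13, 6, 6), (.mul, 18, 3, 6), (.sub, 19, 0, 7)]) (.loop 19 powBody)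

/-- By Fermat the inverse is the power with exponent `p - 2`; for `p = 2` the exponent `0` gives the
correct value `1`. -/
theorem exec_invProg {p : ℕ} (hp : p.Prime) {r : ℕ → ℕ} (hr : Env p r) (h3 : r 3 ≤ p)
    (h30 : (r 3 : ZMod p) ≠ 0) :
    ∃ r', Exec (digitBound p) invProg r r' [] (30 * p.size + 20) ∧ r' 13 ≤ p ∧
      (r 3 : ZMod p) * (r' 13 : ZMod p) = 1 ∧ ∀ i, i < 13 ∨ i = 17 → r' i = r i := by
  have hp0 := hp.pos
  have p1 : p ≤ p ^ 6 := by simpa using pow_le_eight_mul hp0 (k := 1) (by norm_num)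
  have e1 := exec_block (B := digitBound p) (r := r) [(.mul, 13, 6, 6), (.mul, 18, 3, 6),
    (.sub, 19, 0, 7)] (by
      simp only [BlockOk, Op.eval, ne_eq, Nat.reduceEqDiff, not_false_eq_true, OfNat.zero_ne_ofNat,
        Function.update_of_ne, hr.r6, hr.r0, hr.r7]
      refine ⟨?_, ?_, ?_, ?_, ?_, ?_, trivial⟩ <;> exact size_le_digitBound (by omega))
  set r₁ := blockEval [(.mul, 13, 6, 6), (.mul, 18, 3, 6), (.sub, 19, 0, 7)] r with hr₁
  have a : ∀ i, i < 13 ∨ i = 17 → r₁ i = r i := fun i hi =>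
    blockEval_of_notMem (by simp; omega) r
  have a13 : r₁ 13 = 1 := by simp [hr₁, blockEval, Op.eval, hr.r6]
  have a18 : r₁ 18 = r 3 := by simp [hr₁, blockEval, Op.eval, hr.r6]
  have a19 : r₁ 19 = p - 2 := by simp [hr₁, blockEval, Op.eval, hr.r0, hr.r7]
  have hr1 : Env p r₁ := hr.congr fun j hj _ _ _ _ _ => a j (by omega)
  obtain ⟨r₂, e2, b13, b, b'⟩ := exec_powLoop hp0 (p - 2).size hr1 (by rw [a19])
    (by rw [a19]; omega) (by rw [a13]; omega) (by rwa [a18])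
  refine ⟨r₂, (e1.seq e2).mono ?_, b13, ?_, fun i hi => by rw [b' i hi, a i hi]⟩
  · have := Nat.size_le_size (Nat.sub_le p 2)
    simp; omega
  · have := Fact.mk hp
    rw [b, a13, a18, a19, Nat.cast_one, one_mul, ← pow_succ']
    have h2 := hp.two_le
    rw [show p - 2 + 1 = p - 1 by omega]
    exact ZMod.pow_card_sub_one_eq_one h30

/-- Emit a fixed word. -/
def emitWord : List Letter → Prog
  | [] => .skip
  | l :: w => .seq (.emit l) (emitWord w)

theorem exec_emitWord {B : ℕ} (w : List Letter) (r : ℕ → ℕ) :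
    Exec B (emitWord w) r r w (2 * w.length + 1) := by
  induction w with
  | nil => exact Exec.skip r
  | cons l w ih => exact ((Exec.emit l r).seq ih).mono (by simp; omega)

/-- Emit a word for the upper unitriangular matrix with the entry in register `x`, then `w`. -/
def emitUnipWord (x : ℕ) (w : List Letter) : Prog :=
  .seq (block [(.mul, 5, x, 6)]) (.seq emitUnip (emitWord w))

theorem hoare_emitUnipWord {p : ℕ} (hp : p.Prime) (m : ℕ) {r : ℕ → ℕ} (hr : Env p r) {x : ℕ}
    (hx : r x ≤ p) (w : List Letter) :
    Hoare (digitBound p) (trialProb m * trialProb m) (emitUnipWord x w) r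
      (2 * conjSteps p m + 2 * w.length + 30) fun r' o =>
      (∀ i < 20, i ≠ 5 → r' i = r i) ∧
      Letter.evalWord (ZMod p) o = Letter.unip (r x : ZMod p) * Letter.evalWord (ZMod p) w ∧
      o.length ≤ 4 * quotientBound p + 2 + w.length := by
  have p1 : p ≤ p ^ 6 := by simpa using pow_le_eight_mul hp.pos (k := 1) (by norm_num)
  have hp0 := hp.pos
  have e1 := exec_block (B := digitBound p) (r := r) [(.mul, 5, x, 6)] (by
    simp only [BlockOk, hr.r6]
    exact ⟨size_le_digitBound (by omega), size_le_digitBound (by omega), trivial⟩)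
  set r₁ := blockEval [(.mul, 5, x, 6)] r with hr₁
  have a : ∀ i, i ≠ 5 → r₁ i = r i := fun i hi => blockEval_of_notMem (by simp [hi]) r
  have a5 : r₁ 5 = r x := by simp [hr₁, blockEval, Op.eval, hr.r6]
  have hr1 : Env p r₁ := hr.congr fun j _ _ _ _ _ h => a j h
  have h2 := hoare_emitUnip hp m hr1 (by rwa [a5])
  refine ((e1.hoare (Post := fun r' o => r' = r₁ ∧ o = []) ⟨rfl, rfl⟩).seq
    (q₂ := trialProb m * trialProb m * 1)
    (n₂ := (2 * conjSteps p m + 20) + (2 * w.length + 1) + 1) ?_).mono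
    (by rw [one_mul, mul_one]) (by simp; omega) fun _ _ h => h
  rintro _ _ ⟨rfl, rfl⟩
  refine h2.seq ?_
  rintro r₂ o₂ ⟨b, c, d⟩
  refine (exec_emitWord w r₂).hoare ⟨fun i hi hi' => by rw [b i hi, a i hi'], ?_, ?_⟩
  · rw [List.nil_append, Letter.evalWord_append, c, a5]
  · simp only [List.nil_append, List.length_append]
    omega

end RandRAM

/-! ### The Bruhat-type factorization -/

namespace Letter

variable {R : Type*} [CommRing R]

theorem val_upper_inv : ((upper R)⁻¹).1 = !![1, -1; 0, 1] := by
  rw [Matrix.SpecialLinearGroup.coe_inv, upper, Matrix.adjugate_fin_two_of, neg_zero]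

theorem val_lower_inv : ((lower R)⁻¹).1 = !![1, 0; -1, 1] := by
  rw [Matrix.SpecialLinearGroup.coe_inv, lower, Matrix.adjugate_fin_two_of, neg_zero]

theorem evalWord_weyl : (evalWord R [u, vInv, u]).1 = !![0, 1; -1, 0] := by
  change (upper R * ((lower R)⁻¹ * (upper R * 1))).1 = _
  simp only [mul_one, val_mul, val_lower_inv]
  simp [upper]

theorem evalWord_weyl_inv : (evalWord R [uInv, v, uInv]).1 = !![0, -1; 1, 0] := by
  change ((upper R)⁻¹ * (lower R * ((upper R)⁻¹ * 1))).1 = _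
  simp only [mul_one, val_mul, val_upper_inv]
  simp [lower]

/-- Conjugating by the Weyl element turns `unip (-c)` into the lower unitriangular matrix with entry
`c`. The identity is thus the factorization upper, lower, upper of a matrix with invertible lower
left entry `c`. -/
theorem eq_unip_mul {A : Matrix.SpecialLinearGroup (Fin 2) R} {c' : R} (hc : A.1 1 0 * c' = 1) :
    unip ((A.1 0 0 - 1) * c') * evalWord R [u, vInv, u] *
      (unip (-A.1 1 0) * evalWord R [uInv, v, uInv]) * unip ((A.1 1 1 - 1) * c') = A := by
  have hdet := A.2
  rw [Matrix.det_fin_two] at hdet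
  apply Subtype.ext
  simp only [val_mul, evalWord_weyl, evalWord_weyl_inv]
  ext i j
  fin_cases i <;> fin_cases j <;> simp [unip, Matrix.mul_apply, Fin.sum_univ_two]
  · linear_combination (A.1 0 0 - 1) * hc
  · linear_combination (A.1 0 0 - 1) * (A.1 1 1 - 1) * c' * hc + c' * hdet + A.1 0 1 * hc
  · linear_combination (A.1 1 1 - 1) * hc

theorem val_mul_lower_inv (A : Matrix.SpecialLinearGroup (Fin 2) R) :
    (A * (lower R)⁻¹).1 = !![A.1 0 0 - A.1 0 1, A.1 0 1; A.1 1 0 - A.1 1 1, A.1 1 1] := by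
  rw [val_mul, val_lower_inv]
  ext i j
  fin_cases i <;> fin_cases j <;> simp [Matrix.mul_apply, Fin.sum_univ_two, sub_eq_add_neg]

end Letter

/-! ### The complete program -/

namespace RandRAM

open scoped ENNReal

/-- Make the lower left entry nonzero by multiplying with the inverse of the lower unitriangular
generator if it is zero; register `2` tells whether this was done. -/
def pivotProg : Prog :=
  .ite 3 (.arith .sub 2 6 6) (block [(.add, 1, 1, 0), (.sub, 1, 1, 2), (.sub, 3, 0, 4),
    (.mul, 2, 6, 6)])

/-- The registers `1`, `3`, `4` represent the corresponding entries of `g`. -/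
structure Represents (p : ℕ) (r : ℕ → ℕ) (g : Matrix.SpecialLinearGroup (Fin 2) (ZMod p)) :
    Prop where
  r1 : (r 1 : ZMod p) = g.1 0 0
  r3 : (r 3 : ZMod p) = g.1 1 0
  r4 : (r 4 : ZMod p) = g.1 1 1
  r1_le : r 1 ≤ 2 * p
  r3_le : r 3 ≤ p
  r4_le : r 4 ≤ p

/-- If the lower left entry is zero, the lower right one is not, and its negative becomes the new
lower left entry. The upper left entry is left unreduced, hence the bound `2 * p` in `Represents`.
-/
theorem exec_pivotProg {p : ℕ} (hp : p.Prime) {g : Matrix.SpecialLinearGroup (Fin 2) (ZMod p)}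
    {r : ℕ → ℕ} (hr : Env p r) (h1 : r 1 = (g.1 0 0).val) (h2 : r 2 = (g.1 0 1).val)
    (h3 : r 3 = (g.1 1 0).val) (h4 : r 4 = (g.1 1 1).val) :
    ∃ r', Exec (digitBound p) pivotProg r r' [] 20 ∧ Env p r' ∧ r' 2 ≤ 1 ∧
      (r' 3 : ZMod p) ≠ 0 ∧ Represents p r' (g * (Letter.lower (ZMod p) ^ r' 2)⁻¹) := by
  have := Fact.mk hp
  have hp0 := hp.pos
  have p1 : p ≤ p ^ 6 := by simpa using pow_le_eight_mul hp0 (k := 1) (by norm_num)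
  have l1 : r 1 < p := by rw [h1]; exact ZMod.val_lt _
  have l2 : r 2 < p := by rw [h2]; exact ZMod.val_lt _
  have l3 : r 3 < p := by rw [h3]; exact ZMod.val_lt _
  have l4 : r 4 < p := by rw [h4]; exact ZMod.val_lt _
  have c1 : (r 1 : ZMod p) = g.1 0 0 := by rw [h1, ZMod.natCast_zmod_val]
  have c2 : (r 2 : ZMod p) = g.1 0 1 := by rw [h2, ZMod.natCast_zmod_val]
  have c3 : (r 3 : ZMod p) = g.1 1 0 := by rw [h3, ZMod.natCast_zmod_val]
  have c4 : (r 4 : ZMod p) = g.1 1 1 := by rw [h4, ZMod.natCast_zmod_val]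
  by_cases h0 : r 3 = 0
  · have e := exec_block (B := digitBound p) (r := r) [(.add, 1, 1, 0), (.sub, 1, 1, 2),
      (.sub, 3, 0, 4), (.mul, 2, 6, 6)] (by
        simp only [BlockOk, Op.eval, ne_eq, Nat.reduceEqDiff, not_false_eq_true, OfNat.ofNat_ne_one,
          zero_ne_one, Function.update_of_ne, Function.update_self, hr.r0, hr.r6]
        refine ⟨?_, ?_, ?_, ?_, ?_, ?_, ?_, ?_, trivial⟩ <;> exact size_le_digitBound (by omega))
    set r₁ := blockEval [(.add, 1, 1, 0), (.sub, 1, 1, 2), (.sub, 3, 0, 4), (.mul, 2, 6, 6)] r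
      with hr₁
    have a1 : r₁ 1 = r 1 + p - r 2 := by simp [hr₁, blockEval, Op.eval, hr.r0]
    have a2 : r₁ 2 = 1 := by simp [hr₁, blockEval, Op.eval, hr.r6]
    have a3 : r₁ 3 = p - r 4 := by simp [hr₁, blockEval, Op.eval, hr.r0]
    have a : ∀ i, i = 0 ∨ 4 ≤ i → r₁ i = r i := fun i hi => blockEval_of_notMem (by simp; omega) r
    have hc : g.1 1 0 = 0 := by rw [← c3, h0]; simp
    have hd : g.1 1 1 ≠ 0 := fun hd => by
      have hdet := g.2
      rw [Matrix.det_fin_two, hc, hd] at hdet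
      simp at hdet
    have b1 : (r₁ 1 : ZMod p) = g.1 0 0 - g.1 0 1 := by
      rw [a1, Nat.cast_sub (by omega)]; simp [c1, c2]
    have b3 : (r₁ 3 : ZMod p) = g.1 1 0 - g.1 1 1 := by
      rw [a3, Nat.cast_sub l4.le]; simp [c4, hc]
    refine ⟨r₁, (Exec.ite_neg h0 e).mono (by simp), hr.congr fun j _ _ _ _ _ _ => a j (by omega),
      by omega, by rw [b3, hc]; simpa using hd, ?_⟩
    rw [a2, pow_one]
    constructor
    · rw [b1, Letter.val_mul_lower_inv]; rfl
    · rw [b3, Letter.val_mul_lower_inv]; rfl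
    · rw [a 4 (by omega), c4, Letter.val_mul_lower_inv]; rfl
    · omega
    · omega
    · rw [a 4 (by omega)]; omega
  · have e := Exec.arith (B := digitBound p) (r := r) (x := 2) .sub (y := 6) (z := 6)
      (by rw [hr.r6]; exact size_le_digitBound (by omega))
      (by rw [hr.r6]; exact size_le_digitBound (by omega))
    set r₁ := Function.update r 2 (Op.sub.eval (r 6) (r 6)) with hr₁
    have a2 : r₁ 2 = 0 := by simp [hr₁, Op.eval]
    have a : ∀ i, i ≠ 2 → r₁ i = r i := fun i hi => Function.update_of_ne hi _ _
    refine ⟨r₁, (Exec.ite_pos h0 (size_le_digitBound (by omega)) e).mono (by norm_num),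
      hr.congr fun j _ _ h _ _ _ => a j h, by omega, ?_, ?_⟩
    · rw [a 3 (by omega)]
      intro h
      rw [ZMod.natCast_eq_zero_iff] at h
      exact absurd (Nat.le_of_dvd (by omega) h) (by omega)
    · rw [a2, pow_zero, inv_one, mul_one]
      constructor
      · rw [a 1 (by omega), c1]
      · rw [a 3 (by omega), c3]
      · rw [a 4 (by omega), c4]
      · rw [a 1 (by omega)]; omega
      · rw [a 3 (by omega)]; omega
      · rw [a 4 (by omega)]; omega

/-- Compute the entries of the three unitriangular factors in registers `14`, `3`, `15`. -/
def coordBlock : List (Op × ℕ × ℕ × ℕ) :=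
  [(.add, 14, 1, 0), (.sub, 14, 14, 6), (.mul, 14, 14, 13), (.mod, 14, 14, 0),
    (.add, 15, 4, 0), (.sub, 15, 15, 6), (.mul, 15, 15, 13), (.mod, 15, 15, 0), (.sub, 3, 0, 3)]

theorem exec_coordBlock {p : ℕ} (hp : p.Prime) {g : Matrix.SpecialLinearGroup (Fin 2) (ZMod p)}
    {r : ℕ → ℕ} (hr : Env p r) (h : Represents p r g) (h13 : r 13 ≤ p) :
    ∃ r', Exec (digitBound p) (block coordBlock) r r' [] 20 ∧ Env p r' ∧ r' 2 = r 2 ∧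
      r' 14 ≤ p ∧ r' 3 ≤ p ∧ r' 15 ≤ p ∧
      (r' 14 : ZMod p) = (g.1 0 0 - 1) * r 13 ∧ (r' 3 : ZMod p) = - g.1 1 0 ∧
      (r' 15 : ZMod p) = (g.1 1 1 - 1) * r 13 := by
  have hp0 := hp.pos
  have hp1 := hp.one_lt
  have p1 : p ≤ p ^ 6 := by simpa using pow_le_eight_mul hp0 (k := 1) (by norm_num)
  have p2 := pow_le_eight_mul hp0 (k := 2) (by norm_num)
  have l1 := h.r1_le
  have l3 := h.r3_le
  have l4 := h.r4_le
  have hmul : ∀ {x}, x ≤ 3 * p → x * r 13 ≤ 3 * p ^ 2 := fun {x} hx => by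
    calc x * r 13 ≤ (3 * p) * p := Nat.mul_le_mul hx h13
      _ = _ := by ring
  have m1 := hmul (x := r 1 + p - 1) (by omega)
  have m4 := hmul (x := r 4 + p - 1) (by omega)
  have e := exec_block (B := digitBound p) (r := r) coordBlock (by
    simp only [coordBlock, BlockOk, Op.eval, ne_eq, Nat.reduceEqDiff, not_false_eq_true,
      OfNat.zero_ne_ofNat, Function.update_of_ne, Function.update_self, hr.r0,
      hr.r6]
    refine ⟨?_, ?_, ?_, ?_, ?_, ?_, ?_, ?_, ?_, ?_, ?_, ?_, ?_, ?_, ?_, ?_, ?_, ?_, trivial⟩ <;>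
      exact size_le_digitBound (by omega))
  set r₁ := blockEval coordBlock r with hr₁
  have a14 : r₁ 14 = (r 1 + p - 1) * r 13 % p := by
    simp [hr₁, coordBlock, blockEval, Op.eval, hr.r0, hr.r6]
  have a15 : r₁ 15 = (r 4 + p - 1) * r 13 % p := by
    simp [hr₁, coordBlock, blockEval, Op.eval, hr.r0, hr.r6]
  have a3 : r₁ 3 = p - r 3 := by simp [hr₁, coordBlock, blockEval, Op.eval, hr.r0]
  have a : ∀ i, i ≤ 13 ∨ i = 17 → i ≠ 3 → r₁ i = r i := fun i hi hi' =>
    blockEval_of_notMem (by simp [coordBlock]; omega) r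
  refine ⟨r₁, e.mono (by simp [coordBlock]), hr.congr fun j hj _ _ h3 _ _ => a j (by omega) h3,
    a 2 (by omega) (by omega), ?_, ?_, ?_, ?_, ?_, ?_⟩
  · rw [a14]; exact (Nat.mod_lt _ hp0).le
  · omega
  · rw [a15]; exact (Nat.mod_lt _ hp0).le
  · rw [a14, ZMod.natCast_mod, Nat.cast_mul, Nat.cast_sub (by omega), ← h.r1]; simp
  · rw [a3, Nat.cast_sub l3, h.r3]; simp
  · rw [a15, ZMod.natCast_mod, Nat.cast_mul, Nat.cast_sub (by omega), ← h.r4]; simp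

/-- Emit the word, given the entries of the unitriangular factors. -/
def outputProg : Prog :=
  .seq (emitUnipWord 14 [.u, .vInv, .u]) (.seq (emitUnipWord 3 [.uInv, .v, .uInv])
    (.seq (emitUnipWord 15 []) (.ite 2 (.emit .v) .skip)))

/-- Three unipotents with two squares each require six searches, hence the sixth power. The optional
last letter undoes the pivoting. -/
theorem hoare_outputProg {p : ℕ} (hp : p.Prime) (m : ℕ) {r : ℕ → ℕ} (hr : Env p r)
    (h2 : r 2 ≤ 1) (h14 : r 14 ≤ p) (h3 : r 3 ≤ p) (h15 : r 15 ≤ p) :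
    Hoare (digitBound p) (trialProb m ^ 6) outputProg r (6 * conjSteps p m + 150) fun _ o =>
      Letter.evalWord (ZMod p) o =
        Letter.unip (r 14 : ZMod p) * Letter.evalWord (ZMod p) [.u, .vInv, .u] *
          (Letter.unip (r 3 : ZMod p) * Letter.evalWord (ZMod p) [.uInv, .v, .uInv]) *
          Letter.unip (r 15 : ZMod p) * Letter.lower (ZMod p) ^ r 2 ∧
      o.length ≤ 12 * quotientBound p + 20 := by
  have hp0 := hp.pos
  have p1 : p ≤ p ^ 6 := by simpa using pow_le_eight_mul hp0 (k := 1) (by norm_num)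
  have key := fun {r : ℕ → ℕ} (hr : Env p r) {x : ℕ} (hx : r x ≤ p) (w : List Letter) =>
    hoare_emitUnipWord hp m hr hx w
  generalize conjSteps p m = N at key ⊢
  refine ((key hr h14 [.u, .vInv, .u]).seq
    (q₂ := trialProb m * trialProb m * (trialProb m * trialProb m * 1))
    (n₂ := (2 * N + 2 * [Letter.uInv, .v, .uInv].length + 30) + (2 * N + 50) + 1)
    ?_).mono (le_of_eq (by ring)) (by simp; omega) fun _ _ h => h
  rintro r₁ o₁ ⟨a, w₁, l₁⟩
  have hr1 : Env p r₁ := hr.congr fun j hj _ _ _ _ h5 => a j (by omega) h5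
  have a3 := a 3 (by norm_num) (by norm_num)
  refine (key hr1 (x := 3) (by rwa [a3]) [.uInv, .v, .uInv]).seq ?_
  rintro r₂ o₂ ⟨b, w₂, l₂⟩
  have hr2 : Env p r₂ := hr1.congr fun j hj _ _ _ _ h5 => b j (by omega) h5
  have b15 : r₂ 15 = r 15 := by
    rw [b 15 (by norm_num) (by norm_num), a 15 (by norm_num) (by norm_num)]
  refine Hoare.mono (n := (2 * N + 2 * ([] : List Letter).length + 30) + 2 + 1)
    ((key hr2 (x := 15) (by rwa [b15]) []).seq (n₂ := 2) ?_) le_rfl (by simp) fun _ _ h => h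
  rintro r₃ o₃ ⟨c, w₃, l₃⟩
  have c2 : r₃ 2 = r 2 := by
    rw [c 2 (by norm_num) (by norm_num), b 2 (by norm_num) (by norm_num),
      a 2 (by norm_num) (by norm_num)]
  have w₃' : Letter.evalWord (ZMod p) o₃ = Letter.unip (r 15 : ZMod p) := by
    rw [w₃, b15]; simp [Letter.evalWord]
  simp only [List.length_cons, List.length_nil] at l₁ l₂ l₃
  have hs : (r₃ 2).size ≤ digitBound p := by rw [c2]; exact size_le_digitBound (by omega)
  rcases Nat.eq_zero_or_pos (r 2) with h0 | h0
  · refine (Exec.ite_neg (n := 1) (by rw [c2, h0]) (Exec.skip r₃)).hoare ⟨?_, ?_⟩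
    · simp only [Letter.evalWord_append, w₁, w₂, w₃', a3, h0, pow_zero, List.append_nil, mul_one,
        mul_assoc]
    · simp only [List.length_append, List.length_nil]
      omega
  · have h1 : r 2 = 1 := by omega
    refine (Exec.ite_pos (n := 1) (by omega) hs (Exec.emit .v r₃)).hoare ⟨?_, ?_⟩
    · have : Letter.evalWord (ZMod p) [.v] = Letter.lower (ZMod p) := by
        simp [Letter.evalWord, Letter.eval]
      simp only [Letter.evalWord_append, w₁, w₂, w₃', a3, h1, pow_one, this, mul_assoc]
    · simp only [List.length_append, List.length_singleton]
      omega

/-- The program that finds a short word for an element of `SL(2, p)`. -/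
def wordProg : Prog :=
  .seq initProg (.seq pivotProg (.seq invProg (.seq (block coordBlock) outputProg)))

theorem hoare_wordProg {p : ℕ} (hp : p.Prime) (m : ℕ)
    (g : Matrix.SpecialLinearGroup (Fin 2) (ZMod p)) :
    Hoare (digitBound p) (trialProb m ^ 6) wordProg (input p g)
      (6 * conjSteps p m + 60 * p.size + 500) fun _ o =>
        Letter.evalWord (ZMod p) o = g ∧ o.length ≤ 12 * quotientBound p + 20 := by
  obtain ⟨r₁, e1, hr1, a⟩ := exec_initProg hp.pos (r := input p g) rfl
  obtain ⟨r₂, e2, hr2, h2, h3, hg⟩ := exec_pivotProg hp (g := g) hr1 (a 1 (by norm_num))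
    (a 2 (by norm_num)) (a 3 (by norm_num)) (a 4 (by norm_num))
  obtain ⟨r₃, e3, h13, hinv, c⟩ := exec_invProg hp hr2 hg.r3_le h3
  have hr3 : Env p r₃ := hr2.congr fun j hj _ _ _ _ _ => c j (by omega)
  have hg3 : Represents p r₃ (g * (Letter.lower (ZMod p) ^ r₂ 2)⁻¹) := by
    constructor <;> rw [c _ (by omega)]
    exacts [hg.r1, hg.r3, hg.r4, hg.r1_le, hg.r3_le, hg.r4_le]
  obtain ⟨r₄, e4, hr4, d2, l14, l3, l15, d14, d3, d15⟩ := exec_coordBlock hp hr3 hg3 h13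
  have c2 : r₃ 2 = r₂ 2 := c 2 (by norm_num)
  have h5 := hoare_outputProg hp m hr4 (by omega) l14 l3 l15
  rw [hg.r3] at hinv
  rw [d14, d3, d15, d2, c2, Letter.eq_unip_mul hinv, inv_mul_cancel_right] at h5
  refine ((e1.hoare (Post := fun r' o => r' = r₁ ∧ o = []) ⟨rfl, rfl⟩).seq
    (q₂ := 1 * (1 * (1 * trialProb m ^ 6)))
    (n₂ := 20 + ((30 * p.size + 20) + (20 + (6 * conjSteps p m + 150) + 1) + 1) + 1) ?_).mono
    (by simp) (by omega) fun _ _ h => h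
  rintro _ _ ⟨rfl, rfl⟩
  refine (e2.hoare (Post := fun r' o => r' = r₂ ∧ o = []) ⟨rfl, rfl⟩).seq ?_
  rintro _ _ ⟨rfl, rfl⟩
  refine (e3.hoare (Post := fun r' o => r' = r₃ ∧ o = []) ⟨rfl, rfl⟩).seq ?_
  rintro _ _ ⟨rfl, rfl⟩
  refine (e4.hoare (Post := fun r' o => r' = r₄ ∧ o = []) ⟨rfl, rfl⟩).seq ?_
  rintro _ _ ⟨rfl, rfl⟩
  simpa using h5

/-! ### The constants -/

theorem trialProb_eq (m : ℕ) : trialProb m = ENNReal.ofReal (1 - (1 / 2) ^ m) := by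
  induction m with
  | zero => simp [trialProb]
  | succ m ih =>
    have h : (0 : ℝ) ≤ 1 - (1 / 2) ^ m :=
      sub_nonneg.2 (pow_le_one₀ (by norm_num) (by norm_num))
    have h2 : (2⁻¹ : ℝ≥0∞) = ENNReal.ofReal (1 / 2) := by
      rw [one_div, ENNReal.ofReal_inv_of_pos (by norm_num)]; simp
    rw [trialProb, ih, h2, ← ENNReal.ofReal_mul (by norm_num),
      ← ENNReal.ofReal_add (by norm_num) (by positivity)]
    congr 1
    rw [pow_succ]; ring

theorem exists_le_trialProb {c : ℝ} (hc : c < 1) : ∃ m, ENNReal.ofReal c ≤ trialProb m ^ 6 := by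
  have h : Filter.Tendsto (fun m : ℕ => (1 - (1 / 2 : ℝ) ^ m) ^ 6) Filter.atTop (nhds 1) := by
    have := ((tendsto_pow_atTop_nhds_zero_of_lt_one (r := (1 / 2 : ℝ)) (by norm_num)
      (by norm_num)).const_sub 1).pow 6
    simpa using this
  obtain ⟨m, hm⟩ := (h.eventually (lt_mem_nhds hc)).exists
  refine ⟨m, ?_⟩
  rw [trialProb_eq, ← ENNReal.ofReal_pow (sub_nonneg.2 (pow_le_one₀ (by norm_num) (by norm_num)))]
  exact ENNReal.ofReal_le_ofReal hm.le

section RealBounds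

variable {p : ℕ}

theorem size_le_log (hp : 2 ≤ p) : (p.size : ℝ) ≤ 3 * Real.log p := by
  have h0 : 0 < p.size := Nat.size_pos.2 (by omega)
  have h1 : 2 ^ (p.size - 1) ≤ p := Nat.lt_size.1 (by omega)
  have h2 : ((p.size - 1 : ℕ) : ℝ) * Real.log 2 ≤ Real.log p := by
    rw [← Real.log_pow]
    exact Real.log_le_log (by positivity) (by exact_mod_cast h1)
  rw [Nat.cast_sub h0, Nat.cast_one] at h2
  have h3 : Real.log 2 ≤ Real.log p := Real.log_le_log (by norm_num) (by exact_mod_cast hp)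
  have h4 := Real.log_two_gt_d9
  have h5 : (1 : ℝ) ≤ p.size := by exact_mod_cast h0
  nlinarith

theorem one_lt_log_max : 1 < Real.log (max (p : ℝ) 3) := by
  rw [Real.lt_log_iff_exp_lt (by positivity)]
  exact lt_of_lt_of_le (Real.exp_one_lt_d9.trans (by norm_num)) (le_max_right _ _)

/-- Additive constants are absorbed using that `log log max(p, 3)` is at least `log log 3 > 0`; this
explains the quotient by `log log 3`. -/
theorem size_size_le (hp : 2 ≤ p) :
    (p.size.size : ℝ) ≤
      (2 + 6 / Real.log (Real.log 3)) * Real.log (Real.log (max (p : ℝ) 3)) := by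
  have hL1 := one_lt_log_max (p := p)
  set L := Real.log (max (p : ℝ) 3) with hL
  have h1 : (p.size : ℝ) ≤ 3 * L := (size_le_log hp).trans
    (mul_le_mul_of_nonneg_left (Real.log_le_log (by positivity) (le_max_left _ _)) (by norm_num))
  have h0 : 0 < p.size := Nat.size_pos.2 (by omega)
  have hss : 0 < p.size.size := Nat.size_pos.2 h0
  have h2 : 2 ^ (p.size.size - 1) ≤ p.size := Nat.lt_size.1 (by omega)
  have h3 : ((p.size.size - 1 : ℕ) : ℝ) * Real.log 2 ≤ Real.log 3 + Real.log L := by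
    rw [← Real.log_pow, ← Real.log_mul (by norm_num) (by positivity)]
    refine Real.log_le_log (by positivity) (le_trans ?_ h1)
    exact_mod_cast h2
  rw [Nat.cast_sub hss, Nat.cast_one] at h3
  have h4 := Real.log_two_gt_d9
  have h5 : Real.log 3 ≤ 2 := by
    have := Real.log_le_sub_one_of_pos (show (0 : ℝ) < 3 by norm_num)
    linarith
  have h6 : 1 < Real.log 3 := by simpa using one_lt_log_max (p := 0)
  have h7 : 0 < Real.log (Real.log 3) := Real.log_pos h6
  have h8 : Real.log (Real.log 3) ≤ Real.log L :=
    Real.log_le_log (by linarith) (Real.log_le_log (by norm_num) (le_max_right _ _))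
  have h9 : 6 ≤ 6 / Real.log (Real.log 3) * Real.log L := by
    rw [div_mul_eq_mul_div, le_div_iff₀ h7]
    nlinarith
  have h10 : (1 : ℝ) ≤ p.size.size := by exact_mod_cast hss
  nlinarith

/-- The step count is of order `p.size ^ 2` and the cost per step of order `p.size ^ 4`, as
registers have `O(p.size ^ 2)` digits. Hence the exponent `6`. -/
theorem steps_le (hp : 2 ≤ p) (m : ℕ) :
    (6 * conjSteps p m + 60 * p.size + 500) * (digitBound p + 1) ^ 2 ≤
      (2 ^ 75 * (m + 1)) * p.size ^ 6 := by
  have h0 : 1 ≤ p.size := Nat.size_pos.2 (by omega)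
  have h1 : p.size.size ≤ p.size := Nat.size_le.2 Nat.lt_two_pow_self
  have hsq : p.size ≤ p.size ^ 2 := by nlinarith
  have hone : 1 ≤ p.size ^ 2 := h0.trans hsq
  have h2 : digitBound p + 1 ≤ 200 * p.size ^ 2 := by
    unfold digitBound
    nlinarith
  have hQ : quotientBound p ≤ 2 ^ 50 * p.size ^ 2 := by
    unfold quotientBound
    rw [pow_two p.size]
    exact Nat.mul_le_mul_left _ (Nat.mul_le_mul_left _ h1)
  have hm : m * (100 * p.size + 50) ≤ m * (150 * p.size ^ 2) := Nat.mul_le_mul_left _ (by omega)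
  have h3 : 6 * conjSteps p m + 60 * p.size + 500 ≤ 2 ^ 56 * (m + 1) * p.size ^ 2 := by
    unfold conjSteps
    nlinarith [Nat.zero_le (m * p.size ^ 2)]
  calc _ ≤ (2 ^ 56 * (m + 1) * p.size ^ 2) * (200 * p.size ^ 2) ^ 2 :=
        Nat.mul_le_mul h3 (Nat.pow_le_pow_left h2 2)
    _ = (2 ^ 56 * 40000) * ((m + 1) * p.size ^ 6) := by ring
    _ ≤ 2 ^ 75 * ((m + 1) * p.size ^ 6) := Nat.mul_le_mul_right _ (by norm_num)
    _ = _ := by ring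

end RealBounds

end RandRAM

theorem theorem1 :
    ∃ (A : RandRAM.Prog) (c₁ c₂ : ℝ), ∀ c₃ : ℝ, c₃ < 1 → ∃ c₄ : ℝ,
      ∀ p : ℕ, p.Prime → ∀ g : Matrix.SpecialLinearGroup (Fin 2) (ZMod p),
        ENNReal.ofReal c₃ ≤
          RandRAM.successProb A (RandRAM.input p g) (c₄ * Real.log (p : ℝ) ^ c₂)
            {w : List Letter | Letter.evalWord (ZMod p) w = g ∧
              (w.length : ℝ) ≤
                c₁ * (Real.log (p : ℝ) * Real.log (Real.log (max (p : ℝ) 3)))} := by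
  refine ⟨RandRAM.wordProg, 2 ^ 60 * (2 + 6 / Real.log (Real.log 3)), 6, fun c₃ hc₃ => ?_⟩
  obtain ⟨m, hm⟩ := RandRAM.exists_le_trialProb hc₃
  -- The factor `3 ^ 6` comes from `p.size ≤ 3 * log p`; only `m` depends on `c₃`.
  refine ⟨2 ^ 75 * (m + 1) * 3 ^ 6, fun p hp g => ?_⟩
  have hp2 := hp.two_le
  have hsize := RandRAM.size_le_log hp2
  refine hm.trans ((RandRAM.hoare_wordProg hp m g).le_successProb ?_ ?_)
  · refine le_trans (Nat.cast_le.2 (RandRAM.steps_le hp2 m)) ?_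
    push_cast
    have h6 : Real.log (p : ℝ) ^ (6 : ℝ) = Real.log p ^ 6 := by
      rw [← Real.rpow_natCast]; norm_num
    rw [h6, mul_assoc _ ((3 : ℝ) ^ 6), ← mul_pow]
    gcongr
    norm_num
  · rintro _ o ⟨ho, hlen⟩
    refine ⟨ho, ?_⟩
    have hss := RandRAM.size_size_le hp2
    have h0 : 1 ≤ p.size := Nat.size_pos.2 (by omega)
    have h1 : 1 ≤ p.size.size := Nat.size_pos.2 h0
    have h2 : o.length ≤ 2 ^ 55 * (p.size * p.size.size) := by
      have : 1 ≤ p.size * p.size.size := Nat.mul_pos h0 h1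
      unfold quotientBound at hlen
      omega
    calc (o.length : ℝ) ≤ 2 ^ 55 * (p.size * p.size.size) := by exact_mod_cast h2
      _ ≤ 2 ^ 55 * ((3 * Real.log p) * ((2 + 6 / Real.log (Real.log 3)) *
            Real.log (Real.log (max (p : ℝ) 3)))) := by gcongr
      _ = (2 ^ 55 * 3) * ((2 + 6 / Real.log (Real.log 3)) * (Real.log p *
            Real.log (Real.log (max (p : ℝ) 3)))) := by ring
      _ ≤ 2 ^ 60 * ((2 + 6 / Real.log (Real.log 3)) * (Real.log p *
            Real.log (Real.log (max (p : ℝ) 3)))) := by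
          refine mul_le_mul_of_nonneg_right (by norm_num) ?_
          rw [mul_left_comm]
          exact mul_nonneg ((Nat.cast_nonneg _).trans (by linarith : (p.size : ℝ) ≤ 3 * Real.log p) |>
            fun h => by linarith) ((Nat.cast_nonneg _).trans hss)
      _ = _ := by ring
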